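/- Let $\mathfrak g=\mathfrak{osp}(1|4)$ be the complex Lie superalgebra of $5\times5$ matrices (rows and columns indexed $0,\dots,4$) $$\begin{pmatrix}0&a&a_1\\ a_1^t&b&c\\ -a^t&d&-b^t\end{pmatrix},\qquad a,a_1\in\mathbb C^{1\times2},\ b,c,d\in\mathbb C^{2\times 2},\ c,d \text{ symmetric},$$ with odd generators $b_k^+=\sqrt2(e_{0,2+k}+e_{k,0})$, $b_k^-=\sqrt2(e_{0,k}-e_{2+k,0})$ and Cartan elements $h_k=e_{k,k}-e_{2+k,2+k}$ ($k=1,2$). For real $p$ let $\mathcal P=\mathrm{span}\{\{b_j^+,b_k^-\},b_j^-,\{b_j^-,b_k^-\}\}$, let $\mathbb C|0\rangle$ be the one-dimensional $\mathcal P$-module with $b_j^-|0\rangle=0$ and $\{b_j^-,b_k^+\}|0\rangle=p\,\delta_{jk}|0\rangle$, let $\overline V(p)=\mathrm{Ind}_{\mathcal P}^{\mathfrak g}\mathbb C|0\rangle$, let $M(p)$ be its maximal proper submodule, and $V(p)=\overline V(p)/M(p)$, the representation with lowest weight $(\frac p2,\frac p2)$. A unirrep is an irreducible representation that has a positive definite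 Hermitian inner product with $(b_j^\pm)^\dagger=b_j^\mp$. The character of a representation is $\sum\mu_{j_1,j_2}x_1^{j_1}x_2^{j_2}$, where $\mu_{j_1,j_2}$ is the dimension of the space of vectors of weight $(j_1,j_2)$ for $(h_1,h_2)$. **Theorem.** Let $p\neq0$ be real. (1) $V(p)$ is a unirrep if and only if $p\ge1$. (2) If $p>1$, then $M(p)=0$, so $V(p)=\overline V(p)$, and $$\mathrm{char}\,V(p)=\frac{(x_1x_2)^{p/2}}{(1-x_1)(1-x_2)(1-x_1x_2)}.$$ (3) If $p=1$, then $M(1)\ne0$ and $$\mathrm{char}\,V(1)=\frac{(x_1x_2)^{1/2}}{(1-x_1)(1-x_2)}.$$ (4) If $p\ge 1$, then $V(p)$ has an inner product as above with $\langle0|0\rangle=1$, and an orthonormal basis of vectors $|m_{12},m_{22};m_{11})$ labelled by all integers with $m_{12}\ge m_{11}\ge m_{22}\ge0$ if $p>1$, and by those with moreover $m_{22}=0$ if $p=1$, such that $|0,0;0)=|0\rangle$ and, with vectors whose label is not in this set read as $0$, $$\begin{aligned} b_1^+|m)&=\sqrt{m_{11}-m_{22}+1}\,f_1(m_{12},m_{22})\,|m_{12}+1,m_{22};m_{11}+1)-\sqrt{m_{12}-m_{11}}\,f_2(m_{12},m_{22})\,|m_{12},m_{22}+1;m_{11}+1),\\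 b_2^+|m)&=\sqrt{m_{12}-m_{11}+1}\,f_1(m_{12},m_{22})\,|m_{12}+1,m_{22};m_{11})+\sqrt{m_{11}-m_{22}}\,f_2(m_{12},m_{22})\,|m_{12},m_{22}+1;m_{11}),\\ b_1^-|m)&=\sqrt{m_{11}-m_{22}}\,f_1(m_{12}-1,m_{22})\,|m_{12}-1,m_{22};m_{11}-1)-\sqrt{m_{12}-m_{11}+1}\,f_2(m_{12},m_{22}-1)\,|m_{12},m_{22}-1;m_{11}-1),\\ b_2^-|m)&=\sqrt{m_{12}-m_{11}}\,f_1(m_{12}-1,m_{22})\,|m_{12}-1,m_{22};m_{11})+\sqrt{m_{11}-m_{22}+1}\,f_2(m_{12},m_{22}-1)\,|m_{12},m_{22}-1;m_{11}), \end{aligned}$$ where, with $\mathcal E_j=1$ for $j$ even, $0$ for $j$ odd, and $\mathcal O_j=1-\mathcal E_j$, $$f_1(k,l)=(-1)^{l}\,\frac{(k+2+\mathcal E_{k}(p-2))^{1/2}}{(k-l+1+\mathcal O_{k-l})^{1/2}},\qquad f_2(k,l)=\frac{(l+1+\mathcal E_{l}(p-2))^{1/2}}{(k-l+1-\mathcal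 O_{k-l})^{1/2}}.$$ (5) For $p=1$, $V(1)$ with this inner product is the boson Fock space: there is a linear isometric isomorphism of $V(1)$ onto $\mathbb C[X_1,X_2]$, with inner product $\langle X_1^{k_1}X_2^{k_2},X_1^{l_1}X_2^{l_2}\rangle=\delta_{k_1l_1}\delta_{k_2l_2}\,k_1!\,k_2!$, that sends $|0\rangle$ to $1$, $b_j^+$ to multiplication by $X_j$ and $b_j^-$ to $\partial/\partial X_j$. -/

import Mathlib

open scoped Nat

noncomputable section

namespace Paraboson

/-! ### The Lie superalgebra `osp(1|2n)` -/

/-- Row and column indices `0; 1, …, n; n+1, …, 2n` of the `(1+2n) × (1+2n)` matrices. -/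
abbrev Idx (n : ℕ) : Type := Unit ⊕ (Fin n ⊕ Fin n)

/-- The index `0`. -/
abbrev i0 {n : ℕ} : Idx n := Sum.inl ()

/-- The index `j`, for `1 ≤ j ≤ n`. -/
abbrev iL {n : ℕ} (j : Fin n) : Idx n := Sum.inr (Sum.inl j)

/-- The index `n + j`, for `1 ≤ j ≤ n`. -/
abbrev iR {n : ℕ} (j : Fin n) : Idx n := Sum.inr (Sum.inr j)

/-- Matrices of the block form `(0, a, a₁; a₁ᵗ, b, c; -aᵗ, d, -bᵗ)` with `c`, `d` symmetric. -/
structure IsOsp {n : ℕ} (M : Matrix (Idx n) (Idx n) ℂ) : Prop where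
  h00 : M i0 i0 = 0
  hL0 : ∀ j, M (iL j) i0 = M i0 (iR j)
  hR0 : ∀ j, M (iR j) i0 = -M i0 (iL j)
  hRR : ∀ j k, M (iR j) (iR k) = -M (iL k) (iL j)
  hLR : ∀ j k, M (iL j) (iR k) = M (iL k) (iR j)
  hRL : ∀ j k, M (iR j) (iL k) = M (iR k) (iL j)

/-- The underlying complex vector space of `osp(1|2n)`. -/
def osp (n : ℕ) : Submodule ℂ (Matrix (Idx n) (Idx n) ℂ) where
  carrier := {M | IsOsp M}
  zero_mem' := by constructor <;> simp
  add_mem' := by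
    rintro M N hM hN
    constructor
    · simp [hM.h00, hN.h00]
    · intro j; simp [hM.hL0 j, hN.hL0 j]
    · intro j; simp [hM.hR0 j, hN.hR0 j]; ring
    · intro j k; simp [hM.hRR j k, hN.hRR j k]; ring
    · intro j k; simp [hM.hLR j k, hN.hLR j k]
    · intro j k; simp [hM.hRL j k, hN.hRL j k]
  smul_mem' := by
    rintro t M hM
    constructor
    · simp [hM.h00]
    · intro j; simp [hM.hL0 j]
    · intro j; simp [hM.hR0 j]
    · intro j k; simp [hM.hRR j k]
    · intro j k; simp [hM.hLR j k]
    · intro j k; simp [hM.hRL j k]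

/-- Even elements: `a = a₁ = 0`. -/
def IsEven {n : ℕ} (x : osp n) : Prop := ∀ i, x.1 i0 (Sum.inr i) = 0

/-- Odd elements: `b = c = d = 0`. -/
def IsOdd {n : ℕ} (x : osp n) : Prop := ∀ i j, x.1 (Sum.inr i) (Sum.inr j) = 0

theorem commutator_mem {n : ℕ} (x y : osp n) (hx : IsEven x) :
    x.1 * y.1 - y.1 * x.1 ∈ osp n := by
  obtain ⟨x, hX⟩ := x
  obtain ⟨y, hY⟩ := y
  have hX : IsOsp x := hX
  have hY : IsOsp y := hY
  have ha : ∀ j, x i0 (iL j) = 0 := fun j => hx (Sum.inl j)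
  have ha1 : ∀ j, x i0 (iR j) = 0 := fun j => hx (Sum.inr j)
  have hb : ∀ j, x (iL j) i0 = 0 := fun j => by rw [hX.hL0, ha1]
  have hb1 : ∀ j, x (iR j) i0 = 0 := fun j => by rw [hX.hR0, ha, neg_zero]
  have h0 : ∀ u v, x (Sum.inl u) (Sum.inl v) = 0 := fun _ _ => hX.h00
  have h0' : ∀ u v, y (Sum.inl u) (Sum.inl v) = 0 := fun _ _ => hY.h00
  constructor
  · simp [Matrix.mul_apply, ha, ha1, hb, hb1, h0]
  · intro j
    simp [Matrix.mul_apply, ha, ha1, hb, hb1, h0, h0', hX.hRR, hY.hL0, hY.hR0, hX.hLR _ j, mul_comm]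
  · intro j
    simp [Matrix.mul_apply, ha, ha1, hb, hb1, h0, h0', hX.hRR, hY.hL0, hY.hR0, hX.hRL _ j, mul_comm]
    abel
  · intro j k
    simp [Matrix.mul_apply, hb, ha, ha1, hb1, hX.hRR, hY.hRR, hX.hRL j, hY.hRL j,
      hX.hLR _ k, hY.hLR _ k, mul_comm]
    abel
  · intro j k
    simp [Matrix.mul_apply, hb, ha1, hX.hRR, hY.hRR, hX.hLR _ k, hY.hLR _ k,
      hX.hLR _ j, hY.hLR _ j, mul_comm]
    abel
  · intro j k
    simp [Matrix.mul_apply, ha, hb1, hX.hRR, hY.hRR, hX.hRL _ k, hY.hRL _ k,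
      hX.hRL _ j, hY.hRL _ j, mul_comm]
    abel

theorem anticommutator_mem {n : ℕ} (x y : osp n) (hx : IsOdd x) (hy : IsOdd y) :
    x.1 * y.1 + y.1 * x.1 ∈ osp n := by
  obtain ⟨x, hX⟩ := x
  obtain ⟨y, hY⟩ := y
  have hX : IsOsp x := hX
  have hY : IsOsp y := hY
  have hx' : ∀ i j, x (Sum.inr i) (Sum.inr j) = 0 := hx
  have hy' : ∀ i j, y (Sum.inr i) (Sum.inr j) = 0 := hy
  constructor
  · simp [Matrix.mul_apply, hX.h00, hY.h00, hX.hL0, hX.hR0, hY.hL0, hY.hR0, mul_comm]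
  · intro j
    simp [Matrix.mul_apply, hX.h00, hY.h00, hx', hy']
  · intro j
    simp [Matrix.mul_apply, hX.h00, hY.h00, hx', hy']
  · intro j k
    simp [Matrix.mul_apply, hx', hy', hX.hL0, hX.hR0, hY.hL0, hY.hR0, mul_comm]
  · intro j k
    simp [Matrix.mul_apply, hx', hy', hX.hL0, hY.hL0, mul_comm]
    abel
  · intro j k
    simp [Matrix.mul_apply, hx', hy', hX.hR0, hY.hR0, mul_comm]
    abel

/-- The superbracket `[x, y] = xy - yx`, for `x` even. -/
def evenBracket {n : ℕ} (x y : osp n) (hx : IsEven x) : osp n :=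
  ⟨x.1 * y.1 - y.1 * x.1, commutator_mem x y hx⟩

/-- The superbracket `[x, y] = {x, y} = xy + yx`, for `x` and `y` odd. -/
def oddBracket {n : ℕ} (x y : osp n) (hx : IsOdd x) (hy : IsOdd y) : osp n :=
  ⟨x.1 * y.1 + y.1 * x.1, anticommutator_mem x y hx hy⟩

/-- The odd root vector `b_k⁺ = √2 (e_{0,n+k} + e_{k,0})`. -/
def bPlus {n : ℕ} (k : Fin n) : osp n :=
  ⟨(Real.sqrt 2 : ℂ) • (Matrix.single i0 (iR k) 1 + Matrix.single (iL k) i0 1), by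
    constructor <;> intros <;> simp [Matrix.single_apply]⟩

/-- The odd root vector `b_k⁻ = √2 (e_{0,k} - e_{n+k,0})`. -/
def bMinus {n : ℕ} (k : Fin n) : osp n :=
  ⟨(Real.sqrt 2 : ℂ) • (Matrix.single i0 (iL k) 1 - Matrix.single (iR k) i0 1), by
    constructor <;> intros <;> simp [Matrix.single_apply]⟩

theorem isOdd_bPlus {n : ℕ} (k : Fin n) : IsOdd (bPlus k) := by
  intro i j; simp [bPlus]

theorem isOdd_bMinus {n : ℕ} (k : Fin n) : IsOdd (bMinus k) := by
  intro i j; simp [bMinus]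

/-- The Cartan element `h_j = e_{j,j} - e_{n+j,n+j}`. -/
def cartan {n : ℕ} (j : Fin n) : osp n :=
  ⟨Matrix.single (iL j) (iL j) 1 - Matrix.single (iR j) (iR j) 1, by
    constructor <;> intros <;> simp [Matrix.single_apply]; grind⟩

/-! ### The enveloping algebra and its modules -/

/-- The relations `xy - (-1)^{|x||y|} yx = [x, y]` (`x`, `y` homogeneous) of the universal
enveloping algebra. The case of odd `x` and even `y` is the first one up to sign. -/
inductive EnvRel (n : ℕ) : TensorAlgebra ℂ (osp n) → TensorAlgebra ℂ (osp n) → Prop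
  | even (x y : osp n) (hx : IsEven x) :
      EnvRel n (TensorAlgebra.ι ℂ x * TensorAlgebra.ι ℂ y - TensorAlgebra.ι ℂ y * TensorAlgebra.ι ℂ x)
        (TensorAlgebra.ι ℂ (evenBracket x y hx))
  | odd (x y : osp n) (hx : IsOdd x) (hy : IsOdd y) :
      EnvRel n (TensorAlgebra.ι ℂ x * TensorAlgebra.ι ℂ y + TensorAlgebra.ι ℂ y * TensorAlgebra.ι ℂ x)
        (TensorAlgebra.ι ℂ (oddBracket x y hx hy))

/-- The universal enveloping algebra `U(osp(1|2n))`; its left modules are the representations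
of `osp(1|2n)`. -/
def Env (n : ℕ) : Type := RingQuot (EnvRel n)

instance (n : ℕ) : Ring (Env n) := inferInstanceAs (Ring (RingQuot (EnvRel n)))

instance (n : ℕ) : Algebra ℂ (Env n) := inferInstanceAs (Algebra ℂ (RingQuot (EnvRel n)))

/-- The quotient map from the tensor algebra. -/
def envMk (n : ℕ) : TensorAlgebra ℂ (osp n) →ₐ[ℂ] Env n := RingQuot.mkAlgHom ℂ (EnvRel n)

/-- The canonical map `osp(1|2n) → U(osp(1|2n))`. -/
def toEnv (n : ℕ) : osp n →ₗ[ℂ] Env n := (envMk n).toLinearMap ∘ₗ TensorAlgebra.ι ℂ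

/-- The action of `b_j⁺` on a representation. -/
def actPlus {n : ℕ} {W : Type*} [AddCommGroup W] [Module (Env n) W] (j : Fin n) (v : W) : W :=
  toEnv n (bPlus j) • v

/-- The action of `b_j⁻` on a representation. -/
def actMinus {n : ℕ} {W : Type*} [AddCommGroup W] [Module (Env n) W] (j : Fin n) (v : W) : W :=
  toEnv n (bMinus j) • v

/-- A positive definite Hermitian inner product with `(b_j⁺)† = b_j⁻` (equivalently, by Hermitian
symmetry, `(b_j⁻)† = b_j⁺`). -/
def IsStarForm {n : ℕ} {W : Type*} [AddCommGroup W] [Module ℂ W] [Module (Env n) W]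
    (c : InnerProductSpace.Core ℂ W) : Prop :=
  ∀ (j : Fin n) (v w : W), c.inner (actPlus j v) w = c.inner v (actMinus j w)

/-- A unirrep: an irreducible representation carrying a positive definite Hermitian inner product
that satisfies the star conditions `(b_j^±)† = b_j^∓`. -/
def IsUnirrep (n : ℕ) (W : Type*) [AddCommGroup W] [Module ℂ W] [Module (Env n) W]
    [IsScalarTower ℂ (Env n) W] : Prop :=
  IsSimpleModule (Env n) W ∧ ∃ c : InnerProductSpace.Core ℂ W, IsStarForm (n := n) c

/-- The space of vectors of weight `μ`, that is `h_j v = μ_j v` for all `j`. -/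
def weightSpace {n : ℕ} (W : Type*) [AddCommGroup W] [Module ℂ W] [Module (Env n) W]
    [IsScalarTower ℂ (Env n) W] (μ : Fin n → ℂ) : Submodule ℂ W :=
  ⨅ j, Module.End.eigenspace (Module.toModuleEnd ℂ W (toEnv n (cartan j))) (μ j)

/-- `char W = x^s F(x)`: the space `W` is spanned by its weight spaces, these are
finite-dimensional, the one of weight `s + k` with `k ∈ ℕⁿ` has the coefficient of `x^k` in `F` as
its dimension, and there are no other weights. -/
structure HasChar {n : ℕ} (W : Type*) [AddCommGroup W] [Module ℂ W] [Module (Env n) W]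
    [IsScalarTower ℂ (Env n) W]
    (s : Fin n → ℂ) (F : MvPowerSeries (Fin n) ℚ) : Prop where
  iSup_eq_top : ⨆ μ : Fin n → ℂ, weightSpace W μ = ⊤
  finite : ∀ μ : Fin n → ℂ, FiniteDimensional ℂ (weightSpace W μ)
  dim : ∀ k : Fin n →₀ ℕ,
    (Module.finrank ℂ (weightSpace W (fun j => s j + (k j : ℂ))) : ℚ) = MvPowerSeries.coeff k F
  eq_bot : ∀ μ : Fin n → ℂ, (∀ k : Fin n →₀ ℕ, μ ≠ fun j => s j + (k j : ℂ)) →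
    weightSpace W μ = ⊥

/-! ### The representations `V̄(p)` and `V(p)` -/

/-- The parabolic subalgebra spanned by all `{b_j⁺, b_k⁻}`, `b_j⁻`, `{b_j⁻, b_k⁻}`. -/
def parabolic (n : ℕ) : Submodule ℂ (osp n) :=
  Submodule.span ℂ
    ((Set.range fun jk : Fin n × Fin n =>
        oddBracket (bPlus jk.1) (bMinus jk.2) (isOdd_bPlus _) (isOdd_bMinus _)) ∪
      (Set.range fun j : Fin n => bMinus j) ∪
      (Set.range fun jk : Fin n × Fin n =>
        oddBracket (bMinus jk.1) (bMinus jk.2) (isOdd_bMinus _) (isOdd_bMinus _)))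

/-- The linear functional by which the parabolic subalgebra acts on the vacuum: `p/2` times the
trace of the block `b`. -/
def vacuumChar (n : ℕ) (p : ℝ) : osp n →ₗ[ℂ] ℂ where
  toFun x := ((p : ℂ) / 2) * ∑ j : Fin n, x.1 (iL j) (iL j)
  map_add' x y := by simp [Finset.sum_add_distrib, mul_add]
  map_smul' t x := by simp [← Finset.mul_sum]; ring

/-- `b_j⁻ |0⟩ = 0`. -/
theorem vacuumChar_bMinus {n : ℕ} (p : ℝ) (j : Fin n) : vacuumChar n p (bMinus j) = 0 := by
  simp [vacuumChar, bMinus]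

/-- `{b_j⁻, b_k⁻} |0⟩ = 0`. -/
theorem vacuumChar_bMinus_bMinus {n : ℕ} (p : ℝ) (j k : Fin n) :
    vacuumChar n p (oddBracket (bMinus j) (bMinus k) (isOdd_bMinus _) (isOdd_bMinus _)) = 0 := by
  simp [vacuumChar, bMinus, oddBracket, Matrix.mul_apply]

/-- `{b_j⁺, b_k⁻} |0⟩ = p δ_{jk} |0⟩`. -/
theorem vacuumChar_bPlus_bMinus {n : ℕ} (p : ℝ) (j k : Fin n) :
    vacuumChar n p (oddBracket (bPlus j) (bMinus k) (isOdd_bPlus _) (isOdd_bMinus _)) =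
      if j = k then (p : ℂ) else 0 := by
  have h2 : (Real.sqrt 2 : ℂ) * (Real.sqrt 2 : ℂ) = 2 := by
    rw [← Complex.ofReal_mul, Real.mul_self_sqrt (by norm_num)]; norm_num
  simp [vacuumChar, bPlus, bMinus, oddBracket, Matrix.mul_apply, Matrix.single_apply]
  grind

/-- The left ideal of `U(osp(1|2n))` generated by all `x - χ(x)` with `x` in the parabolic
subalgebra, where `χ` is the vacuum character. -/
def vacuumIdeal (n : ℕ) (p : ℝ) : Submodule (Env n) (Env n) :=
  Submodule.span (Env n)
    ((fun x : osp n => toEnv n x - algebraMap ℂ (Env n) (vacuumChar n p x)) '' parabolic n)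

/-- The induced module `V̄(p) = Ind ℂ|0⟩ = U(osp(1|2n)) ⊗_{U(P)} ℂ|0⟩`, in its presentation as a
quotient of `U(osp(1|2n))`. -/
def Vbar (n : ℕ) (p : ℝ) : Type := Env n ⧸ vacuumIdeal n p

instance (n : ℕ) (p : ℝ) : AddCommGroup (Vbar n p) :=
  inferInstanceAs (AddCommGroup (Env n ⧸ vacuumIdeal n p))

instance (n : ℕ) (p : ℝ) : Module (Env n) (Vbar n p) :=
  inferInstanceAs (Module (Env n) (Env n ⧸ vacuumIdeal n p))

instance (n : ℕ) (p : ℝ) : Module ℂ (Vbar n p) :=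
  inferInstanceAs (Module ℂ (Env n ⧸ vacuumIdeal n p))

instance (n : ℕ) (p : ℝ) : IsScalarTower ℂ (Env n) (Vbar n p) :=
  inferInstanceAs (IsScalarTower ℂ (Env n) (Env n ⧸ vacuumIdeal n p))

/-- The quotient map `U(osp(1|2n)) → V̄(p)`; it sends `1` to the vacuum vector. -/
def toVbar (n : ℕ) (p : ℝ) : Env n →ₗ[Env n] Vbar n p := (vacuumIdeal n p).mkQ

/-- `M(p)`, the maximal proper submodule of `V̄(p)`: the sum of all proper submodules. -/
def maxSub (n : ℕ) (p : ℝ) : Submodule (Env n) (Vbar n p) :=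
  sSup {N : Submodule (Env n) (Vbar n p) | N ≠ ⊤}

/-- The representation `V(p) = V̄(p) / M(p)` of lowest weight `(p/2, …, p/2)`. -/
def V (n : ℕ) (p : ℝ) : Type := Vbar n p ⧸ maxSub n p

instance (n : ℕ) (p : ℝ) : AddCommGroup (V n p) :=
  inferInstanceAs (AddCommGroup (Vbar n p ⧸ maxSub n p))

instance (n : ℕ) (p : ℝ) : Module (Env n) (V n p) :=
  inferInstanceAs (Module (Env n) (Vbar n p ⧸ maxSub n p))

instance (n : ℕ) (p : ℝ) : Module ℂ (V n p) :=
  inferInstanceAs (Module ℂ (Vbar n p ⧸ maxSub n p))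

instance (n : ℕ) (p : ℝ) : IsScalarTower ℂ (Env n) (V n p) :=
  inferInstanceAs (IsScalarTower ℂ (Env n) (Vbar n p ⧸ maxSub n p))

/-- The quotient map `V̄(p) → V(p)`. -/
def toV (n : ℕ) (p : ℝ) : Vbar n p →ₗ[Env n] V n p := (maxSub n p).mkQ

/-- The vacuum vector `|0⟩` of `V(p)`. -/
def vac (n : ℕ) (p : ℝ) : V n p := toV n p (toVbar n p 1)

/-! ### The boson Fock space -/

/-- The `n`-boson Fock space, as the space of polynomials in `n` variables: `B_j⁺` is
multiplication by `X_j`, `B_j⁻` is `∂/∂X_j`, the vacuum is `1`, and the monomials are orthogonal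
with `⟨X^k, X^k⟩ = k_1! ⋯ k_n!`. -/
abbrev BosonFock (n : ℕ) : Type := MvPolynomial (Fin n) ℂ

/-- The creation operator `B_j⁺`. -/
def bosonPlus {n : ℕ} (j : Fin n) (f : BosonFock n) : BosonFock n := MvPolynomial.X j * f

/-- The annihilation operator `B_j⁻`. -/
def bosonMinus {n : ℕ} (j : Fin n) (f : BosonFock n) : BosonFock n := MvPolynomial.pderiv j f

/-- The inner product of the boson Fock space, conjugate-linear in the first argument. -/
def bosonInner {n : ℕ} (f g : BosonFock n) : ℂ :=
  ∑ k ∈ f.support, (∏ j : Fin n, ((k j)! : ℂ)) * starRingEnd ℂ (f.coeff k) * g.coeff k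

/-! ### The Gelfand–Zetlin basis for `n = 2` -/

/-- The even function `E_j`. -/
def evenFn (j : ℤ) : ℝ := if Even j then 1 else 0

/-- The odd function `O_j`. -/
def oddFn (j : ℤ) : ℝ := if Odd j then 1 else 0

/-- The function `f₁(m₁₂, m₂₂)`. -/
def f1 (p : ℝ) (m12 m22 : ℤ) : ℝ :=
  (-1 : ℝ) ^ m22 * Real.sqrt ((m12 : ℝ) + 2 + evenFn m12 * (p - 2)) /
    Real.sqrt ((m12 : ℝ) - m22 + 1 + oddFn (m12 - m22))

/-- The function `f₂(m₁₂, m₂₂)`. -/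
def f2 (p : ℝ) (m12 m22 : ℤ) : ℝ :=
  Real.sqrt ((m22 : ℝ) + 1 + evenFn m22 * (p - 2)) /
    Real.sqrt ((m12 : ℝ) - m22 + 1 - oddFn (m12 - m22))

/-- The patterns labelling the basis of `V(p)`: all Gelfand–Zetlin patterns
`m₁₂ ≥ m₁₁ ≥ m₂₂ ≥ 0`, for `p = 1` only those with `m₂₂ = 0`. -/
def IsPattern (p : ℝ) (m12 m22 m11 : ℤ) : Prop :=
  0 ≤ m22 ∧ m22 ≤ m11 ∧ m11 ≤ m12 ∧ (p = 1 → m22 = 0)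

/-- `e m₁₂ m₂₂ m₁₁` are the vectors of an orthonormal (for `c`) Gelfand–Zetlin basis of `V(p)`
starting at the vacuum, with the explicit action of `b_1^±`, `b_2^±` (here `b_j` has index `j - 1`).
Vectors whose label is not a pattern are zero. -/
structure IsGZBasis (p : ℝ) (c : InnerProductSpace.Core ℂ (V 2 p)) (e : ℤ → ℤ → ℤ → V 2 p) :
    Prop where
  eq_zero : ∀ m12 m22 m11 : ℤ, ¬IsPattern p m12 m22 m11 → e m12 m22 m11 = 0
  vacuum : e 0 0 0 = vac 2 p
  norm_one : ∀ m12 m22 m11 : ℤ, IsPattern p m12 m22 m11 →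
    c.inner (e m12 m22 m11) (e m12 m22 m11) = 1
  orthogonal : ∀ m12 m22 m11 m12' m22' m11' : ℤ, (m12, m22, m11) ≠ (m12', m22', m11') →
    c.inner (e m12 m22 m11) (e m12' m22' m11') = 0
  span_eq_top : Submodule.span ℂ {v | ∃ m12 m22 m11 : ℤ, v = e m12 m22 m11} = ⊤
  act1Plus : ∀ m12 m22 m11 : ℤ, IsPattern p m12 m22 m11 →
    actPlus (0 : Fin 2) (e m12 m22 m11) =
      ((Real.sqrt ((m11 : ℝ) - m22 + 1) * f1 p m12 m22 : ℝ) : ℂ) • e (m12 + 1) m22 (m11 + 1)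
      - ((Real.sqrt ((m12 : ℝ) - m11) * f2 p m12 m22 : ℝ) : ℂ) • e m12 (m22 + 1) (m11 + 1)
  act2Plus : ∀ m12 m22 m11 : ℤ, IsPattern p m12 m22 m11 →
    actPlus (1 : Fin 2) (e m12 m22 m11) =
      ((Real.sqrt ((m12 : ℝ) - m11 + 1) * f1 p m12 m22 : ℝ) : ℂ) • e (m12 + 1) m22 m11
      + ((Real.sqrt ((m11 : ℝ) - m22) * f2 p m12 m22 : ℝ) : ℂ) • e m12 (m22 + 1) m11
  act1Minus : ∀ m12 m22 m11 : ℤ, IsPattern p m12 m22 m11 →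
    actMinus (0 : Fin 2) (e m12 m22 m11) =
      ((Real.sqrt ((m11 : ℝ) - m22) * f1 p (m12 - 1) m22 : ℝ) : ℂ) • e (m12 - 1) m22 (m11 - 1)
      - ((Real.sqrt ((m12 : ℝ) - m11 + 1) * f2 p m12 (m22 - 1) : ℝ) : ℂ) •
        e m12 (m22 - 1) (m11 - 1)
  act2Minus : ∀ m12 m22 m11 : ℤ, IsPattern p m12 m22 m11 →
    actMinus (1 : Fin 2) (e m12 m22 m11) =
      ((Real.sqrt ((m12 : ℝ) - m11) * f1 p (m12 - 1) m22 : ℝ) : ℂ) • e (m12 - 1) m22 m11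
      + ((Real.sqrt ((m11 : ℝ) - m22 + 1) * f2 p m12 (m22 - 1) : ℝ) : ℂ) • e m12 (m22 - 1) m11

end Paraboson

end

/-! The odd generators of osp(1|2n) are n pairs of parabosons, and the triple relations of
`IsParaboson` determine all other brackets. Operators that satisfy them therefore give a
representation (`envLift`), and the enveloping algebra is generated by the b_j^± (`adjoin_eq_top`).
The theorem thus becomes a matter of writing down explicit operators.

The induced module is realised on polynomials in u, v, t (`Model`). The monomial u^i v^j t^l stands
for the pattern m₂₂ = l, m₁₁ = l + i, m₁₂ = l + i + j, and the operators are those of the theorem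
with the square roots removed by rescaling, so that the coefficients are rational functions of the
exponents and p, depending on parities (`isParaboson_laurent`). The monomial 1 generates this model
for every p (`mono_mem`). Conversely V̄(p) is spanned by the vectors (b₁⁺)^a {b₁⁺, b₂⁺}^d (b₂⁺)^b
|0⟩ (`span_raise_vbarVac`), which have the same weights as u^a v^b t^d. Since weight multiplicities
are finite, the surjection of V̄(p) onto the model is bijective (`toModel_injective`).

Unitarity forces p ≥ 1 because b₁⁺|0⟩ and (b₁⁺b₂⁺ − b₂⁺b₁⁺)|0⟩ have square lengths p and 4p(p − 1)
(`IsStarForm.one_le`). For the converse, orthogonal monomials of square length `normSq` make b_j⁺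
and b_j⁻ adjoint. These lengths are positive if p > 1 (`isStarForm_modelCore`). At p = 1 they vanish
for l > 0 and equal i! j! for l = 0, and setting t = 0 maps the model onto the boson Fock space
(`modelToFock`), whose inner product pulls back to this degenerate form
(`fockCore_modelToFock_mono`).

A homomorphism from V̄(p) into a module with a star form, not killing the vacuum, has kernel M(p)
(`ker_eq_maxSub`): a vector outside the kernel generates one with nonzero vacuum component, and
polynomials in the Euler operator isolate that component. So V(p) is the model for p > 1 and the
Fock space for p = 1. Both cases pass through `exists_equiv_of_model_quotient`, where the normalized
monomials become the Gelfand–Zetlin basis; the characters count monomials by weight. -/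

noncomputable section

namespace Paraboson

/-! ### Triple relations and the matrix generators -/

section

/-- The triple relations of `n` pairs of parabosons in an associative algebra. -/
structure IsParaboson {n : ℕ} {A : Type*} [Ring A] [Algebra ℂ A] (P M : Fin n → A) : Prop where
  pm_p : ∀ j k l, (P j * M k + M k * P j) * P l - P l * (P j * M k + M k * P j) =
    if k = l then (2 : ℂ) • P j else 0
  pm_m : ∀ j k l, (P j * M k + M k * P j) * M l - M l * (P j * M k + M k * P j) =
    if j = l then (-2 : ℂ) • M k else 0
  pp_p : ∀ j k l, (P j * P k + P k * P j) * P l - P l * (P j * P k + P k * P j) = 0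
  mm_m : ∀ j k l, (M j * M k + M k * M j) * M l - M l * (M j * M k + M k * M j) = 0

section
variable {n : ℕ} {A : Type*} [Ring A] [Algebra ℂ A] {P M : Fin n → A}

/-- The cyclic sum of [{x, y}, z] vanishes, which is the Jacobi identity for three odd elements. It
yields the two triple relations that `IsParaboson` leaves out. -/
theorem super_jacobi {A : Type*} [Ring A] (x y z : A) :
    (x * y + y * x) * z - z * (x * y + y * x) =
      -((y * z + z * y) * x - x * (y * z + z * y)) -
        ((x * z + z * x) * y - y * (x * z + z * x)) := by
  noncomm_ring

theorem IsParaboson.pp_m (h : IsParaboson P M) (j k l : Fin n) :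
    (P j * P k + P k * P j) * M l - M l * (P j * P k + P k * P j) =
      (if l = j then (-2 : ℂ) • P k else 0) + if l = k then (-2 : ℂ) • P j else 0 := by
  rw [super_jacobi, h.pm_p, h.pm_p]
  split_ifs <;> simp [sub_eq_add_neg]

theorem IsParaboson.mm_p (h : IsParaboson P M) (j k l : Fin n) :
    (M j * M k + M k * M j) * P l - P l * (M j * M k + M k * M j) =
      (if l = j then (2 : ℂ) • M k else 0) + if l = k then (2 : ℂ) • M j else 0 := by
  rw [super_jacobi, add_comm (M k * P l), add_comm (M j * P l), h.pm_m, h.pm_m]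
  split_ifs <;> simp [sub_eq_add_neg]

end

theorem single_mul_single_ite {m : Type*} [Fintype m] [DecidableEq m] (i j k l : m) (a b : ℂ) :
    Matrix.single i j a * Matrix.single k l b = if j = k then Matrix.single i l (a * b) else 0 := by
  split_ifs with h
  · subst h; simp
  · simp [Matrix.single_mul_single_of_ne _ _ _ _ h]

theorem sqrt_two_sq : (Real.sqrt 2 : ℂ) * (Real.sqrt 2 : ℂ) = 2 := by
  rw [← Complex.ofReal_mul, Real.mul_self_sqrt (by norm_num)]; norm_num

section
variable {n : ℕ}

theorem bPlus_mul_bMinus (j k : Fin n) :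
    (bPlus j).1 * (bMinus k).1 + (bMinus k).1 * (bPlus j).1 =
      (2 : ℂ) • (Matrix.single (iL j) (iL k) 1 - Matrix.single (iR k) (iR j) 1) := by
  simp only [bPlus, bMinus, Matrix.smul_mul, Matrix.mul_smul, smul_smul, sqrt_two_sq, ← smul_add]
  congr 1
  simp only [mul_add, add_mul, sub_mul, mul_sub, single_mul_single_ite]
  by_cases h : j = k
  · subst h; simp [sub_eq_add_neg]; abel
  · simp [h, Ne.symm h, sub_eq_add_neg]

theorem bPlus_mul_bPlus (j k : Fin n) :
    (bPlus j).1 * (bPlus k).1 + (bPlus k).1 * (bPlus j).1 =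
      (2 : ℂ) • (Matrix.single (iL j) (iR k) 1 + Matrix.single (iL k) (iR j) 1) := by
  simp only [bPlus, Matrix.smul_mul, Matrix.mul_smul, smul_smul, sqrt_two_sq, ← smul_add]
  congr 1
  simp only [mul_add, add_mul, single_mul_single_ite]
  simp

theorem bMinus_mul_bMinus (j k : Fin n) :
    (bMinus j).1 * (bMinus k).1 + (bMinus k).1 * (bMinus j).1 =
      (-2 : ℂ) • (Matrix.single (iR j) (iL k) 1 + Matrix.single (iR k) (iL j) 1) := by
  simp only [bMinus, Matrix.smul_mul, Matrix.mul_smul, smul_smul, sqrt_two_sq, ← smul_add]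
  rw [neg_smul, ← smul_neg]
  congr 1
  simp only [sub_mul, mul_sub, single_mul_single_ite]
  simp [add_comm]

/-- The odd generators of `osp(1|2n)` are parabosons. -/
theorem isParaboson_matrix :
    IsParaboson (fun j : Fin n => (bPlus j).1) (fun j : Fin n => (bMinus j).1) := by
  constructor <;> intro j k l
  · simp only [bPlus_mul_bMinus]
    simp only [bPlus, Matrix.smul_mul, Matrix.mul_smul, mul_add, add_mul, sub_mul, mul_sub,
      single_mul_single_ite]
    by_cases h : k = l
    · subst h; simp [mul_comm, add_comm]
    · simp [h, Ne.symm h]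
  · simp only [bPlus_mul_bMinus]
    simp only [bMinus, Matrix.smul_mul, Matrix.mul_smul, sub_mul, mul_sub, single_mul_single_ite]
    by_cases h : j = l
    · subst h; simp [smul_sub, mul_comm]; abel
    · simp [h, Ne.symm h]
  · simp [bPlus, mul_add, add_mul]
  · simp [bMinus, mul_add, add_mul, sub_mul, mul_sub]

end

section
variable {n : ℕ} {A : Type*} [Ring A] [Algebra ℂ A] {P M : Fin n → A}

/-- The linear extension to `osp(1|2n)` (written for all matrices) of `b_j⁺ ↦ P j`,
`b_j⁻ ↦ M j` that respects anticommutators of generators. -/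
def ospExtend (P M : Fin n → A) : Matrix (Idx n) (Idx n) ℂ →ₗ[ℂ] A :=
  (∑ j, ((Real.sqrt 2 : ℂ)⁻¹ • (Matrix.entryLinearMap ℂ ℂ i0 (iR j)).smulRight (P j) +
      (Real.sqrt 2 : ℂ)⁻¹ • (Matrix.entryLinearMap ℂ ℂ i0 (iL j)).smulRight (M j))) +
    ∑ j, ∑ k,
      -- The factors invert the anticommutators of the matrix generators. It is 4⁻¹ for the
      -- symmetric blocks because the sum over ordered pairs meets each off-diagonal pair twice,
      -- while on the diagonal the anticommutator itself doubles.
      ((2 : ℂ)⁻¹ • (Matrix.entryLinearMap ℂ ℂ (iL j) (iL k)).smulRight (P j * M k + M k * P j) +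
      (4 : ℂ)⁻¹ • (Matrix.entryLinearMap ℂ ℂ (iL j) (iR k)).smulRight (P j * P k + P k * P j) -
      (4 : ℂ)⁻¹ • (Matrix.entryLinearMap ℂ ℂ (iR j) (iL k)).smulRight (M j * M k + M k * M j))

theorem ospExtend_apply (P M : Fin n → A) (x : Matrix (Idx n) (Idx n) ℂ) :
    ospExtend P M x =
      (∑ j, (((Real.sqrt 2 : ℂ)⁻¹ * x i0 (iR j)) • P j +
        ((Real.sqrt 2 : ℂ)⁻¹ * x i0 (iL j)) • M j)) +
      ∑ j, ∑ k, (((2 : ℂ)⁻¹ * x (iL j) (iL k)) • (P j * M k + M k * P j) +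
        ((4 : ℂ)⁻¹ * x (iL j) (iR k)) • (P j * P k + P k * P j) -
        ((4 : ℂ)⁻¹ * x (iR j) (iL k)) • (M j * M k + M k * M j)) := by
  simp [ospExtend, smul_smul]

theorem ospExtend_bPlus (P M : Fin n → A) (l : Fin n) : ospExtend P M (bPlus l).1 = P l := by
  rw [ospExtend_apply]
  simp [bPlus, Matrix.single_apply]

theorem ospExtend_bMinus (P M : Fin n → A) (l : Fin n) : ospExtend P M (bMinus l).1 = M l := by
  rw [ospExtend_apply]
  simp [bMinus, Matrix.single_apply]

theorem ospExtend_bPlus_bMinus (P M : Fin n → A) (j k : Fin n) :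
    ospExtend P M ((bPlus j).1 * (bMinus k).1 + (bMinus k).1 * (bPlus j).1) =
      P j * M k + M k * P j := by
  rw [bPlus_mul_bMinus, ospExtend_apply]
  simp [Matrix.single_apply, ite_and, Finset.sum_add_distrib]

theorem ospExtend_bPlus_bPlus (P M : Fin n → A) (j k : Fin n) :
    ospExtend P M ((bPlus j).1 * (bPlus k).1 + (bPlus k).1 * (bPlus j).1) =
      P j * P k + P k * P j := by
  rw [bPlus_mul_bPlus, ospExtend_apply]
  simp [Matrix.single_apply, ite_and, mul_add, add_smul, Finset.sum_add_distrib]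
  module

theorem ospExtend_bMinus_bMinus (P M : Fin n → A) (j k : Fin n) :
    ospExtend P M ((bMinus j).1 * (bMinus k).1 + (bMinus k).1 * (bMinus j).1) =
      M j * M k + M k * M j := by
  rw [bMinus_mul_bMinus, ospExtend_apply]
  simp [Matrix.single_apply, ite_and, mul_add, add_smul, Finset.sum_add_distrib]
  module

/-- Every element of `osp(1|2n)` is recovered from its blocks. -/
theorem ospExtend_self (x : osp n) :
    ospExtend (fun j : Fin n => (bPlus j).1) (fun j => (bMinus j).1) x.1 = x.1 := by
  obtain ⟨x, hx⟩ := x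
  have hx : IsOsp x := hx
  rw [ospExtend_apply]
  simp only [bPlus_mul_bMinus, bPlus_mul_bPlus, bMinus_mul_bMinus]
  have h0 : ∀ z : ℂ, (Real.sqrt 2 : ℂ)⁻¹ * z * Real.sqrt 2 = z := fun z => by
    field_simp
  have h2 : ∀ z : ℂ, 2⁻¹ * z * 2 = z := fun z => by ring
  have h4 : ∀ z : ℂ, 4⁻¹ * z * 2 + 4⁻¹ * z * 2 = z := fun z => by ring
  ext i j
  rcases i with ⟨⟩ | i | i <;> rcases j with ⟨⟩ | j | j <;>
    simp [Matrix.sum_apply, Matrix.single_apply, bPlus, bMinus, ite_and, hx.h00, hx.hL0, hx.hR0,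
      hx.hRR, Finset.sum_add_distrib, h0, h2]
  · rw [hx.hLR j i, h4]
  · rw [hx.hRL j i, h4]

end

end

/-! ### The enveloping algebra as the algebra of parabosons -/

section

section
variable {n : ℕ}

/-- The odd generators `b_j^±` as matrices. -/
def oddGen (n : ℕ) : Set (Matrix (Idx n) (Idx n) ℂ) :=
  (Set.range fun j : Fin n => (bPlus j).1) ∪ Set.range fun j : Fin n => (bMinus j).1

/-- The anticommutators of the odd generators. -/
def evenGen (n : ℕ) : Set (Matrix (Idx n) (Idx n) ℂ) :=
  (Set.range fun jk : Fin n × Fin n =>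
      (bPlus jk.1).1 * (bMinus jk.2).1 + (bMinus jk.2).1 * (bPlus jk.1).1) ∪
    (Set.range fun jk : Fin n × Fin n =>
      (bPlus jk.1).1 * (bPlus jk.2).1 + (bPlus jk.2).1 * (bPlus jk.1).1) ∪
    Set.range fun jk : Fin n × Fin n =>
      (bMinus jk.1).1 * (bMinus jk.2).1 + (bMinus jk.2).1 * (bMinus jk.1).1

theorem exists_of_mem_evenGen {z : Matrix (Idx n) (Idx n) ℂ} (hz : z ∈ evenGen n) :
    ∃ u ∈ oddGen n, ∃ v ∈ oddGen n, z = u * v + v * u := by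
  rcases hz with (⟨⟨j, k⟩, rfl⟩ | ⟨⟨j, k⟩, rfl⟩) | ⟨⟨j, k⟩, rfl⟩
  · exact ⟨_, Or.inl ⟨j, rfl⟩, _, Or.inr ⟨k, rfl⟩, rfl⟩
  · exact ⟨_, Or.inl ⟨j, rfl⟩, _, Or.inl ⟨k, rfl⟩, rfl⟩
  · exact ⟨_, Or.inr ⟨j, rfl⟩, _, Or.inr ⟨k, rfl⟩, rfl⟩

/-- The expansion in `ospExtend_self` already separates the generators from their anticommutators.
The two parity clauses place homogeneous elements in a single span, so that brackets can be checked
on generators. -/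
theorem osp_eq_add (x : osp n) :
    ∃ y ∈ Submodule.span ℂ (oddGen n), ∃ z ∈ Submodule.span ℂ (evenGen n),
      x.1 = y + z ∧ (IsOdd x → z = 0) ∧ (IsEven x → y = 0) := by
  have h := ospExtend_self x
  rw [ospExtend_apply] at h
  refine ⟨_, ?_, _, ?_, h.symm, fun hx => ?_, fun hx => ?_⟩
  · refine Submodule.sum_mem _ fun j _ => Submodule.add_mem _ ?_ ?_
    · exact Submodule.smul_mem _ _ (Submodule.subset_span (Or.inl ⟨j, rfl⟩))
    · exact Submodule.smul_mem _ _ (Submodule.subset_span (Or.inr ⟨j, rfl⟩))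
  · refine Submodule.sum_mem _ fun j _ => Submodule.sum_mem _ fun k _ =>
      Submodule.sub_mem _ (Submodule.add_mem _ ?_ ?_) ?_
    · exact Submodule.smul_mem _ _ (Submodule.subset_span (Or.inl (Or.inl ⟨(j, k), rfl⟩)))
    · exact Submodule.smul_mem _ _ (Submodule.subset_span (Or.inl (Or.inr ⟨(j, k), rfl⟩)))
    · exact Submodule.smul_mem _ _ (Submodule.subset_span (Or.inr ⟨(j, k), rfl⟩))
  · have h' : ∀ i j, x.1 (Sum.inr i) (Sum.inr j) = 0 := hx
    simp [h']
  · have h' : ∀ i, x.1 i0 (Sum.inr i) = 0 := hx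
    simp [h']

theorem IsOdd.mem_span {x : osp n} (hx : IsOdd x) : x.1 ∈ Submodule.span ℂ (oddGen n) := by
  obtain ⟨y, hy, z, hz, h, h1, -⟩ := osp_eq_add x
  rwa [h, h1 hx, add_zero]

theorem IsEven.mem_span {x : osp n} (hx : IsEven x) : x.1 ∈ Submodule.span ℂ (evenGen n) := by
  obtain ⟨y, hy, z, hz, h, -, h1⟩ := osp_eq_add x
  rwa [h, h1 hx, zero_add]

variable {A : Type*} [Ring A] [Algebra ℂ A] {P M : Fin n → A}

/-- By bilinearity only pairs of generators matter, and there `ospExtend` was defined to make this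
true. No triple relation is involved. -/
theorem ospExtend_anticommutator (P M : Fin n → A) {x y : Matrix (Idx n) (Idx n) ℂ}
    (hx : x ∈ Submodule.span ℂ (oddGen n)) (hy : y ∈ Submodule.span ℂ (oddGen n)) :
    ospExtend P M (x * y + y * x) =
      ospExtend P M x * ospExtend P M y + ospExtend P M y * ospExtend P M x := by
  induction hx, hy using Submodule.span_induction₂ with
  | mem_mem x y hx hy =>
    rcases hx with ⟨j, rfl⟩ | ⟨j, rfl⟩ <;> rcases hy with ⟨k, rfl⟩ | ⟨k, rfl⟩
    · simp [ospExtend_bPlus_bPlus, ospExtend_bPlus]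
    · simp [ospExtend_bPlus_bMinus, ospExtend_bPlus, ospExtend_bMinus]
    · simp only
      rw [add_comm, ospExtend_bPlus_bMinus, ospExtend_bPlus, ospExtend_bMinus, add_comm]
    · simp [ospExtend_bMinus_bMinus, ospExtend_bMinus]
  | zero_left y hy => simp
  | zero_right x hx => simp
  | add_left x y z hx hy hz h1 h2 =>
    rw [show (x + y) * z + z * (x + y) = (x * z + z * x) + (y * z + z * y) by noncomm_ring,
      map_add, h1, h2, map_add]
    noncomm_ring
  | add_right x y z hx hy hz h1 h2 =>
    rw [show x * (y + z) + (y + z) * x = (x * y + y * x) + (x * z + z * x) by noncomm_ring,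
      map_add, h1, h2, map_add]
    noncomm_ring
  | smul_left r x y hx hy h =>
    rw [Matrix.smul_mul, Matrix.mul_smul, ← smul_add, map_smul, h]; simp
  | smul_right r x y hx hy h =>
    rw [Matrix.smul_mul, Matrix.mul_smul, ← smul_add, map_smul, h]; simp

/-- The six cases are the six triple relations, used once for matrices and once in `A`. Membership
in the odd span is recorded so that these commutators can be fed back into
`ospExtend_anticommutator`. -/
theorem commutator_evenGen_oddGen (h : IsParaboson P M) {x y : Matrix (Idx n) (Idx n) ℂ}
    (hx : x ∈ evenGen n) (hy : y ∈ oddGen n) :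
    x * y - y * x ∈ Submodule.span ℂ (oddGen n) ∧
      ospExtend P M (x * y - y * x) =
        ospExtend P M x * ospExtend P M y - ospExtend P M y * ospExtend P M x := by
  have hP (j : Fin n) : (bPlus j).1 ∈ Submodule.span ℂ (oddGen n) :=
    Submodule.subset_span (Or.inl ⟨j, rfl⟩)
  have hM (j : Fin n) : (bMinus j).1 ∈ Submodule.span ℂ (oddGen n) :=
    Submodule.subset_span (Or.inr ⟨j, rfl⟩)
  have hm := isParaboson_matrix (n := n)
  rcases hx with (⟨⟨j, k⟩, rfl⟩ | ⟨⟨j, k⟩, rfl⟩) | ⟨⟨j, k⟩, rfl⟩ <;>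
    rcases hy with ⟨l, rfl⟩ | ⟨l, rfl⟩ <;> simp only
  · rw [hm.pm_p, ospExtend_bPlus_bMinus, ospExtend_bPlus, h.pm_p]
    split_ifs <;> simp [ospExtend_bPlus, hP, -neg_smul]
  · rw [hm.pm_m, ospExtend_bPlus_bMinus, ospExtend_bMinus, h.pm_m]
    split_ifs <;> simp [ospExtend_bMinus, Submodule.smul_mem, hM, -neg_smul]
  · rw [hm.pp_p, ospExtend_bPlus_bPlus, ospExtend_bPlus, h.pp_p]
    simp
  · rw [hm.pp_m, ospExtend_bPlus_bPlus, ospExtend_bMinus, h.pp_m]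
    split_ifs <;> simp [ospExtend_bPlus, Submodule.smul_mem, Submodule.add_mem, hP, -neg_smul]
  · rw [hm.mm_p, ospExtend_bMinus_bMinus, ospExtend_bPlus, h.mm_p]
    split_ifs <;> simp [ospExtend_bMinus, Submodule.add_mem, hM, -neg_smul]
  · rw [hm.mm_m, ospExtend_bMinus_bMinus, ospExtend_bMinus, h.mm_m]
    simp

theorem commutator_even_odd (h : IsParaboson P M) {x y : Matrix (Idx n) (Idx n) ℂ}
    (hx : x ∈ Submodule.span ℂ (evenGen n)) (hy : y ∈ Submodule.span ℂ (oddGen n)) :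
    x * y - y * x ∈ Submodule.span ℂ (oddGen n) ∧
      ospExtend P M (x * y - y * x) =
        ospExtend P M x * ospExtend P M y - ospExtend P M y * ospExtend P M x := by
  induction hx, hy using Submodule.span_induction₂ with
  | mem_mem x y hx hy => exact commutator_evenGen_oddGen h hx hy
  | zero_left y hy => simp
  | zero_right x hx => simp
  | add_left x y z hx hy hz h1 h2 =>
    rw [map_add, add_mul, mul_add, add_mul, mul_add,
      add_sub_add_comm, map_add, h1.2, h2.2, add_sub_add_comm]
    exact ⟨Submodule.add_mem _ h1.1 h2.1, rfl⟩
  | add_right x y z hx hy hz h1 h2 =>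
    rw [map_add, add_mul, mul_add, add_mul, mul_add,
      add_sub_add_comm, map_add, h1.2, h2.2, add_sub_add_comm]
    exact ⟨Submodule.add_mem _ h1.1 h2.1, rfl⟩
  | smul_left r x y hx hy h =>
    rw [Matrix.smul_mul, Matrix.mul_smul, ← smul_sub, map_smul, h.2]
    exact ⟨Submodule.smul_mem _ _ h.1, by simp [smul_sub]⟩
  | smul_right r x y hx hy h =>
    rw [Matrix.smul_mul, Matrix.mul_smul, ← smul_sub, map_smul, h.2]
    exact ⟨Submodule.smul_mem _ _ h.1, by simp [smul_sub]⟩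

theorem commutator_anticommutator {B : Type*} [Ring B] (x u v : B) :
    x * (u * v + v * u) - (u * v + v * u) * x =
      ((x * u - u * x) * v + v * (x * u - u * x)) +
        (u * (x * v - v * x) + (x * v - v * x) * u) := by
  noncomm_ring

/-- An even generator is an anticommutator {u, v} of odd ones, and commutation with x acts on {u, v}
as a derivation. This reduces the claim to commutators of even with odd elements. -/
theorem commutator_even_even (h : IsParaboson P M) {x y : Matrix (Idx n) (Idx n) ℂ}
    (hx : x ∈ Submodule.span ℂ (evenGen n)) (hy : y ∈ Submodule.span ℂ (evenGen n)) :
    ospExtend P M (x * y - y * x) =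
      ospExtend P M x * ospExtend P M y - ospExtend P M y * ospExtend P M x := by
  induction hy using Submodule.span_induction with
  | mem y hy =>
    obtain ⟨u, hu, v, hv, rfl⟩ := exists_of_mem_evenGen hy
    replace hu := Submodule.subset_span (R := ℂ) hu
    replace hv := Submodule.subset_span (R := ℂ) hv
    have h1 := commutator_even_odd h hx hu
    have h2 := commutator_even_odd h hx hv
    rw [commutator_anticommutator x u v, map_add, ospExtend_anticommutator _ _ h1.1 hv,
      ospExtend_anticommutator _ _ hu h2.1, h1.2, h2.2, ospExtend_anticommutator _ _ hu hv,
      commutator_anticommutator]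
  | zero => simp
  | add y z hy hz h1 h2 =>
    rw [map_add, add_mul, mul_add, add_mul, mul_add,
      add_sub_add_comm, map_add, h1, h2, add_sub_add_comm]
  | smul r y hy h =>
    rw [Matrix.smul_mul, Matrix.mul_smul, ← smul_sub, map_smul, h]
    simp [smul_sub]

theorem commutator_even (h : IsParaboson P M) (x y : osp n) (hx : IsEven x) :
    ospExtend P M (x.1 * y.1 - y.1 * x.1) =
      ospExtend P M x.1 * ospExtend P M y.1 - ospExtend P M y.1 * ospExtend P M x.1 := by
  obtain ⟨y1, hy1, y0, hy0, hy, -, -⟩ := osp_eq_add y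
  rw [hy, map_add, add_mul, mul_add, add_mul, mul_add, add_sub_add_comm, map_add,
    (commutator_even_odd h hx.mem_span hy1).2, commutator_even_even h hx.mem_span hy0,
    add_sub_add_comm]

/-- Parabosons in an algebra extend to the enveloping algebra of `osp(1|2n)`. -/
def envLift (h : IsParaboson P M) : Env n →ₐ[ℂ] A :=
  RingQuot.liftAlgHom ℂ ⟨TensorAlgebra.lift ℂ (ospExtend P M ∘ₗ (osp n).subtype), by
    intro a b hab
    induction hab with
    | even x y hx => simp [evenBracket, commutator_even h x y hx]
    | odd x y hx hy =>
      simp [oddBracket, ospExtend_anticommutator P M hx.mem_span hy.mem_span]⟩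

theorem envLift_toEnv (h : IsParaboson P M) (x : osp n) :
    envLift h (toEnv n x) = ospExtend P M x.1 := by
  simp only [envLift, toEnv, envMk, LinearMap.comp_apply]
  erw [RingQuot.liftAlgHom_mkAlgHom_apply]
  simp

@[simp] theorem envLift_bPlus (h : IsParaboson P M) (j : Fin n) :
    envLift h (toEnv n (bPlus j)) = P j := by
  rw [envLift_toEnv, ospExtend_bPlus]

@[simp] theorem envLift_bMinus (h : IsParaboson P M) (j : Fin n) :
    envLift h (toEnv n (bMinus j)) = M j := by
  rw [envLift_toEnv, ospExtend_bMinus]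

end

section
variable {n : ℕ}

theorem toEnv_evenBracket (x y : osp n) (hx : IsEven x) :
    toEnv n (evenBracket x y hx) = toEnv n x * toEnv n y - toEnv n y * toEnv n x := by
  have := RingQuot.mkAlgHom_rel ℂ (EnvRel.even x y hx)
  rw [map_sub, map_mul, map_mul] at this
  exact this.symm

theorem toEnv_oddBracket (x y : osp n) (hx : IsOdd x) (hy : IsOdd y) :
    toEnv n (oddBracket x y hx hy) = toEnv n x * toEnv n y + toEnv n y * toEnv n x := by
  have := RingQuot.mkAlgHom_rel ℂ (EnvRel.odd x y hx hy)
  rw [map_add, map_mul, map_mul] at this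
  exact this.symm

theorem isEven_oddBracket (x y : osp n) (hx : IsOdd x) (hy : IsOdd y) :
    IsEven (oddBracket x y hx hy) := by
  intro i
  simp [oddBracket, Matrix.mul_apply, (show IsOsp x.1 from x.2).h00,
    (show IsOsp y.1 from y.2).h00, hx _ _, hy _ _]

/-- The odd generators of the enveloping algebra are parabosons. -/
theorem isParaboson_toEnv :
    IsParaboson (fun j : Fin n => toEnv n (bPlus j)) (fun j : Fin n => toEnv n (bMinus j)) := by
  have key (x y z w : osp n) (hx : IsOdd x) (hy : IsOdd y)
      (h : (x.1 * y.1 + y.1 * x.1) * z.1 - z.1 * (x.1 * y.1 + y.1 * x.1) = w.1) :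
      (toEnv n x * toEnv n y + toEnv n y * toEnv n x) * toEnv n z -
        toEnv n z * (toEnv n x * toEnv n y + toEnv n y * toEnv n x) = toEnv n w := by
    rw [← toEnv_oddBracket x y hx hy, ← toEnv_evenBracket _ _ (isEven_oddBracket x y hx hy)]
    exact congrArg _ (Subtype.ext h)
  have hm := isParaboson_matrix (n := n)
  constructor <;> intro j k l
  · rw [key _ _ _ (if k = l then (2 : ℂ) • bPlus j else 0) (isOdd_bPlus j) (isOdd_bMinus k)]
    · split_ifs <;> simp
    · rw [hm.pm_p]; split_ifs <;> simp
  · rw [key _ _ _ (if j = l then (-2 : ℂ) • bMinus k else 0) (isOdd_bPlus j) (isOdd_bMinus k)]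
    · split_ifs <;> simp
    · rw [hm.pm_m]; split_ifs <;> simp
  · rw [key _ _ _ 0 (isOdd_bPlus j) (isOdd_bPlus k), map_zero]
    rw [hm.pp_p]; simp
  · rw [key _ _ _ 0 (isOdd_bMinus j) (isOdd_bMinus k), map_zero]
    rw [hm.mm_m]; simp

/-- The enveloping algebra is generated by the `b_j^±`. -/
theorem adjoin_eq_top :
    Algebra.adjoin ℂ ((Set.range fun j : Fin n => toEnv n (bPlus j)) ∪
      Set.range fun j : Fin n => toEnv n (bMinus j)) = ⊤ := by
  set S := Algebra.adjoin ℂ ((Set.range fun j : Fin n => toEnv n (bPlus j)) ∪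
      Set.range fun j : Fin n => toEnv n (bMinus j)) with hS
  have hP (j : Fin n) : toEnv n (bPlus j) ∈ S := Algebra.subset_adjoin (Or.inl ⟨j, rfl⟩)
  have hM (j : Fin n) : toEnv n (bMinus j) ∈ S := Algebra.subset_adjoin (Or.inr ⟨j, rfl⟩)
  have h1 (x : osp n) : toEnv n x ∈ S := by
    -- The spans are spans of matrices, while `toEnv` is defined on the subtype. Pushing the claim
    -- forward to matrices lets the two be compared.
    have hx : x ∈ Submodule.comap (osp n).subtype
        (Submodule.map (osp n).subtype ((Subalgebra.toSubmodule S).comap (toEnv n))) := by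
      obtain ⟨y, hy, z, hz, h, -, -⟩ := osp_eq_add x
      rw [Submodule.mem_comap, Submodule.subtype_apply, h]
      refine Submodule.add_mem _ (Submodule.span_le.2 ?_ hy) (Submodule.span_le.2 ?_ hz)
      · rintro _ (⟨j, rfl⟩ | ⟨j, rfl⟩)
        · exact ⟨_, hP j, rfl⟩
        · exact ⟨_, hM j, rfl⟩
      · rintro _ ((⟨⟨j, k⟩, rfl⟩ | ⟨⟨j, k⟩, rfl⟩) | ⟨⟨j, k⟩, rfl⟩)
        · refine ⟨oddBracket _ _ (isOdd_bPlus j) (isOdd_bMinus k), ?_, rfl⟩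
          simp [toEnv_oddBracket, add_mem, mul_mem, hP, hM]
        · refine ⟨oddBracket _ _ (isOdd_bPlus j) (isOdd_bPlus k), ?_, rfl⟩
          simp [toEnv_oddBracket, add_mem, mul_mem, hP]
        · refine ⟨oddBracket _ _ (isOdd_bMinus j) (isOdd_bMinus k), ?_, rfl⟩
          simp [toEnv_oddBracket, add_mem, mul_mem, hM]
    obtain ⟨y, hy, hyx⟩ := hx
    rwa [← Subtype.ext hyx]
  rw [eq_top_iff]
  rintro u -
  obtain ⟨t, rfl⟩ := RingQuot.mkAlgHom_surjective ℂ (EnvRel n) u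
  induction t using TensorAlgebra.induction with
  | algebraMap r => rw [AlgHom.commutes]; exact S.algebraMap_mem r
  | ι x => exact h1 x
  | mul a b ha hb => rw [map_mul]; exact S.mul_mem ha hb
  | add a b ha hb => rw [map_add]; exact S.add_mem ha hb

theorem Env.induction {motive : Env n → Prop}
    (scalar : ∀ r : ℂ, motive (algebraMap ℂ (Env n) r))
    (plus : ∀ j, motive (toEnv n (bPlus j))) (minus : ∀ j, motive (toEnv n (bMinus j)))
    (mul : ∀ a b, motive a → motive b → motive (a * b))
    (add : ∀ a b, motive a → motive b → motive (a + b)) (u : Env n) : motive u := by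
  have hu : u ∈ Algebra.adjoin ℂ ((Set.range fun j : Fin n => toEnv n (bPlus j)) ∪
      Set.range fun j : Fin n => toEnv n (bMinus j)) := by rw [adjoin_eq_top]; trivial
  induction hu using Algebra.adjoin_induction with
  | mem x hx =>
    rcases hx with ⟨j, rfl⟩ | ⟨j, rfl⟩
    · exact plus j
    · exact minus j
  | algebraMap r => exact scalar r
  | add a b _ _ ha hb => exact add a b ha hb
  | mul a b _ _ ha hb => exact mul a b ha hb

theorem toEnv_cartan (j : Fin n) :
    toEnv n (cartan j) = (2 : ℂ)⁻¹ • (toEnv n (bPlus j) * toEnv n (bMinus j) +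
      toEnv n (bMinus j) * toEnv n (bPlus j)) := by
  rw [← toEnv_oddBracket _ _ (isOdd_bPlus j) (isOdd_bMinus j), ← map_smul]
  congr 1
  apply Subtype.ext
  simp [oddBracket, bPlus_mul_bMinus, cartan]

end

end

/-! ### Weights, vacuum vectors and star forms -/

section

section
variable {n : ℕ} {W W' : Type*} [AddCommGroup W] [Module ℂ W] [Module (Env n) W]
  [IsScalarTower ℂ (Env n) W] [AddCommGroup W'] [Module ℂ W'] [Module (Env n) W']
  [IsScalarTower ℂ (Env n) W']

theorem env_smul_smul (u : Env n) (r : ℂ) (v : W) : u • r • v = r • u • v := by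
  rw [← algebraMap_smul (Env n) r v, ← algebraMap_smul (Env n) r (u • v), smul_smul, smul_smul,
    Algebra.commutes]

theorem mem_weightSpace {μ : Fin n → ℂ} {v : W} :
    v ∈ weightSpace W μ ↔ ∀ j, toEnv n (cartan j) • v = μ j • v := by
  simp [weightSpace, Submodule.mem_iInf]

theorem cartan_mul_bPlus (j l : Fin n) :
    toEnv n (cartan j) * toEnv n (bPlus l) =
      toEnv n (bPlus l) * toEnv n (cartan j) + if j = l then toEnv n (bPlus l) else 0 := by
  have h := isParaboson_toEnv.pm_p j j l
  rw [sub_eq_iff_eq_add] at h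
  simp only [toEnv_cartan, smul_mul_assoc, mul_smul_comm, h]
  split_ifs with hjl
  · subst hjl; rw [smul_add, smul_smul, add_comm]; norm_num
  · simp

theorem bPlus_smul_mem_weightSpace {μ : Fin n → ℂ} {v : W} (hv : v ∈ weightSpace W μ)
    (l : Fin n) : toEnv n (bPlus l) • v ∈ weightSpace W (μ + Pi.single l 1) := by
  rw [mem_weightSpace] at hv ⊢
  intro j
  rw [smul_smul, cartan_mul_bPlus, add_smul, mul_smul, hv j, env_smul_smul, Pi.add_apply, add_smul]
  by_cases h : j = l
  · subst h; simp
  · simp [h]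

/-- `w` is annihilated by all `b_j⁻` and `{b_j⁺, b_k⁻} w = p δ_{jk} w`. -/
def IsVacuum (p : ℝ) (w : W) : Prop :=
  (∀ j : Fin n, toEnv n (bMinus j) • w = 0) ∧
  ∀ j k : Fin n, (toEnv n (bPlus j) * toEnv n (bMinus k) +
    toEnv n (bMinus k) * toEnv n (bPlus j)) • w = if j = k then (p : ℂ) • w else 0

theorem IsVacuum.map {p : ℝ} {w : W} (h : IsVacuum (n := n) p w) (f : W →ₗ[Env n] W') :
    IsVacuum (n := n) p (f w) := by
  refine ⟨fun j => by rw [← map_smul, h.1, map_zero], fun j k => ?_⟩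
  rw [← map_smul, h.2]
  split_ifs
  · rw [← algebraMap_smul (Env n), map_smul, algebraMap_smul]
  · simp

theorem IsVacuum.mem_weightSpace {p : ℝ} {w : W} (h : IsVacuum (n := n) p w) :
    w ∈ weightSpace W (fun _ : Fin n => (p : ℂ) / 2) := by
  rw [Paraboson.mem_weightSpace]
  intro j
  rw [toEnv_cartan, smul_assoc, h.2, if_pos rfl, smul_smul]
  ring_nf

theorem IsVacuum.parabolic_smul {p : ℝ} {w : W} (h : IsVacuum (n := n) p w) {x : osp n}
    (hx : x ∈ parabolic n) : toEnv n x • w = vacuumChar n p x • w := by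
  induction hx using Submodule.span_induction with
  | mem x hx =>
    rcases hx with (⟨⟨j, k⟩, rfl⟩ | ⟨j, rfl⟩) | ⟨⟨j, k⟩, rfl⟩
    · simp only
      rw [toEnv_oddBracket, h.2, vacuumChar_bPlus_bMinus]
      split_ifs <;> simp
    · simp only
      rw [h.1, vacuumChar_bMinus, zero_smul]
    · simp only
      rw [toEnv_oddBracket, vacuumChar_bMinus_bMinus, add_smul, mul_smul, mul_smul, h.1, h.1]
      simp
  | zero => simp
  | add x y _ _ hx hy => rw [map_add, add_smul, hx, hy, map_add, add_smul]
  | smul r x _ hx => rw [map_smul, smul_assoc, hx, map_smul, smul_assoc]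

variable (n) in
/-- The vacuum vector of the induced module. -/
def vbarVac (p : ℝ) : Vbar n p := toVbar n p 1

theorem toVbar_eq_smul (p : ℝ) (u : Env n) : toVbar n p u = u • vbarVac n p := by
  rw [vbarVac, ← map_smul, smul_eq_mul, mul_one]

theorem toVbar_surjective (p : ℝ) : Function.Surjective (toVbar n p) :=
  Submodule.mkQ_surjective _

theorem toV_surjective (p : ℝ) : Function.Surjective (toV n p) :=
  Submodule.mkQ_surjective _

theorem exists_smul_vbarVac (p : ℝ) (v : Vbar n p) : ∃ u : Env n, v = u • vbarVac n p := by
  obtain ⟨u, rfl⟩ := toVbar_surjective p v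
  exact ⟨u, toVbar_eq_smul p u⟩

theorem parabolic_smul_vbarVac (p : ℝ) {x : osp n} (hx : x ∈ parabolic n) :
    toEnv n x • vbarVac n p = vacuumChar n p x • vbarVac n p := by
  rw [← sub_eq_zero, ← algebraMap_smul (Env n) (vacuumChar n p x), ← sub_smul, ← toVbar_eq_smul]
  exact (Submodule.Quotient.mk_eq_zero _).2 (Submodule.subset_span ⟨x, hx, rfl⟩)

theorem isVacuum_vbarVac (p : ℝ) : IsVacuum (n := n) p (vbarVac n p) := by
  constructor
  · intro j
    rw [parabolic_smul_vbarVac p (Submodule.subset_span (Or.inl (Or.inr ⟨j, rfl⟩))),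
      vacuumChar_bMinus, zero_smul]
  · intro j k
    rw [← toEnv_oddBracket _ _ (isOdd_bPlus j) (isOdd_bMinus k),
      parabolic_smul_vbarVac p (Submodule.subset_span (Or.inl (Or.inl ⟨(j, k), rfl⟩))),
      vacuumChar_bPlus_bMinus]
    split_ifs <;> simp

theorem isVacuum_vac (p : ℝ) : IsVacuum (n := n) p (vac n p) :=
  (isVacuum_vbarVac p).map (toV n p)

/-- The universal property of the induced module. -/
def vbarLift {p : ℝ} {w : W} (h : IsVacuum (n := n) p w) : Vbar n p →ₗ[Env n] W :=
  (vacuumIdeal n p).liftQ (LinearMap.toSpanSingleton (Env n) W w) <| by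
    rw [vacuumIdeal, Submodule.span_le]
    rintro _ ⟨x, hx, rfl⟩
    simp [sub_smul, h.parabolic_smul hx]

@[simp] theorem vbarLift_vbarVac {p : ℝ} {w : W} (h : IsVacuum (n := n) p w) :
    vbarLift h (vbarVac n p) = w := by
  refine (Submodule.liftQ_apply _ _ _).trans ?_
  simp

end

section
variable {W : Type*} [AddCommGroup W] [Module ℂ W]

theorem core_add_right (c : InnerProductSpace.Core ℂ W) (x y z : W) :
    c.inner x (y + z) = c.inner x y + c.inner x z := by
  rw [← c.conj_inner_symm, c.add_left, map_add, c.conj_inner_symm, c.conj_inner_symm]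

theorem core_smul_right (c : InnerProductSpace.Core ℂ W) (r : ℂ) (x y : W) :
    c.inner x (r • y) = r * c.inner x y := by
  rw [← c.conj_inner_symm, c.smul_left, map_mul, c.conj_inner_symm]
  simp

theorem core_zero_left (c : InnerProductSpace.Core ℂ W) (x : W) : c.inner 0 x = 0 := by
  simpa using c.smul_left 0 x 0

theorem core_zero_right (c : InnerProductSpace.Core ℂ W) (x : W) : c.inner x 0 = 0 := by
  simpa using core_smul_right c 0 x 0

theorem core_sub_left (c : InnerProductSpace.Core ℂ W) (x y z : W) :
    c.inner (x - y) z = c.inner x z - c.inner y z := by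
  rw [eq_sub_iff_add_eq, ← c.add_left, sub_add_cancel]

theorem core_sub_right (c : InnerProductSpace.Core ℂ W) (x y z : W) :
    c.inner x (y - z) = c.inner x y - c.inner x z := by
  rw [eq_sub_iff_add_eq, ← core_add_right, sub_add_cancel]

/-- The pullback of an inner product along an injective linear map. -/
@[reducible] def coreComap {W' : Type*} [AddCommGroup W'] [Module ℂ W']
    (c : InnerProductSpace.Core ℂ W') (e : W →ₗ[ℂ] W') (he : Function.Injective e) :
    InnerProductSpace.Core ℂ W where
  inner x y := c.inner (e x) (e y)
  conj_inner_symm x y := c.conj_inner_symm _ _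
  re_inner_nonneg x := c.re_inner_nonneg _
  add_left x y z := by rw [map_add]; exact c.add_left _ _ _
  smul_left x y r := by rw [map_smul]; exact c.smul_left _ _ _
  definite x hx := he (by rw [map_zero]; exact c.definite _ hx)

variable {n : ℕ} [Module (Env n) W] {c : InnerProductSpace.Core ℂ W}

theorem IsStarForm.bMinus_left (hc : IsStarForm (n := n) c) (j : Fin n) (v w : W) :
    c.inner (toEnv n (bMinus j) • v) w = c.inner v (toEnv n (bPlus j) • w) := by
  rw [← c.conj_inner_symm, ← c.conj_inner_symm v]
  exact congrArg _ (hc j w v).symm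

variable [IsScalarTower ℂ (Env n) W]

/-- Taking adjoints reverses products, so adjoints of the generators give adjoints of all elements
they generate. -/
theorem IsStarForm.exists_adjoint (hc : IsStarForm (n := n) c) (u : Env n) :
    ∃ u' : Env n, ∀ v w, c.inner (u • v) w = c.inner v (u' • w) := by
  induction u using Env.induction with
  | scalar r =>
    refine ⟨algebraMap ℂ (Env n) (starRingEnd ℂ r), fun v w => ?_⟩
    rw [algebraMap_smul, algebraMap_smul, c.smul_left, core_smul_right]
  | plus j => exact ⟨toEnv n (bMinus j), fun v w => hc j v w⟩
  | minus j => exact ⟨toEnv n (bPlus j), fun v w => hc.bMinus_left j v w⟩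
  | mul a b ha hb =>
    obtain ⟨a', ha⟩ := ha
    obtain ⟨b', hb⟩ := hb
    exact ⟨b' * a', fun v w => by rw [mul_smul, ha, hb, mul_smul]⟩
  | add a b ha hb =>
    obtain ⟨a', ha⟩ := ha
    obtain ⟨b', hb⟩ := hb
    exact ⟨a' + b', fun v w => by rw [add_smul, c.add_left, ha, hb, add_smul, core_add_right]⟩

theorem IsStarForm.cartan_left (hc : IsStarForm (n := n) c) (j : Fin n) (v w : W) :
    c.inner (toEnv n (cartan j) • v) w = c.inner v (toEnv n (cartan j) • w) := by
  have hp : ∀ v w, c.inner (toEnv n (bPlus j) • v) w = c.inner v (toEnv n (bMinus j) • w) :=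
    fun v w => hc j v w
  simp only [toEnv_cartan, smul_assoc, add_smul, mul_smul, c.smul_left, core_smul_right, c.add_left,
    core_add_right, hp, hc.bMinus_left, map_inv₀, Complex.conj_ofNat]

/-- The inner product restricts the parameter of a nonzero vacuum vector. -/
theorem IsStarForm.one_le {W : Type*} [AddCommGroup W] [Module ℂ W] [Module (Env 2) W]
    [IsScalarTower ℂ (Env 2) W] {c : InnerProductSpace.Core ℂ W} (hc : IsStarForm (n := 2) c)
    {p : ℝ} (hp : p ≠ 0) {w : W} (hw : IsVacuum (n := 2) p w) (h0 : w ≠ 0) : 1 ≤ p := by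
  have hP : ∀ j v w, c.inner (toEnv 2 (bPlus j) • v) w = c.inner v (toEnv 2 (bMinus j) • w) :=
    fun j v w => hc j v w
  have hre : 0 < (c.inner w w).re := by
    refine lt_of_le_of_ne (c.re_inner_nonneg w) fun h => h0 (c.definite w ?_)
    have him : (c.inner w w).im = 0 := by
      have := congrArg Complex.im (c.conj_inner_symm w w)
      simp only [Complex.conj_im] at this
      linarith
    exact Complex.ext h.symm him
  have hMP (j k : Fin 2) : toEnv 2 (bMinus k) • toEnv 2 (bPlus j) • w =
      if j = k then (p : ℂ) • w else 0 := by
    have := hw.2 j k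
    rwa [add_smul, mul_smul, hw.1, smul_zero, zero_add, mul_smul] at this
  -- Replace b_k⁻b_j⁺ by {b_j⁺, b_k⁻} − b_j⁺b_k⁻. The anticommutator passes b_l⁺ at the cost of
  -- 2δ_{kl} b_j⁺ and then acts on w by pδ_{jk}.
  have hMPP (j k l : Fin 2) : toEnv 2 (bMinus k) • toEnv 2 (bPlus j) • toEnv 2 (bPlus l) • w =
      (if j = k then (p : ℂ) • toEnv 2 (bPlus l) • w else 0) +
      (if k = l then (2 : ℂ) • toEnv 2 (bPlus j) • w else 0) -
      (if l = k then (p : ℂ) • toEnv 2 (bPlus j) • w else 0) := by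
    have h := congrArg (· • w) (isParaboson_toEnv.pm_p j k l)
    simp only [sub_smul, mul_smul _ (toEnv 2 (bPlus l)), mul_smul (toEnv 2 (bPlus l)), hw.2] at h
    rw [add_smul, mul_smul, mul_smul, hMP] at h
    rw [sub_eq_iff_eq_add] at h
    rw [eq_sub_iff_add_eq, add_comm, ← sub_eq_zero]
    rw [← sub_eq_zero] at h
    simp only [smul_ite, smul_zero, ite_smul, zero_smul, env_smul_smul, smul_assoc] at h
    refine Eq.trans ?_ h
    abel
  -- ‖b₁⁺w‖² = p‖w‖².
  have h1 : 0 ≤ p := by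
    have h := c.re_inner_nonneg (toEnv 2 (bPlus (0 : Fin 2)) • w)
    rw [hP, hMP, if_pos rfl, core_smul_right] at h
    simp at h
    exact nonneg_of_mul_nonneg_left h hre
  -- ‖(b₁⁺b₂⁺ − b₂⁺b₁⁺)w‖² = 4p(p − 1)‖w‖², which excludes 0 < p < 1.
  have h2 : 0 ≤ 4 * p * (p - 1) := by
    have h := c.re_inner_nonneg (toEnv 2 (bPlus (0 : Fin 2)) • toEnv 2 (bPlus (1 : Fin 2)) • w -
      toEnv 2 (bPlus (1 : Fin 2)) • toEnv 2 (bPlus (0 : Fin 2)) • w)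
    rw [core_sub_left, hP, hP, hP, hP] at h
    simp only [smul_sub, hMPP] at h
    simp [env_smul_smul, hMP, smul_smul, -Complex.coe_smul, -Complex.real_smul, core_sub_right,
      core_smul_right] at h
    exact nonneg_of_mul_nonneg_left
      (by linarith : 0 ≤ 4 * p * (p - 1) * (c.inner w w).re) hre
  have h3 : 0 < p := lt_of_le_of_ne h1 hp.symm
  nlinarith

end

end

/-! ### Spanning vectors of the induced module and its maximal submodule -/

section

section
variable {W : Type*} [AddCommGroup W] [Module (Env 2) W]

/-- The anticommutator `{b_1⁺, b_2⁺}` in the enveloping algebra. -/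
def pairPlus : Env 2 :=
  toEnv 2 (bPlus 0) * toEnv 2 (bPlus 1) + toEnv 2 (bPlus 1) * toEnv 2 (bPlus 0)

theorem commute_pairPlus (l : Fin 2) : Commute pairPlus (toEnv 2 (bPlus l)) :=
  sub_eq_zero.1 (isParaboson_toEnv.pp_p 0 1 l)

/-- The vectors `(b_1⁺)^a {b_1⁺, b_2⁺}^d (b_2⁺)^b w`, indexed by `(a, b, d)`. -/
def raise (w : W) (m : ℕ × ℕ × ℕ) : W :=
  (toEnv 2 (bPlus 0) ^ m.1 * pairPlus ^ m.2.2 * toEnv 2 (bPlus 1) ^ m.2.1) • w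

theorem raise_zero (w : W) : raise w 0 = w := by simp [raise]

theorem raise_map {W' : Type*} [AddCommGroup W'] [Module (Env 2) W'] (f : W →ₗ[Env 2] W') (w : W)
    (m : ℕ × ℕ × ℕ) : f (raise w m) = raise (f w) m := by
  simp [raise]

theorem bPlus_zero_smul_raise (w : W) (a b d : ℕ) :
    toEnv 2 (bPlus 0) • raise w (a, b, d) = raise w (a + 1, b, d) := by
  simp [raise, smul_smul, pow_succ', mul_assoc]

theorem pairPlus_smul_raise (w : W) (a b d : ℕ) :
    pairPlus • raise w (a, b, d) = raise w (a, b, d + 1) := by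
  simp only [raise, smul_smul, ← mul_assoc]
  rw [((commute_pairPlus 0).pow_right a).eq, pow_succ']
  simp only [mul_assoc]

theorem bPlus_one_smul_raise (w : W) (b d : ℕ) :
    toEnv 2 (bPlus 1) • raise w (0, b, d) = raise w (0, b + 1, d) := by
  simp only [raise, smul_smul, ← mul_assoc, pow_zero, one_mul]
  rw [((commute_pairPlus 1).symm.pow_right d).eq, pow_succ']
  simp only [mul_assoc]

theorem bPlus_one_smul_raise_succ (w : W) (a b d : ℕ) :
    toEnv 2 (bPlus 1) • raise w (a + 1, b, d) = raise w (a, b, d + 1) -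
      toEnv 2 (bPlus 0) • toEnv 2 (bPlus 1) • raise w (a, b, d) := by
  rw [← bPlus_zero_smul_raise, ← pairPlus_smul_raise, pairPlus, add_smul, mul_smul, mul_smul]
  abel

variable [Module ℂ W]

/-- A subspace containing `w` and stable under the creation operators contains all `raise w m`. -/
theorem raise_mem {w : W} {S : Submodule ℂ W} (hw : w ∈ S)
    (hS : ∀ l : Fin 2, ∀ v ∈ S, toEnv 2 (bPlus l) • v ∈ S) (m : ℕ × ℕ × ℕ) : raise w m ∈ S := by
  obtain ⟨a, b, d⟩ := m
  induction a with
  | zero =>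
    induction d with
    | zero =>
      induction b with
      | zero => rw [show ((0, 0, 0) : ℕ × ℕ × ℕ) = 0 from rfl, raise_zero]; exact hw
      | succ b ih => rw [← bPlus_one_smul_raise]; exact hS _ _ ih
    | succ d ih =>
      rw [← pairPlus_smul_raise, pairPlus, add_smul, mul_smul, mul_smul]
      exact S.add_mem (hS _ _ (hS _ _ ih)) (hS _ _ (hS _ _ ih))
  | succ a ih => rw [← bPlus_zero_smul_raise]; exact hS _ _ ih

variable [IsScalarTower ℂ (Env 2) W]

/-- The two components of the difference of the weight of `raise w m` and of `w`. -/
def rel (m : ℕ × ℕ × ℕ) : Fin 2 → ℕ := ![m.1 + m.2.2, m.2.1 + m.2.2]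

theorem raise_mem_weightSpace {w : W} {μ : Fin 2 → ℂ} (hw : w ∈ weightSpace W μ)
    (m : ℕ × ℕ × ℕ) : raise w m ∈ weightSpace W (fun j => μ j + rel m j) := by
  obtain ⟨a, b, d⟩ := m
  induction a with
  | zero =>
    induction d with
    | zero =>
      induction b with
      | zero =>
        have h : (fun j => μ j + rel (0, 0, 0) j) = μ := by ext j; fin_cases j <;> simp [rel]
        rw [h, show ((0, 0, 0) : ℕ × ℕ × ℕ) = 0 from rfl, raise_zero]
        exact hw
      | succ b ih =>
        rw [← bPlus_one_smul_raise]
        convert bPlus_smul_mem_weightSpace ih 1 using 2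
        ext j; fin_cases j <;> simp [rel]; ring
    | succ d ih =>
      rw [← pairPlus_smul_raise, pairPlus, add_smul, mul_smul, mul_smul]
      refine Submodule.add_mem _ ?_ ?_
      · convert bPlus_smul_mem_weightSpace (bPlus_smul_mem_weightSpace ih 1) 0 using 2
        ext j; fin_cases j <;> simp [rel] <;> ring
      · convert bPlus_smul_mem_weightSpace (bPlus_smul_mem_weightSpace ih 0) 1 using 2
        ext j; fin_cases j <;> simp [rel] <;> ring
  | succ a ih =>
    rw [← bPlus_zero_smul_raise]
    convert bPlus_smul_mem_weightSpace ih 0 using 2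
    ext j; fin_cases j <;> simp [rel]; ring

/-- Normal ordering: b₁⁺ already stands leftmost, and b₂⁺ moves past b₁⁺ at the cost of {b₁⁺, b₂⁺},
which commutes with both creation operators. -/
theorem bPlus_smul_mem_span_raise {w : W} {v : W} (l : Fin 2)
    (hv : v ∈ Submodule.span ℂ (Set.range (raise w))) :
    toEnv 2 (bPlus l) • v ∈ Submodule.span ℂ (Set.range (raise w)) := by
  have h0 : ∀ v ∈ Submodule.span ℂ (Set.range (raise w)),
      toEnv 2 (bPlus 0) • v ∈ Submodule.span ℂ (Set.range (raise w)) := by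
    intro v hv
    induction hv using Submodule.span_induction with
    | mem v hv =>
      obtain ⟨⟨a, b, d⟩, rfl⟩ := hv
      rw [bPlus_zero_smul_raise]
      exact Submodule.subset_span ⟨_, rfl⟩
    | zero => simp
    | add x y _ _ hx hy => rw [smul_add]; exact Submodule.add_mem _ hx hy
    | smul r x _ hx => rw [env_smul_smul]; exact Submodule.smul_mem _ _ hx
  have h1 : ∀ a b d, toEnv 2 (bPlus 1) • raise w (a, b, d) ∈
      Submodule.span ℂ (Set.range (raise w)) := by
    intro a
    induction a with
    | zero =>
      intro b d
      rw [bPlus_one_smul_raise]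
      exact Submodule.subset_span ⟨_, rfl⟩
    | succ a ih =>
      intro b d
      rw [bPlus_one_smul_raise_succ]
      exact Submodule.sub_mem _ (Submodule.subset_span ⟨_, rfl⟩) (h0 _ (ih b d))
  fin_cases l
  · exact h0 v hv
  · induction hv using Submodule.span_induction with
    | mem v hv =>
      obtain ⟨⟨a, b, d⟩, rfl⟩ := hv
      exact h1 a b d
    | zero => simp
    | add x y _ _ hx hy => rw [smul_add]; exact Submodule.add_mem _ hx hy
    | smul r x _ hx => rw [env_smul_smul]; exact Submodule.smul_mem _ _ hx

/-- The vectors raised from a vacuum vector span a submodule. -/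
theorem IsVacuum.smul_mem_span_raise {p : ℝ} {w : W} (h : IsVacuum (n := 2) p w) (u : Env 2)
    {v : W} (hv : v ∈ Submodule.span ℂ (Set.range (raise w))) :
    u • v ∈ Submodule.span ℂ (Set.range (raise w)) := by
  set T := Submodule.span ℂ (Set.range (raise w)) with hT
  -- Controlling the anticommutators together with the b_j⁻ is what makes `Z` stable under creation:
  -- b_j⁻b_l⁺ = {b_l⁺, b_j⁻} − b_l⁺b_j⁻, and {b_j⁺, b_k⁻} commutes with b_l⁺ up to a multiple of
  -- b_j⁺.
  let Z : Submodule ℂ W :=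
    { carrier := {v | v ∈ T ∧ (∀ j, toEnv 2 (bMinus j) • v ∈ T) ∧
        ∀ j k, (toEnv 2 (bPlus j) * toEnv 2 (bMinus k) +
          toEnv 2 (bMinus k) * toEnv 2 (bPlus j)) • v ∈ T}
      zero_mem' := by simp
      add_mem' := fun ha hb => by
        refine ⟨T.add_mem ha.1 hb.1, fun j => ?_, fun j k => ?_⟩
        · rw [smul_add]; exact T.add_mem (ha.2.1 j) (hb.2.1 j)
        · rw [smul_add]; exact T.add_mem (ha.2.2 j k) (hb.2.2 j k)
      smul_mem' := fun r a ha => by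
        refine ⟨T.smul_mem r ha.1, fun j => ?_, fun j k => ?_⟩
        · rw [env_smul_smul]; exact T.smul_mem r (ha.2.1 j)
        · rw [env_smul_smul]; exact T.smul_mem r (ha.2.2 j k) }
  have hwT : w ∈ T := Submodule.subset_span ⟨0, raise_zero w⟩
  have hwZ : w ∈ Z := by
    refine ⟨hwT, fun j => by rw [h.1]; exact T.zero_mem, fun j k => ?_⟩
    rw [h.2]
    split_ifs
    exacts [T.smul_mem _ hwT, T.zero_mem]
  have hZ : ∀ l : Fin 2, ∀ v ∈ Z, toEnv 2 (bPlus l) • v ∈ Z := by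
    rintro l v ⟨h1, h2, h3⟩
    refine ⟨bPlus_smul_mem_span_raise l h1, fun j => ?_, fun j k => ?_⟩
    · have := T.sub_mem (h3 l j) (bPlus_smul_mem_span_raise l (h2 j))
      rwa [add_smul, mul_smul, mul_smul, add_sub_cancel_left] at this
    · rw [smul_smul, sub_eq_iff_eq_add.1 (isParaboson_toEnv.pm_p j k l), add_smul, mul_smul _ _ v]
      refine T.add_mem ?_ (bPlus_smul_mem_span_raise l (h3 j k))
      split_ifs
      · rw [smul_assoc]; exact T.smul_mem _ (bPlus_smul_mem_span_raise j h1)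
      · rw [zero_smul]; exact T.zero_mem
  have hTZ : T ≤ Z := Submodule.span_le.2 (by rintro _ ⟨m, rfl⟩; exact raise_mem hwZ hZ m)
  induction u using Env.induction generalizing v with
  | scalar r => rw [algebraMap_smul]; exact T.smul_mem r hv
  | plus j => exact bPlus_smul_mem_span_raise j hv
  | minus j => exact (hTZ hv).2.1 j
  | mul a b ha hb => rw [mul_smul]; exact ha (hb hv)
  | add a b ha hb => rw [add_smul]; exact T.add_mem (ha hv) (hb hv)

theorem span_raise_vbarVac (p : ℝ) :
    Submodule.span ℂ (Set.range (raise (vbarVac 2 p))) = ⊤ := by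
  rw [eq_top_iff]
  rintro v -
  obtain ⟨u, rfl⟩ := exists_smul_vbarVac p v
  exact (isVacuum_vbarVac p).smul_mem_span_raise u (Submodule.subset_span ⟨0, raise_zero _⟩)

/-- The total degree operator. -/
def euler : Env 2 := toEnv 2 (cartan 0) + toEnv 2 (cartan 1)

theorem euler_smul_raise {p : ℝ} {w : W} (hw : IsVacuum (n := 2) p w) (m : ℕ × ℕ × ℕ) :
    euler • raise w m = ((p : ℂ) + (rel m 0 + rel m 1 : ℕ)) • raise w m := by
  have h := mem_weightSpace.1 (raise_mem_weightSpace hw.mem_weightSpace m)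
  rw [euler, add_smul, h, h, ← add_smul]
  push_cast
  ring_nf

theorem rel_add_ne_zero {m : ℕ × ℕ × ℕ} (hm : m ≠ 0) : rel m 0 + rel m 1 ≠ 0 := by
  obtain ⟨a, b, d⟩ := m
  simp [rel, Prod.ext_iff] at hm ⊢
  omega

open Polynomial in
/-- A submodule containing a vector with nonzero vacuum component contains the vacuum. -/
theorem vbarVac_mem {p : ℝ} {N : Submodule (Env 2) (Vbar 2 p)} {r : Vbar 2 p}
    (hr : r ∈ Submodule.span ℂ (raise (vbarVac 2 p) '' {0}ᶜ))
    {t : ℂ} (ht : t ≠ 0) (hN : t • vbarVac 2 p + r ∈ N) : vbarVac 2 p ∈ N := by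
  have hev (q : ℂ[X]) (v : Vbar 2 p) (z : ℂ) (h : euler • v = z • v) :
      aeval euler q • v = q.eval z • v := by
    induction q using Polynomial.induction_on' with
    | add a b ha hb => rw [map_add, add_smul, ha, hb, eval_add, add_smul]
    | monomial k a =>
      rw [aeval_monomial, eval_monomial, mul_smul, algebraMap_smul, mul_smul]
      congr 1
      induction k with
      | zero => simp
      | succ k ih => rw [pow_succ, mul_smul, h, env_smul_smul, ih, smul_smul, pow_succ, mul_comm]
  -- A product of factors X − λ, one for each raised vector occurring in r, kills r. It does not
  -- vanish at the vacuum eigenvalue p, since each λ exceeds p by a positive integer.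
  have key : ∃ q : ℂ[X], q.eval (p : ℂ) ≠ 0 ∧ aeval euler q • r = 0 := by
    clear hN
    induction hr using Submodule.span_induction with
    | mem x hx =>
      obtain ⟨m, hm, rfl⟩ := hx
      refine ⟨X - C ((p : ℂ) + (rel m 0 + rel m 1 : ℕ)), ?_, ?_⟩
      · have := rel_add_ne_zero hm
        simp only [eval_sub, eval_X, eval_C, sub_add_cancel_left, ne_eq, neg_eq_zero]
        exact_mod_cast this
      · rw [hev _ _ _ (euler_smul_raise (isVacuum_vbarVac p) m)]
        simp
    | zero => exact ⟨1, by simp, by simp⟩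
    | add x y _ _ hx hy =>
      obtain ⟨a, ha, hax⟩ := hx
      obtain ⟨b, hb, hby⟩ := hy
      refine ⟨a * b, by simp [ha, hb], ?_⟩
      rw [smul_add, map_mul, mul_smul _ _ y, hby, smul_zero, add_zero, ← map_mul, mul_comm, map_mul,
        mul_smul, hax, smul_zero]
    | smul s x _ hx =>
      obtain ⟨a, ha, hax⟩ := hx
      exact ⟨a, ha, by rw [env_smul_smul, hax, smul_zero]⟩
  obtain ⟨q, hq, hqr⟩ := key
  have h1 := N.smul_mem (aeval euler q) hN
  have h2 := euler_smul_raise (isVacuum_vbarVac p) 0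
  rw [raise_zero] at h2
  rw [smul_add, hqr, add_zero, env_smul_smul, hev q _ _ h2] at h1
  simp only [rel] at h1
  have h3 := N.smul_mem (algebraMap ℂ (Env 2) ((t * q.eval (p : ℂ))⁻¹)) h1
  rw [algebraMap_smul, smul_smul, smul_smul] at h3
  convert h3
  simp [ht, hq]

/-- An inner product on a quotient of the induced module identifies the maximal submodule. -/
theorem ker_eq_maxSub {p : ℝ} (f : Vbar 2 p →ₗ[Env 2] W)
    {c : InnerProductSpace.Core ℂ W} (hc : IsStarForm (n := 2) c) (h0 : f (vbarVac 2 p) ≠ 0) :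
    LinearMap.ker f = maxSub 2 p := by
  apply le_antisymm
  · refine le_sSup fun h => h0 ?_
    have : vbarVac 2 p ∈ LinearMap.ker f := by rw [h]; trivial
    exact this
  · refine sSup_le fun N hN v hv => ?_
    by_contra hv0
    refine hN ?_
    have hvac : vbarVac 2 p ∈ N := by
      -- With u' adjoint to u, the pairing of f|0⟩ with f(u'u|0⟩) is the square length of f(u|0⟩),
      -- which is nonzero. Hence u'u|0⟩, which lies in N, has a nonzero vacuum component.
      obtain ⟨u, rfl⟩ := exists_smul_vbarVac p v
      obtain ⟨u', hu'⟩ := hc.exists_adjoint u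
      set x := u' • u • vbarVac 2 p with hx
      have hxN : x ∈ N := N.smul_mem u' hv
      have hfx : c.inner (f (vbarVac 2 p)) (f x) ≠ 0 := by
        rw [hx, map_smul, ← hu', ← map_smul]
        exact fun h => hv0 (c.definite _ h)
      have hxt : x ∈ Submodule.span ℂ (Set.range (raise (vbarVac 2 p))) := by
        rw [span_raise_vbarVac]; trivial
      rw [← Set.image_univ, ← Set.insert_eq_of_mem (Set.mem_univ (0 : ℕ × ℕ × ℕ)),
        ← Set.insert_sdiff_singleton, Set.image_insert_eq, ← Set.compl_eq_univ_sdiff, raise_zero,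
        Submodule.mem_span_insert] at hxt
      obtain ⟨t, r, hr, hxr⟩ := hxt
      refine vbarVac_mem hr (t := t) ?_ (hxr ▸ hxN)
      rintro rfl
      apply hfx
      rw [hxr, zero_smul, zero_add]
      clear hxr
      induction hr using Submodule.span_induction with
      | mem y hy =>
        obtain ⟨m, hm, rfl⟩ := hy
        have hw := (isVacuum_vbarVac p).map f
        have h1 := euler_smul_raise hw 0
        have h2 := euler_smul_raise hw m
        -- The Euler operator is self-adjoint and its eigenvalues on the two vectors differ, so they
        -- are orthogonal.
        have h3 : c.inner (euler • raise (f (vbarVac 2 p)) 0) (raise (f (vbarVac 2 p)) m) =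
            c.inner (raise (f (vbarVac 2 p)) 0) (euler • raise (f (vbarVac 2 p)) m) := by
          rw [euler, add_smul, add_smul, c.add_left, core_add_right, hc.cartan_left, hc.cartan_left]
        rw [h1, h2, c.smul_left, core_smul_right, raise_zero] at h3
        rw [raise_map]
        have h4 : ((rel m 0 + rel m 1 : ℕ) : ℂ) ≠ 0 := Nat.cast_ne_zero.2 (rel_add_ne_zero hm)
        have h5 : rel (0 : ℕ × ℕ × ℕ) 0 + rel (0 : ℕ × ℕ × ℕ) 1 = 0 := rfl
        rw [h5, Nat.cast_zero, add_zero, Complex.conj_ofReal] at h3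
        exact (mul_eq_zero.1 (by linear_combination -h3)).resolve_left h4
      | zero => rw [map_zero, core_zero_right]
      | add y z _ _ hy hz => rw [map_add, core_add_right, hy, hz, add_zero]
      | smul s y _ hy =>
        rw [← algebraMap_smul (Env 2), map_smul, algebraMap_smul, core_smul_right, hy, mul_zero]
    rw [eq_top_iff]
    rintro y -
    obtain ⟨u, rfl⟩ := exists_smul_vbarVac p y
    exact N.smul_mem u hvac

end

end

/-! ### Explicit parabosons on Laurent monomials -/

section

/-- The space with basis `u^i v^j t^l`, indexed by `(i, j, l)`. -/
abbrev LaurentModel : Type := ℤ × ℤ × ℤ →₀ ℂ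

/-- The monomial `u^i v^j t^l`. -/
def lmono (i j l : ℤ) : LaurentModel := Finsupp.single (i, j, l) 1

/-- The linear operator with prescribed values on monomials. -/
def lop (f : ℤ → ℤ → ℤ → LaurentModel) : Module.End ℂ LaurentModel :=
  Finsupp.linearCombination ℂ fun m : ℤ × ℤ × ℤ => f m.1 m.2.1 m.2.2

theorem lop_lmono (f : ℤ → ℤ → ℤ → LaurentModel) (i j l : ℤ) :
    lop f (lmono i j l) = f i j l := by
  simp [lop, lmono]

theorem lop_ext {f g : Module.End ℂ LaurentModel}
    (h : ∀ i j l, f (lmono i j l) = g (lmono i j l)) : f = g :=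
  Finsupp.lhom_ext' fun m => LinearMap.ext_ring (h m.1 m.2.1 m.2.2)

/-- The sign `(-1)^l`. -/
def sgn (l : ℤ) : ℂ := if Even l then 1 else -1

/-- The least odd number `≥ n`. -/
def oddCeil (n : ℤ) : ℂ := if Even n then n + 1 else n

theorem oddCeil_ne_zero (n : ℤ) : oddCeil n ≠ 0 := by
  rw [oddCeil]
  split_ifs with h
  · obtain ⟨k, rfl⟩ := h
    norm_cast
    omega
  · rintro h0
    exact h (by rw [Int.cast_eq_zero.1 h0]; exact Even.zero)

/-- The coefficient of the lowering of the first label. -/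
def gCoef (p : ℝ) (k : ℤ) : ℂ := if Even k then k + 1 else k + p - 1

/-- The coefficient of the lowering of the second label. -/
def hCoef (p : ℝ) (l : ℤ) : ℂ := if Even l then l else l + p - 2

/-- The creation operators `u - t ∂_v` and `v + t ∂_u` (up to scalars). -/
def laurentPlus : Fin 2 → Module.End ℂ LaurentModel :=
  ![lop fun i j l => sgn l • lmono (i + 1) j l - (j / oddCeil (i + j)) • lmono i (j - 1) (l + 1),
    lop fun i j l => sgn l • lmono i (j + 1) l + (i / oddCeil (i + j)) • lmono (i - 1) j (l + 1)]

/-- The annihilation operators `∂_u - t⁻¹ v` and `∂_v + t⁻¹ u` (up to scalars). -/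
def laurentMinus (p : ℝ) : Fin 2 → Module.End ℂ LaurentModel :=
  ![lop fun i j l => (sgn l * i * gCoef p (i + j + l) / oddCeil (i + j)) • lmono (i - 1) j l -
      hCoef p l • lmono i (j + 1) (l - 1),
    lop fun i j l => (sgn l * j * gCoef p (i + j + l) / oddCeil (i + j)) • lmono i (j - 1) l +
      hCoef p l • lmono (i + 1) j (l - 1)]

theorem laurentPlus_zero (i j l : ℤ) : laurentPlus 0 (lmono i j l) =
    sgn l • lmono (i + 1) j l - (j / oddCeil (i + j)) • lmono i (j - 1) (l + 1) := by
  simp [laurentPlus, lop_lmono]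

theorem laurentPlus_one (i j l : ℤ) : laurentPlus 1 (lmono i j l) =
    sgn l • lmono i (j + 1) l + (i / oddCeil (i + j)) • lmono (i - 1) j (l + 1) := by
  simp [laurentPlus, lop_lmono]

theorem laurentMinus_zero (p : ℝ) (i j l : ℤ) : laurentMinus p 0 (lmono i j l) =
    (sgn l * i * gCoef p (i + j + l) / oddCeil (i + j)) • lmono (i - 1) j l -
      hCoef p l • lmono i (j + 1) (l - 1) := by
  simp [laurentMinus, lop_lmono]

theorem laurentMinus_one (p : ℝ) (i j l : ℤ) : laurentMinus p 1 (lmono i j l) =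
    (sgn l * j * gCoef p (i + j + l) / oddCeil (i + j)) • lmono i (j - 1) l +
      hCoef p l • lmono (i + 1) j (l - 1) := by
  simp [laurentMinus, lop_lmono]

section
set_option linter.unusedSimpArgs false
set_option linter.unusedTactic false
set_option linter.unreachableTactic false

/-- All parity-dependent factors cancel here and gl(2) remains: 2u∂_u + 2t∂_t + p, 2u∂_v, 2v∂_u and
2v∂_v + 2t∂_t + p. The mixed triple relations then only need commutators with these first-order
operators. -/
theorem laurent_anticommutators (p : ℝ) :
    laurentPlus 0 * laurentMinus p 0 + laurentMinus p 0 * laurentPlus 0 =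
      lop (fun i j l => (2 * i + 2 * l + p : ℂ) • lmono i j l) ∧
    laurentPlus 0 * laurentMinus p 1 + laurentMinus p 1 * laurentPlus 0 =
      lop (fun i j l => (2 * j : ℂ) • lmono (i + 1) (j - 1) l) ∧
    laurentPlus 1 * laurentMinus p 0 + laurentMinus p 0 * laurentPlus 1 =
      lop (fun i j l => (2 * i : ℂ) • lmono (i - 1) (j + 1) l) ∧
    laurentPlus 1 * laurentMinus p 1 + laurentMinus p 1 * laurentPlus 1 =
      lop (fun i j l => (2 * j + 2 * l + p : ℂ) • lmono i j l) := by
  refine ⟨lop_ext fun i j l => ?_, lop_ext fun i j l => ?_, lop_ext fun i j l => ?_,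
    lop_ext fun i j l => ?_⟩ <;>
  simp only [LinearMap.add_apply, LinearMap.sub_apply, LinearMap.smul_apply,
    LinearMap.zero_apply, Module.End.mul_apply, laurentPlus_zero, laurentPlus_one,
    laurentMinus_zero, laurentMinus_one, lop_lmono, map_add, map_sub, map_smul, sub_add_cancel,
    add_sub_cancel_right] <;>
  -- What remains are rational identities in the exponents. The denominators `oddCeil` are odd,
  -- hence nonzero, and the parity-dependent factors are constant or linear on each of the eight
  -- parity classes of (i, j, l).
  match_scalars <;> field_simp (disch := exact oddCeil_ne_zero _) <;>
  first
  | (push_cast; ring1)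
  | (by_cases hi : Even i <;> by_cases hj : Even j <;> by_cases hl : Even l <;>
      simp only [sgn, oddCeil, gCoef, hCoef, Int.even_add, Int.even_sub, Int.not_even_one, hi, hj,
        hl, iff_true, true_iff, iff_false, false_iff, not_true, not_false, if_true, if_false] <;>
      push_cast <;> ring1)

theorem laurent_pm_plus (p : ℝ) (j k l : Fin 2) :
    (laurentPlus j * laurentMinus p k + laurentMinus p k * laurentPlus j) * laurentPlus l -
      laurentPlus l * (laurentPlus j * laurentMinus p k + laurentMinus p k * laurentPlus j) =
    if k = l then (2 : ℂ) • laurentPlus j else 0 := by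
  obtain ⟨h00, h01, h10, h11⟩ := laurent_anticommutators p
  fin_cases j <;> fin_cases k <;> fin_cases l <;>
  simp only [Fin.zero_eta, Fin.mk_one, h00, h01, h10, h11, if_true, one_ne_zero,
    zero_ne_one, if_false] <;>
  refine lop_ext fun i j l => ?_ <;>
  simp only [LinearMap.add_apply, LinearMap.sub_apply, LinearMap.smul_apply,
    LinearMap.zero_apply, Module.End.mul_apply, laurentPlus_zero, laurentPlus_one,
    laurentMinus_zero, laurentMinus_one, lop_lmono, map_add, map_sub, map_smul, sub_add_cancel,
    add_sub_cancel_right] <;>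
  match_scalars <;> field_simp (disch := exact oddCeil_ne_zero _) <;>
  first
  | (push_cast; ring1)
  | (by_cases hi : Even i <;> by_cases hj : Even j <;> by_cases hl : Even l <;>
      simp only [sgn, oddCeil, gCoef, hCoef, Int.even_add, Int.even_sub, Int.not_even_one, hi, hj,
        hl, iff_true, true_iff, iff_false, false_iff, not_true, not_false, if_true, if_false] <;>
      push_cast <;> ring1)

theorem laurent_pm_minus (p : ℝ) (j k l : Fin 2) :
    (laurentPlus j * laurentMinus p k + laurentMinus p k * laurentPlus j) * laurentMinus p l -
      laurentMinus p l * (laurentPlus j * laurentMinus p k + laurentMinus p k * laurentPlus j) =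
    if j = l then (-2 : ℂ) • laurentMinus p k else 0 := by
  obtain ⟨h00, h01, h10, h11⟩ := laurent_anticommutators p
  fin_cases j <;> fin_cases k <;> fin_cases l <;>
  simp only [Fin.zero_eta, Fin.mk_one, h00, h01, h10, h11, if_true, one_ne_zero,
    zero_ne_one, if_false] <;>
  refine lop_ext fun i j l => ?_ <;>
  simp only [LinearMap.add_apply, LinearMap.sub_apply, LinearMap.smul_apply,
    LinearMap.zero_apply, Module.End.mul_apply, laurentPlus_zero, laurentPlus_one,
    laurentMinus_zero, laurentMinus_one, lop_lmono, map_add, map_sub, map_smul, sub_add_cancel,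
    add_sub_cancel_right] <;>
  match_scalars <;> field_simp (disch := exact oddCeil_ne_zero _) <;>
  first
  | (push_cast; ring1)
  | (by_cases hi : Even i <;> by_cases hj : Even j <;> by_cases hl : Even l <;>
      simp only [sgn, oddCeil, gCoef, hCoef, Int.even_add, Int.even_sub, Int.not_even_one, hi, hj,
        hl, iff_true, true_iff, iff_false, false_iff, not_true, not_false, if_true, if_false] <;>
      push_cast <;> ring1)

theorem laurentPlus_sq_mul :
    laurentPlus 0 * (laurentPlus 0 * laurentPlus 1) =
      laurentPlus 1 * (laurentPlus 0 * laurentPlus 0) ∧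
    laurentPlus 1 * (laurentPlus 1 * laurentPlus 0) =
      laurentPlus 0 * (laurentPlus 1 * laurentPlus 1) := by
  refine ⟨lop_ext fun i j l => ?_, lop_ext fun i j l => ?_⟩ <;>
  simp only [LinearMap.add_apply, LinearMap.sub_apply, LinearMap.smul_apply,
    LinearMap.zero_apply, Module.End.mul_apply, laurentPlus_zero, laurentPlus_one,
    laurentMinus_zero, laurentMinus_one, lop_lmono, map_add, map_sub, map_smul, sub_add_cancel,
    add_sub_cancel_right] <;>
  match_scalars <;> field_simp (disch := exact oddCeil_ne_zero _) <;>
  first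
  | (push_cast; ring1)
  | (by_cases hi : Even i <;> by_cases hj : Even j <;> by_cases hl : Even l <;>
      simp only [sgn, oddCeil, gCoef, hCoef, Int.even_add, Int.even_sub, Int.not_even_one, hi, hj,
        hl, iff_true, true_iff, iff_false, false_iff, not_true, not_false, if_true, if_false] <;>
      push_cast <;> ring1)

theorem laurentMinus_sq_mul (p : ℝ) :
    laurentMinus p 0 * (laurentMinus p 0 * laurentMinus p 1) =
      laurentMinus p 1 * (laurentMinus p 0 * laurentMinus p 0) ∧
    laurentMinus p 1 * (laurentMinus p 1 * laurentMinus p 0) =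
      laurentMinus p 0 * (laurentMinus p 1 * laurentMinus p 1) := by
  refine ⟨lop_ext fun i j l => ?_, lop_ext fun i j l => ?_⟩ <;>
  simp only [LinearMap.add_apply, LinearMap.sub_apply, LinearMap.smul_apply,
    LinearMap.zero_apply, Module.End.mul_apply, laurentPlus_zero, laurentPlus_one,
    laurentMinus_zero, laurentMinus_one, lop_lmono, map_add, map_sub, map_smul, sub_add_cancel,
    add_sub_cancel_right] <;>
  match_scalars <;> field_simp (disch := exact oddCeil_ne_zero _) <;>
  first
  | (push_cast; ring1)
  | (by_cases hi : Even i <;> by_cases hj : Even j <;> by_cases hl : Even l <;>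
      simp only [sgn, oddCeil, gCoef, hCoef, Int.even_add, Int.even_sub, Int.not_even_one, hi, hj,
        hl, iff_true, true_iff, iff_false, false_iff, not_true, not_false, if_true, if_false] <;>
      push_cast <;> ring1)

end

/-- Once the cross terms such as x₀x₁x₀ cancel, each case is trivial or says that the square of one
generator commutes with the other. -/
theorem anticommutator_commute_of_sq {A : Type*} [Ring A] (x : Fin 2 → A)
    (h0 : x 0 * (x 0 * x 1) = x 1 * (x 0 * x 0)) (h1 : x 1 * (x 1 * x 0) = x 0 * (x 1 * x 1))
    (j k l : Fin 2) : (x j * x k + x k * x j) * x l - x l * (x j * x k + x k * x j) = 0 := by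
  fin_cases j <;> fin_cases k <;> fin_cases l <;>
  simp only [Fin.zero_eta, Fin.mk_one, add_mul, mul_add, mul_assoc, h0, h1] <;> abel

theorem isParaboson_laurent (p : ℝ) : IsParaboson laurentPlus (laurentMinus p) where
  pm_p := laurent_pm_plus p
  pm_m := laurent_pm_minus p
  pp_p := anticommutator_commute_of_sq _ laurentPlus_sq_mul.1 laurentPlus_sq_mul.2
  mm_m := anticommutator_commute_of_sq _ (laurentMinus_sq_mul p).1 (laurentMinus_sq_mul p).2

end

/-! ### The polynomial model as a quotient of the induced module -/

section

/-- Allows the relations to be verified on Laurent monomials, where lowering an exponent has no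
boundary case. -/
theorem IsParaboson.of_injective {n : ℕ} {W W' : Type*} [AddCommGroup W] [Module ℂ W]
    [AddCommGroup W'] [Module ℂ W'] {P M : Fin n → Module.End ℂ W} {P' M' : Fin n → Module.End ℂ W'}
    (h : IsParaboson P' M') (f : W →ₗ[ℂ] W') (hf : Function.Injective f)
    (hP : ∀ j v, f (P j v) = P' j (f v)) (hM : ∀ j v, f (M j v) = M' j (f v)) :
    IsParaboson P M := by
  constructor <;> intro j k l <;> refine LinearMap.ext fun v => hf ?_
  · have := LinearMap.congr_fun (h.pm_p j k l) (f v)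
    split_ifs at this ⊢ <;> simpa [hP, hM] using this
  · have := LinearMap.congr_fun (h.pm_m j k l) (f v)
    split_ifs at this ⊢ <;> simpa [hP, hM] using this
  · simpa [hP, hM] using LinearMap.congr_fun (h.pp_p j k l) (f v)
  · simpa [hP, hM] using LinearMap.congr_fun (h.mm_m j k l) (f v)

/-- The model of the induced module: the span of the monomials `u^i v^j t^l` with
nonnegative exponents. -/
def Model (_p : ℝ) : Type := ℕ × ℕ × ℕ →₀ ℂ

instance (p : ℝ) : AddCommGroup (Model p) := inferInstanceAs (AddCommGroup (ℕ × ℕ × ℕ →₀ ℂ))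

instance (p : ℝ) : Module ℂ (Model p) := inferInstanceAs (Module ℂ (ℕ × ℕ × ℕ →₀ ℂ))

section
variable {p : ℝ}

/-- The basis of monomials. -/
def modelBasis (p : ℝ) : Module.Basis (ℕ × ℕ × ℕ) ℂ (Model p) :=
  (Finsupp.basisSingleOne : Module.Basis (ℕ × ℕ × ℕ) ℂ (ℕ × ℕ × ℕ →₀ ℂ))

/-- The monomial `u^i v^j t^l`. -/
def mono (p : ℝ) (i j l : ℕ) : Model p := modelBasis p (i, j, l)

/-- The creation operators of the model. -/
def modelPlus (p : ℝ) : Fin 2 → Module.End ℂ (Model p) :=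
  ![(modelBasis p).constr ℂ fun m => sgn m.2.2 • mono p (m.1 + 1) m.2.1 m.2.2 -
      (m.2.1 / oddCeil (m.1 + m.2.1) : ℂ) • mono p m.1 (m.2.1 - 1) (m.2.2 + 1),
    (modelBasis p).constr ℂ fun m => sgn m.2.2 • mono p m.1 (m.2.1 + 1) m.2.2 +
      (m.1 / oddCeil (m.1 + m.2.1) : ℂ) • mono p (m.1 - 1) m.2.1 (m.2.2 + 1)]

/-- The annihilation operators of the model. -/
def modelMinus (p : ℝ) : Fin 2 → Module.End ℂ (Model p) :=
  ![(modelBasis p).constr ℂ fun m =>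
      (sgn m.2.2 * m.1 * gCoef p (m.1 + m.2.1 + m.2.2) / oddCeil (m.1 + m.2.1) : ℂ) •
        mono p (m.1 - 1) m.2.1 m.2.2 - hCoef p m.2.2 • mono p m.1 (m.2.1 + 1) (m.2.2 - 1),
    (modelBasis p).constr ℂ fun m =>
      (sgn m.2.2 * m.2.1 * gCoef p (m.1 + m.2.1 + m.2.2) / oddCeil (m.1 + m.2.1) : ℂ) •
        mono p m.1 (m.2.1 - 1) m.2.2 + hCoef p m.2.2 • mono p (m.1 + 1) m.2.1 (m.2.2 - 1)]

theorem modelPlus_zero (i j l : ℕ) : modelPlus p 0 (mono p i j l) =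
    sgn l • mono p (i + 1) j l - (j / oddCeil (i + j) : ℂ) • mono p i (j - 1) (l + 1) := by
  simp only [modelPlus, Matrix.cons_val_zero]
  exact (modelBasis p).constr_basis ℂ _ _

theorem modelPlus_one (i j l : ℕ) : modelPlus p 1 (mono p i j l) =
    sgn l • mono p i (j + 1) l + (i / oddCeil (i + j) : ℂ) • mono p (i - 1) j (l + 1) := by
  simp only [modelPlus, Matrix.cons_val_one]
  exact (modelBasis p).constr_basis ℂ _ _

theorem modelMinus_zero (i j l : ℕ) : modelMinus p 0 (mono p i j l) =
    (sgn l * i * gCoef p (i + j + l) / oddCeil (i + j) : ℂ) • mono p (i - 1) j l -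
      hCoef p l • mono p i (j + 1) (l - 1) := by
  simp only [modelMinus, Matrix.cons_val_zero]
  exact (modelBasis p).constr_basis ℂ _ _

theorem modelMinus_one (i j l : ℕ) : modelMinus p 1 (mono p i j l) =
    (sgn l * j * gCoef p (i + j + l) / oddCeil (i + j) : ℂ) • mono p i (j - 1) l +
      hCoef p l • mono p (i + 1) j (l - 1) := by
  simp only [modelMinus, Matrix.cons_val_one]
  exact (modelBasis p).constr_basis ℂ _ _

theorem hCoef_zero : hCoef p 0 = 0 := by simp [hCoef]

/-- The inclusion of the model into Laurent monomials. -/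
def modelEmbed (p : ℝ) : Model p →ₗ[ℂ] LaurentModel :=
  Finsupp.lmapDomain ℂ ℂ fun m : ℕ × ℕ × ℕ => ((m.1, m.2.1, m.2.2) : ℤ × ℤ × ℤ)

theorem modelEmbed_mono (i j l : ℕ) : modelEmbed p (mono p i j l) = lmono i j l := by
  have : mono p i j l = (Finsupp.single (i, j, l) 1 : ℕ × ℕ × ℕ →₀ ℂ) :=
    congrFun (Finsupp.coe_basisSingleOne (R := ℂ)) (i, j, l)
  rw [this, modelEmbed, lmono]
  exact Finsupp.mapDomain_single

theorem modelEmbed_injective : Function.Injective (modelEmbed p) := by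
  refine Finsupp.mapDomain_injective fun a b h => ?_
  simpa [Prod.ext_iff] using h

theorem model_hom_ext {W : Type*} [AddCommGroup W] [Module ℂ W] {f g : Model p →ₗ[ℂ] W}
    (h : ∀ i j l, f (mono p i j l) = g (mono p i j l)) : f = g :=
  (modelBasis p).ext fun m => h m.1 m.2.1 m.2.2

theorem modelEmbed_modelPlus (j : Fin 2) (v : Model p) :
    modelEmbed p (modelPlus p j v) = laurentPlus j (modelEmbed p v) := by
  suffices h : modelEmbed p ∘ₗ modelPlus p j = laurentPlus j ∘ₗ modelEmbed p from
    LinearMap.congr_fun h v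
  refine model_hom_ext fun a b l => ?_
  fin_cases j
  · simp only [Fin.zero_eta, LinearMap.comp_apply, modelPlus_zero, modelEmbed_mono, laurentPlus_zero,
      map_sub, map_smul]
    rcases b with _ | b <;> simp
  · simp only [Fin.mk_one, LinearMap.comp_apply, modelPlus_one, modelEmbed_mono, laurentPlus_one,
      map_add, map_smul]
    rcases a with _ | a <;> simp

/-- Truncated subtraction does no harm: a term that would lower the exponent 0 of u, v or t carries
the factor i, j or `hCoef p 0`, which is then zero. -/
theorem modelEmbed_modelMinus (j : Fin 2) (v : Model p) :
    modelEmbed p (modelMinus p j v) = laurentMinus p j (modelEmbed p v) := by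
  suffices h : modelEmbed p ∘ₗ modelMinus p j = laurentMinus p j ∘ₗ modelEmbed p from
    LinearMap.congr_fun h v
  refine model_hom_ext fun a b l => ?_
  fin_cases j
  · simp only [Fin.zero_eta, LinearMap.comp_apply, modelMinus_zero, modelEmbed_mono,
      laurentMinus_zero, map_sub, map_smul]
    rcases a with _ | a <;> rcases l with _ | l <;> simp [hCoef_zero]
  · simp only [Fin.mk_one, LinearMap.comp_apply, modelMinus_one, modelEmbed_mono, laurentMinus_one,
      map_add, map_smul]
    rcases b with _ | b <;> rcases l with _ | l <;> simp [hCoef_zero]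

theorem isParaboson_model (p : ℝ) : IsParaboson (modelPlus p) (modelMinus p) :=
  (isParaboson_laurent p).of_injective (modelEmbed p) modelEmbed_injective modelEmbed_modelPlus
    modelEmbed_modelMinus

instance : Module (Env 2) (Model p) :=
  Module.compHom (Model p) (envLift (isParaboson_model p)).toRingHom

theorem model_smul_def (u : Env 2) (v : Model p) : u • v = envLift (isParaboson_model p) u v := rfl

instance : IsScalarTower ℂ (Env 2) (Model p) :=
  ⟨fun r u v => by rw [model_smul_def, map_smul]; rfl⟩

@[simp] theorem model_bPlus_smul (j : Fin 2) (v : Model p) :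
    toEnv 2 (bPlus j) • v = modelPlus p j v := by
  rw [model_smul_def, envLift_bPlus]

@[simp] theorem model_bMinus_smul (j : Fin 2) (v : Model p) :
    toEnv 2 (bMinus j) • v = modelMinus p j v := by
  rw [model_smul_def, envLift_bMinus]

theorem isVacuum_mono : IsVacuum (n := 2) p (mono p 0 0 0) := by
  have h0 (j : Fin 2) : modelMinus p j (mono p 0 0 0) = 0 := by
    fin_cases j
    · simp [modelMinus_zero, hCoef_zero]
    · simp [modelMinus_one, hCoef_zero]
  refine ⟨fun j => by rw [model_bMinus_smul, h0], fun j k => ?_⟩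
  rw [add_smul, mul_smul, mul_smul, model_bMinus_smul, h0, smul_zero, zero_add]
  simp only [model_bMinus_smul, model_bPlus_smul]
  fin_cases j <;> fin_cases k <;>
    simp [modelPlus_zero, modelPlus_one, modelMinus_zero, modelMinus_one, hCoef_zero, sgn, gCoef,
      oddCeil]

/-- The canonical map from the induced module to the model. -/
def toModel (p : ℝ) : Vbar 2 p →ₗ[Env 2] Model p := vbarLift isVacuum_mono

theorem toModel_vbarVac : toModel p (vbarVac 2 p) = mono p 0 0 0 := vbarLift_vbarVac _

/-- The vacuum generates the model. -/
theorem mono_mem {N : Submodule (Env 2) (Model p)} (h0 : mono p 0 0 0 ∈ N) (i j l : ℕ) :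
    mono p i j l ∈ N := by
  have hs {r : ℂ} (hr : r ≠ 0) {v : Model p} (h : r • v ∈ N) : v ∈ N := by
    have := N.smul_mem (algebraMap ℂ (Env 2) r⁻¹) h
    rwa [algebraMap_smul, smul_smul, inv_mul_cancel₀ hr, one_smul] at this
  have hs' (r : ℂ) {v : Model p} (h : v ∈ N) : r • v ∈ N := by
    have := N.smul_mem (algebraMap ℂ (Env 2) r) h
    rwa [algebraMap_smul] at this
  have hP (k : Fin 2) {v : Model p} (h : v ∈ N) : modelPlus p k v ∈ N := by
    rw [← model_bPlus_smul]; exact N.smul_mem _ h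
  -- b₂⁺ on u^{i+1}v^j t^l and b₁⁺ on u^i v^{j+1} t^l share their leading term. The difference is (i
  -- + j + 2)/`oddCeil (i + j + 1)` times u^i v^j t^{l+1}, a nonzero multiple whatever p is.
  have step1 {i j l : ℕ} (h1 : mono p (i + 1) j l ∈ N) (h2 : mono p i (j + 1) l ∈ N) :
      mono p i j (l + 1) ∈ N := by
    have h := N.sub_mem (hP 1 h1) (hP 0 h2)
    rw [modelPlus_one, modelPlus_zero, add_sub_sub_cancel, add_tsub_cancel_right,
      add_tsub_cancel_right,
      show ((i : ℤ) + (j + 1 : ℕ)) = ((i + 1 : ℕ) : ℤ) + j by push_cast; ring,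
      ← add_smul, ← add_div] at h
    refine hs (div_ne_zero ?_ (oddCeil_ne_zero _)) h
    norm_cast
  -- The induction runs over the number of creation operators applied to the vacuum; t counts twice.
  suffices h : ∀ s i j l : ℕ, i + j + 2 * l = s → mono p i j l ∈ N from h _ i j l rfl
  intro s
  induction s with
  | zero =>
    intro i j l h
    obtain ⟨rfl, rfl, rfl⟩ : i = 0 ∧ j = 0 ∧ l = 0 := by omega
    exact h0
  | succ s ih =>
    have hl : ∀ i j l, i + j + 2 * (l + 1) = s + 1 → mono p i j (l + 1) ∈ N := fun i j l h =>
      step1 (ih _ _ _ (by omega)) (ih _ _ _ (by omega))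
    intro i j l h
    rcases l with _ | l
    · rcases i with _ | i
      · rcases j with _ | j
        · omega
        · have h1 := hP 1 (ih 0 j 0 (by omega))
          rw [modelPlus_one] at h1
          simpa [sgn] using h1
      · have h1 := hP 0 (ih i j 0 (by omega))
        rw [modelPlus_zero] at h1
        rcases j with _ | j
        · simpa [sgn] using h1
        · have h2 := N.add_mem h1 (hs' ((j + 1 : ℕ) / oddCeil (i + (j + 1 : ℕ)))
            (hl i j 0 (by omega)))
          rw [add_tsub_cancel_right, zero_add, sub_add_cancel] at h2
          simpa [sgn] using h2
    · exact hl i j l h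

theorem toModel_surjective : Function.Surjective (toModel p) := by
  rw [← LinearMap.range_eq_top, eq_top_iff]
  rintro v -
  have h : ∀ i j l, mono p i j l ∈ LinearMap.range (toModel p) :=
    mono_mem ⟨vbarVac 2 p, toModel_vbarVac⟩
  have hv := (modelBasis p).mem_span v
  have hle : Submodule.span ℂ (Set.range (modelBasis p)) ≤
      (LinearMap.range (toModel p)).restrictScalars ℂ := by
    rw [Submodule.span_le]
    rintro _ ⟨m, rfl⟩
    exact h m.1 m.2.1 m.2.2
  exact hle hv

end

end

/-! ### Finite weight multiplicities, injectivity and characters -/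

section

section
variable {ι κ W : Type*} [AddCommGroup W] [Module ℂ W]

open Classical in
/-- A surjective endomorphism that respects a grading with finite-dimensional pieces
is injective. -/
theorem injective_of_surjective_of_graded (b : Module.Basis ι ℂ W) (s : ι → κ)
    (hfin : ∀ k, (s ⁻¹' {k}).Finite) (T : Module.End ℂ W)
    (hT : ∀ i i', b.repr (T (b i)) i' ≠ 0 → s i' = s i) (hs : Function.Surjective T) :
    Function.Injective T := by
  -- The projection to degree k commutes with `T`, so each finite-dimensional piece inherits
  -- surjectivity and hence injectivity.
  let proj (k : κ) : Module.End ℂ W := b.constr ℂ fun i => if s i = k then b i else 0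
  have hrepr (k : κ) (x : W) (i : ι) :
      b.repr (proj k x) i = if s i = k then b.repr x i else 0 := by
    have h : b.coord i ∘ₗ proj k = (if s i = k then (1 : ℂ) else 0) • b.coord i := by
      refine b.ext fun i' => ?_
      simp only [proj, LinearMap.comp_apply, Module.Basis.constr_basis, LinearMap.smul_apply]
      by_cases h : i' = i
      · subst h; split_ifs <;> simp
      · split_ifs <;> simp [h]
    have := LinearMap.congr_fun h x
    split_ifs at this ⊢ <;> simpa using this
  have hcomm (k : κ) (x : W) : T (proj k x) = proj k (T x) := by
    suffices h : T ∘ₗ proj k = proj k ∘ₗ T from LinearMap.congr_fun h x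
    refine b.ext fun i => b.repr.injective (Finsupp.ext fun i' => ?_)
    simp only [LinearMap.comp_apply, hrepr]
    simp only [proj, Module.Basis.constr_basis]
    have := hT i i'
    by_cases h0 : b.repr (T (b i)) i' = 0
    · split_ifs <;> simp [h0]
    · rw [this h0]; split_ifs <;> simp
  have hinj (k : κ) (x : W) (hx : T (proj k x) = 0) : proj k x = 0 := by
    have hfd : FiniteDimensional ℂ (LinearMap.range (proj k)) := by
      have : FiniteDimensional ℂ (Submodule.span ℂ (b '' (s ⁻¹' {k}))) :=
        FiniteDimensional.span_of_finite ℂ ((hfin k).image b)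
      refine Submodule.finiteDimensional_of_le (S₂ := Submodule.span ℂ (b '' (s ⁻¹' {k}))) ?_
      rintro _ ⟨y, rfl⟩
      rw [b.mem_span_image]
      intro i hi
      by_contra hik
      simp only [Finset.mem_coe, Finsupp.mem_support_iff, hrepr] at hi
      exact hi (if_neg hik)
    have hmaps : ∀ y ∈ LinearMap.range (proj k), T y ∈ LinearMap.range (proj k) := by
      rintro _ ⟨y, rfl⟩
      exact ⟨T y, (hcomm k y).symm⟩
    have hsurj : Function.Surjective (T.restrict hmaps) := by
      rintro ⟨_, ⟨y, rfl⟩⟩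
      obtain ⟨z, rfl⟩ := hs y
      exact ⟨⟨proj k z, z, rfl⟩, Subtype.ext (hcomm k z)⟩
    have h := LinearMap.injective_iff_surjective.2 hsurj
    have := @h ⟨proj k x, x, rfl⟩ 0 (Subtype.ext (by simpa using hx))
    exact congrArg Subtype.val this
  rw [← LinearMap.ker_eq_bot, LinearMap.ker_eq_bot']
  intro x hx
  refine b.repr.injective (Finsupp.ext fun i => ?_)
  have h := hinj (s i) x (by rw [hcomm, hx, map_zero])
  have h2 := hrepr (s i) x i
  rw [h, if_pos rfl] at h2
  simpa using h2.symm

variable {n : ℕ} [Module (Env n) W] [IsScalarTower ℂ (Env n) W]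

/-- A coordinate functional of a weight basis is an eigenvector of the transposed Cartan operators,
so only basis vectors of weight μ can occur in a vector of weight μ. -/
theorem eq_of_mem_weightSpace (b : Module.Basis ι ℂ W) {wt : ι → Fin n → ℂ}
    (hb : ∀ i, b i ∈ weightSpace W (wt i)) {μ : Fin n → ℂ} {v : W} (hv : v ∈ weightSpace W μ)
    {i : ι} (hi : b.repr v i ≠ 0) : wt i = μ := by
  ext j
  have h : b.coord i ∘ₗ Module.toModuleEnd ℂ W (toEnv n (cartan j)) = wt i j • b.coord i := by
    refine b.ext fun i' => ?_
    simp only [LinearMap.comp_apply, Module.toModuleEnd_apply, DistribSMul.toLinearMap_apply,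
      mem_weightSpace.1 (hb i') j, map_smul, LinearMap.smul_apply]
    by_cases h : i' = i
    · subst h; rfl
    · simp [h]
  have h2 := LinearMap.congr_fun h v
  simp only [LinearMap.comp_apply, Module.toModuleEnd_apply, DistribSMul.toLinearMap_apply,
    mem_weightSpace.1 hv j, map_smul, LinearMap.smul_apply, Module.Basis.coord_apply,
    smul_eq_mul] at h2
  exact (mul_right_cancel₀ hi h2).symm

theorem weightSpace_eq_span (b : Module.Basis ι ℂ W) {wt : ι → Fin n → ℂ}
    (hb : ∀ i, b i ∈ weightSpace W (wt i)) (μ : Fin n → ℂ) :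
    weightSpace W μ = Submodule.span ℂ (b '' {i | wt i = μ}) := by
  apply le_antisymm
  · intro v hv
    rw [b.mem_span_image]
    intro i hi
    exact eq_of_mem_weightSpace b hb hv (Finsupp.mem_support_iff.1 hi)
  · rw [Submodule.span_le]
    rintro _ ⟨i, rfl, rfl⟩
    exact hb i

/-- The character of a module with a basis of weight vectors. -/
theorem hasChar_of_basis (b : Module.Basis ι ℂ W) (σ : Fin n → ℂ) (r : ι → Fin n →₀ ℕ)
    (hb : ∀ i, b i ∈ weightSpace W (fun j => σ j + r i j)) (hfin : ∀ k, (r ⁻¹' {k}).Finite)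
    {F : MvPowerSeries (Fin n) ℚ}
    (hF : ∀ k, ((r ⁻¹' {k}).ncard : ℚ) = MvPowerSeries.coeff k F) : HasChar W σ F := by
  have hset (k : Fin n →₀ ℕ) :
      {i | (fun j => σ j + (r i j : ℂ)) = fun j => σ j + (k j : ℂ)} = r ⁻¹' {k} := by
    ext i
    simp [funext_iff, Finsupp.ext_iff]
  have hempty (μ : Fin n → ℂ) (h : ∀ k : Fin n →₀ ℕ, μ ≠ fun j => σ j + (k j : ℂ)) :
      weightSpace W μ = ⊥ := by
    rw [weightSpace_eq_span b hb, Set.eq_empty_of_forall_notMem (s := {i | _ = μ}), Set.image_empty,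
      Submodule.span_empty]
    exact fun i hi => h (r i) hi.symm
  constructor
  · rw [eq_top_iff, ← b.span_eq, Submodule.span_le]
    rintro _ ⟨i, rfl⟩
    exact Submodule.mem_iSup_of_mem _ (hb i)
  · intro μ
    by_cases h : ∃ k : Fin n →₀ ℕ, μ = fun j => σ j + (k j : ℂ)
    · obtain ⟨k, rfl⟩ := h
      rw [weightSpace_eq_span b hb, hset]
      exact FiniteDimensional.span_of_finite ℂ ((hfin k).image b)
    · rw [hempty μ (not_exists.1 h)]
      infer_instance
  · intro k
    rw [weightSpace_eq_span b hb, hset, ← hF, Set.image_eq_range]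
    have := (hfin k).fintype
    change ((Module.finrank ℂ (Submodule.span ℂ
      (Set.range (b ∘ (Subtype.val : r ⁻¹' {k} → ι)))) : ℕ) : ℚ) = _
    rw [finrank_span_eq_card (b.linearIndependent.comp _ Subtype.val_injective),
      ← Nat.card_eq_fintype_card, Nat.card_coe_set_eq]
  · exact hempty

end

section
variable {p : ℝ}

theorem mono_mem_weightSpace (i j l : ℕ) :
    mono p i j l ∈ weightSpace (Model p) (fun k => (p : ℂ) / 2 + rel (i, j, l) k) := by
  rw [mem_weightSpace]
  intro k
  refine modelEmbed_injective ?_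
  rw [toEnv_cartan, smul_assoc, add_smul, mul_smul, mul_smul]
  simp only [model_bPlus_smul, model_bMinus_smul, map_smul, map_add, modelEmbed_modelPlus,
    modelEmbed_modelMinus, modelEmbed_mono]
  fin_cases k
  · have h := LinearMap.congr_fun (laurent_anticommutators p).1 (lmono i j l)
    simp only [LinearMap.add_apply, Module.End.mul_apply, lop_lmono] at h
    simp only [Fin.zero_eta, h, smul_smul, rel]
    congr 1
    simp
    ring
  · have h := LinearMap.congr_fun (laurent_anticommutators p).2.2.2 (lmono i j l)
    simp only [LinearMap.add_apply, Module.End.mul_apply, lop_lmono] at h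
    simp only [Fin.mk_one, h, smul_smul, rel]
    congr 1
    simp
    ring

/-- A weight fixes i + l and j + l. The only freedom is l, bounded by both components. -/
theorem rel_fiber (k : Fin 2 → ℕ) : rel ⁻¹' {k} =
    (fun l => (k 0 - l, k 1 - l, l)) '' (Finset.range (min (k 0) (k 1) + 1) : Set ℕ) := by
  ext ⟨i, j, l⟩
  simp only [Set.mem_preimage, Set.mem_singleton_iff, rel, funext_iff, Fin.forall_fin_two,
    Matrix.cons_val_zero, Matrix.cons_val_one, Set.mem_image, Finset.coe_range, Set.mem_Iio,
    Prod.mk.injEq]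
  constructor
  · rintro ⟨h0, h1⟩
    exact ⟨l, by omega, by omega, by omega, rfl⟩
  · rintro ⟨l', h, h0, h1, rfl⟩
    omega

theorem rel_fiber_finite (k : Fin 2 → ℕ) : (rel ⁻¹' {k}).Finite := by
  rw [rel_fiber]
  exact (Finset.finite_toSet _).image _

theorem rel_fiber_ncard (k : Fin 2 → ℕ) : (rel ⁻¹' {k}).ncard = min (k 0) (k 1) + 1 := by
  rw [rel_fiber, Set.ncard_image_of_injective, Set.ncard_coe_finset, Finset.card_range]
  intro a b h
  simpa using congrArg (fun x => x.2.2) h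

/-- Sending u^a v^b t^d to the raised vector with the same index, and this to the model, gives a
surjective endomorphism that preserves the finite-dimensional weight spaces. It is therefore
injective, and as its first factor `U` is onto, its second factor `toModel` is injective. -/
theorem toModel_injective : Function.Injective (toModel p) := by
  let T : Module.End ℂ (Model p) := (modelBasis p).constr ℂ (raise (mono p 0 0 0))
  let U : Model p →ₗ[ℂ] Vbar 2 p := (modelBasis p).constr ℂ (raise (vbarVac 2 p))
  have hTb (m : ℕ × ℕ × ℕ) : T (modelBasis p m) = raise (mono p 0 0 0) m :=
    (modelBasis p).constr_basis ℂ _ _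
  have hUb (m : ℕ × ℕ × ℕ) : U (modelBasis p m) = raise (vbarVac 2 p) m :=
    (modelBasis p).constr_basis ℂ _ _
  have hUs : Function.Surjective U := by
    rw [← LinearMap.range_eq_top, eq_top_iff, ← span_raise_vbarVac, Submodule.span_le]
    rintro _ ⟨m, rfl⟩
    exact ⟨_, hUb m⟩
  have hTU (x : Model p) : T x = toModel p (U x) := by
    suffices h : T = (toModel p).restrictScalars ℂ ∘ₗ U from LinearMap.congr_fun h x
    refine (modelBasis p).ext fun m => ?_
    rw [hTb, LinearMap.comp_apply, hUb, LinearMap.restrictScalars_apply, raise_map,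
      toModel_vbarVac]
  have hTs : Function.Surjective T := fun y => by
    obtain ⟨x, rfl⟩ := toModel_surjective y
    obtain ⟨z, rfl⟩ := hUs x
    exact ⟨z, hTU z⟩
  have hw0 := (isVacuum_mono (p := p)).mem_weightSpace
  have hTi := injective_of_surjective_of_graded (modelBasis p) rel rel_fiber_finite T (by
    intro m m' h
    rw [hTb] at h
    have := eq_of_mem_weightSpace (modelBasis p)
      (fun m => mono_mem_weightSpace m.1 m.2.1 m.2.2) (raise_mem_weightSpace hw0 m) h
    simpa [funext_iff] using this) hTs
  rw [← LinearMap.ker_eq_bot, LinearMap.ker_eq_bot']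
  intro v hv
  obtain ⟨x, rfl⟩ := hUs v
  rw [← hTU] at hv
  rw [hTi (hv.trans (map_zero T).symm), map_zero]

end

section
open MvPowerSeries

theorem coeff_X_mul_ite (F : MvPowerSeries (Fin 2) ℚ) (k : Fin 2 →₀ ℕ) (s : Fin 2) :
    coeff k (X s * F) = if 1 ≤ k s then coeff (k - Finsupp.single s 1) F else 0 := by
  rw [X, coeff_monomial_mul]; simp [Finsupp.single_le_iff]

/-- Multiplication by 1 − X_s takes differences along the exponent s. On the series with all
coefficients 1, this leaves only the terms where that exponent is zero. -/
theorem one_sub_mul_one_sub_mul {G : MvPowerSeries (Fin 2) ℚ} (hG : ∀ k, coeff k G = 1) :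
    ((1 - X 0) * (1 - X 1) : MvPowerSeries (Fin 2) ℚ) * G = 1 := by
  have h1 (k) : coeff k ((1 - X 1 : MvPowerSeries (Fin 2) ℚ) * G) = if k 1 = 0 then 1 else 0 := by
    rw [sub_mul, one_mul, map_sub, coeff_X_mul_ite, hG, hG]
    by_cases h : k 1 = 0
    · simp [h]
    · simp [h, Nat.one_le_iff_ne_zero]
  rw [mul_assoc]
  ext k
  have hk : k = 0 ↔ k 0 = 0 ∧ k 1 = 0 := by simp [Finsupp.ext_iff, Fin.forall_fin_two]
  rw [sub_mul, one_mul, map_sub, coeff_X_mul_ite, h1, h1, coeff_one, if_congr hk rfl rfl]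
  by_cases h : k 0 = 0
  · simp [h]
  · simp [h, Nat.one_le_iff_ne_zero]

theorem coeff_inv_two (k : Fin 2 →₀ ℕ) :
    coeff k ((1 - X 0) * (1 - X 1) : MvPowerSeries (Fin 2) ℚ)⁻¹ = 1 := by
  let G : MvPowerSeries (Fin 2) ℚ := fun _ => 1
  have hG : ∀ k, coeff k G = 1 := fun _ => rfl
  have h := one_sub_mul_one_sub_mul hG
  rw [mul_comm] at h
  rw [← (MvPowerSeries.eq_inv_iff_mul_eq_one (by simp)).2 h, hG]

/-- Multiplication by 1 − X₀X₁ takes differences along the diagonal, where min(k₀, k₁) + 1 grows in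
steps of 1 from the boundary value 1. This leaves the series with all coefficients 1. -/
theorem coeff_inv_three (k : Fin 2 →₀ ℕ) :
    coeff k ((1 - X 0) * (1 - X 1) * (1 - X 0 * X 1) : MvPowerSeries (Fin 2) ℚ)⁻¹ =
      ((min (k 0) (k 1) + 1 : ℕ) : ℚ) := by
  let H : MvPowerSeries (Fin 2) ℚ := fun k => ((min (k 0) (k 1) + 1 : ℕ) : ℚ)
  have hH : ∀ k, coeff k H = ((min (k 0) (k 1) + 1 : ℕ) : ℚ) := fun _ => rfl
  have h1 (k) : coeff k ((1 - X 0 * X 1 : MvPowerSeries (Fin 2) ℚ) * H) = 1 := by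
    rw [sub_mul, one_mul, map_sub, mul_assoc, coeff_X_mul_ite, coeff_X_mul_ite, hH, hH]
    by_cases h0 : k 0 = 0
    · simp [h0]
    by_cases h1 : k 1 = 0
    · simp [h1]
    obtain ⟨a, ha⟩ := Nat.exists_eq_succ_of_ne_zero h0
    obtain ⟨b, hb⟩ := Nat.exists_eq_succ_of_ne_zero h1
    simp [ha, hb]
  have h := one_sub_mul_one_sub_mul h1
  rw [← mul_assoc, mul_comm] at h
  rw [← (MvPowerSeries.eq_inv_iff_mul_eq_one (by simp)).2 h, hH]

end

end

/-! ### The inner product of the model -/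

section

section
variable {ι W : Type*} [AddCommGroup W] [Module ℂ W]

/-- The summation range depends on x. Enlarging it to a common finite set makes additivity and
Hermitian symmetry termwise statements. -/
theorem weighted_sum_eq (b : Module.Basis ι ℂ W) (w : ι → ℝ) (x y : W) (s : Finset ι)
    (hs : (b.repr x).support ⊆ s) :
    ∑ i ∈ (b.repr x).support, (w i : ℂ) * starRingEnd ℂ (b.repr x i) * b.repr y i =
      ∑ i ∈ s, (w i : ℂ) * starRingEnd ℂ (b.repr x i) * b.repr y i := by
  refine Finset.sum_subset hs fun i _ hi => ?_
  rw [Finsupp.notMem_support_iff.1 hi]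
  simp

/-- The inner product for which a basis is orthogonal with prescribed square lengths. -/
@[reducible] def weightedCore (b : Module.Basis ι ℂ W) (w : ι → ℝ) (hw : ∀ i, 0 < w i) :
    InnerProductSpace.Core ℂ W where
  inner x y := ∑ i ∈ (b.repr x).support, (w i : ℂ) * starRingEnd ℂ (b.repr x i) * b.repr y i
  conj_inner_symm x y := by
    classical
    rw [weighted_sum_eq b w x y _ Finset.subset_union_left,
      weighted_sum_eq b w y x _ Finset.subset_union_right, map_sum]
    refine Finset.sum_congr rfl fun i _ => ?_
    simp only [map_mul, Complex.conj_ofReal, Complex.conj_conj]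
    ring
  re_inner_nonneg x := by
    rw [map_sum]
    refine Finset.sum_nonneg fun i _ => ?_
    rw [mul_assoc, mul_comm (starRingEnd ℂ _), Complex.mul_conj, ← Complex.ofReal_mul]
    exact mul_nonneg (hw i).le (Complex.normSq_nonneg _)
  add_left x y z := by
    classical
    rw [weighted_sum_eq b w x z ((b.repr x).support ∪ (b.repr y).support)
        Finset.subset_union_left,
      weighted_sum_eq b w y z ((b.repr x).support ∪ (b.repr y).support)
        Finset.subset_union_right,
      weighted_sum_eq b w (x + y) z ((b.repr x).support ∪ (b.repr y).support)
        (by rw [map_add]; exact Finsupp.support_add), ← Finset.sum_add_distrib]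
    refine Finset.sum_congr rfl fun i _ => ?_
    rw [map_add, Finsupp.add_apply, map_add]
    ring
  smul_left x y r := by
    rw [weighted_sum_eq b w (r • x) y (b.repr x).support
      (by rw [map_smul]; exact Finsupp.support_smul), Finset.mul_sum]
    refine Finset.sum_congr rfl fun i _ => ?_
    rw [map_smul, Finsupp.smul_apply, smul_eq_mul, map_mul]
    ring
  definite x hx := by
    have h0 : ∑ i ∈ (b.repr x).support, w i * Complex.normSq (b.repr x i) = 0 := by
      have := congrArg Complex.re hx
      rw [Complex.re_sum] at this
      rw [← Complex.zero_re, ← this]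
      refine Finset.sum_congr rfl fun i _ => ?_
      rw [mul_assoc, mul_comm (starRingEnd ℂ _), Complex.mul_conj, ← Complex.ofReal_mul,
        Complex.ofReal_re]
    rw [Finset.sum_eq_zero_iff_of_nonneg
      fun i _ => mul_nonneg (hw i).le (Complex.normSq_nonneg _)] at h0
    refine b.repr.injective (Finsupp.ext fun i => ?_)
    by_contra hi
    have := h0 i (Finsupp.mem_support_iff.2 (by simpa using hi))
    rw [mul_eq_zero, Complex.normSq_eq_zero] at this
    exact hi (by simpa using this.resolve_left (hw i).ne')

open Classical in
theorem weightedCore_basis (b : Module.Basis ι ℂ W) (w : ι → ℝ) (hw : ∀ i, 0 < w i) (i j : ι) :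
    (weightedCore b w hw).inner (b i) (b j) = if i = j then (w i : ℂ) else 0 := by
  refine (weighted_sum_eq b w (b i) (b j) {i} ?_).trans ?_
  · rw [b.repr_self]; exact Finsupp.support_single_subset
  · by_cases h : i = j
    · simp [h]
    · simp [h, Finsupp.single_apply, Ne.symm h]

theorem core_adjoint_of_basis {c : InnerProductSpace.Core ℂ W} (b : Module.Basis ι ℂ W)
    (f g : Module.End ℂ W) (h : ∀ i j, c.inner (f (b i)) (b j) = c.inner (b i) (g (b j)))
    (v w : W) : c.inner (f v) w = c.inner v (g w) := by
  have h1 (i : ι) : c.inner (f (b i)) w = c.inner (b i) (g w) := by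
    induction b.mem_span w using Submodule.span_induction with
    | mem w hw => obtain ⟨j, rfl⟩ := hw; exact h i j
    | zero => rw [map_zero, core_zero_right, core_zero_right]
    | add x y _ _ hx hy => rw [map_add, core_add_right, core_add_right, hx, hy]
    | smul r x _ hx => rw [map_smul, core_smul_right, core_smul_right, hx]
  induction b.mem_span v using Submodule.span_induction with
  | mem v hv => obtain ⟨i, rfl⟩ := hv; exact h1 i
  | zero => rw [map_zero, core_zero_left, core_zero_left]
  | add x y _ _ hx hy => rw [map_add, c.add_left, c.add_left, hx, hy]
  | smul r x _ hx => rw [map_smul, c.smul_left, c.smul_left, hx]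

/-- Linear maps that intertwine the odd generators are homomorphisms of representations. -/
def envLinear {n : ℕ} {W W' : Type*} [AddCommGroup W] [Module ℂ W] [Module (Env n) W]
    [IsScalarTower ℂ (Env n) W] [AddCommGroup W'] [Module ℂ W'] [Module (Env n) W']
    [IsScalarTower ℂ (Env n) W'] (f : W →ₗ[ℂ] W')
    (hP : ∀ j v, f (toEnv n (bPlus j) • v) = toEnv n (bPlus j) • f v)
    (hM : ∀ j v, f (toEnv n (bMinus j) • v) = toEnv n (bMinus j) • f v) : W →ₗ[Env n] W' where
  toFun := f
  map_add' := map_add f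
  map_smul' u := by
    induction u using Env.induction with
    | scalar r => intro v; simp only [algebraMap_smul, map_smul, RingHom.id_apply]
    | plus j => exact hP j
    | minus j => exact hM j
    | mul a b ha hb =>
      intro v
      simp only [RingHom.id_apply] at ha hb ⊢
      rw [mul_smul, ha, hb, mul_smul]
    | add a b ha hb =>
      intro v
      simp only [RingHom.id_apply] at ha hb ⊢
      rw [add_smul, map_add, ha, hb, add_smul]

end

section
variable (p : ℝ)

/-- The radicand in the numerator of `f1`. -/
def pUp (k : ℤ) : ℝ := k + 2 + evenFn k * (p - 2)

/-- The radicand in the numerator of `f2`. -/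
def qUp (l : ℤ) : ℝ := l + 1 + evenFn l * (p - 2)

/-- The radicand in the denominators of `f1` and `f2`. -/
def dUp (n : ℤ) : ℝ := n + 1 + oddFn n

variable {p}

/-- The lowering coefficients, shifted by one, are the radicands in f₁ and f₂: normalizing the
monomials distributes each of them as square roots over raising and lowering. -/
theorem gCoef_succ (k : ℤ) : gCoef p (k + 1) = (pUp p k : ℂ) := by
  rw [gCoef, pUp, evenFn]
  rcases Int.even_or_odd k with h | h
  · simp [h, Int.not_odd_iff_even.2 h]; ring
  · simp [h, Int.not_even_iff_odd.2 h]; ring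

theorem hCoef_succ (l : ℤ) : hCoef p (l + 1) = (qUp p l : ℂ) := by
  rw [hCoef, qUp, evenFn]
  rcases Int.even_or_odd l with h | h
  · simp [h, Int.not_odd_iff_even.2 h]; ring
  · simp [h, Int.not_even_iff_odd.2 h]

theorem oddCeil_succ (n : ℤ) : oddCeil (n + 1) = (dUp n : ℂ) := by
  rw [oddCeil, dUp, oddFn]
  rcases Int.even_or_odd n with h | h
  · simp [Int.not_odd_iff_even.2 h]
  · simp [h]

theorem gCoef_succ_left (i j l : ℕ) :
    gCoef p ((i + 1 : ℕ) + j + l) = (pUp p (i + j + l : ℕ) : ℂ) := by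
  rw [← gCoef_succ]; congr 1; push_cast; ring

theorem gCoef_succ_right (i j l : ℕ) :
    gCoef p (i + (j + 1 : ℕ) + l) = (pUp p (i + j + l : ℕ) : ℂ) := by
  rw [← gCoef_succ]; congr 1; push_cast; ring

theorem oddCeil_succ_left (i j : ℕ) : oddCeil ((i + 1 : ℕ) + j) = (dUp (i + j : ℕ) : ℂ) := by
  rw [← oddCeil_succ]; congr 1; push_cast; ring

theorem oddCeil_succ_right (i j : ℕ) : oddCeil (i + (j + 1 : ℕ)) = (dUp (i + j : ℕ) : ℂ) := by
  rw [← oddCeil_succ]; push_cast; ring_nf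

theorem hCoef_nat_succ (l : ℕ) : hCoef p (l + 1 : ℕ) = (qUp p (l : ℕ) : ℂ) := by
  rw [← hCoef_succ]; congr 1

theorem pUp_pos (hp : 0 < p) (k : ℕ) : 0 < pUp p k := by
  rw [pUp, evenFn]
  have : (0 : ℝ) ≤ k := k.cast_nonneg
  split_ifs <;> push_cast <;> linarith

theorem dUp_pos (n : ℕ) : 0 < dUp n := by
  rw [dUp, oddFn]
  have : (0 : ℝ) ≤ n := n.cast_nonneg
  split_ifs <;> push_cast <;> linarith

theorem qUp_pos (hp : 1 < p) (l : ℕ) : 0 < qUp p l := by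
  rw [qUp, evenFn]
  have : (0 : ℝ) ≤ l := l.cast_nonneg
  split_ifs <;> push_cast <;> linarith

variable (p) in
/-- The square length of the monomial `u^i v^j t^l`. -/
def normSq (i j l : ℕ) : ℝ :=
  i ! * j ! * (∏ m ∈ Finset.range (i + j + l), pUp p m) * (∏ m ∈ Finset.range l, qUp p m) /
    ∏ m ∈ Finset.range (i + j), dUp m

theorem prod_dUp_pos (n : ℕ) : 0 < ∏ m ∈ Finset.range n, dUp m :=
  Finset.prod_pos fun _ _ => dUp_pos _

/-- For p ≥ 1 the only factor that can vanish is `qUp p 0`, which is p − 1. -/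
theorem normSq_pos (hp : 1 < p) (i j l : ℕ) : 0 < normSq p i j l := by
  refine div_pos (mul_pos (mul_pos (by positivity) ?_) ?_) (prod_dUp_pos _)
  · exact Finset.prod_pos fun _ _ => pUp_pos (by linarith) _
  · exact Finset.prod_pos fun _ _ => qUp_pos hp _

theorem normSq_pos_of_zero (hp : 0 < p) (i j : ℕ) : 0 < normSq p i j 0 := by
  refine div_pos (mul_pos (mul_pos (by positivity) ?_) (by simp)) (prod_dUp_pos _)
  exact Finset.prod_pos fun _ _ => pUp_pos hp _

/-- At p = 1 the factors `pUp` and `dUp` coincide and cancel, and any positive power of t brings in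
`qUp 1 0`, which is 0. What is left are the square lengths of the Fock monomials. -/
theorem normSq_one (i j l : ℕ) : normSq 1 i j l = if l = 0 then (i ! * j ! : ℝ) else 0 := by
  split_ifs with h
  · subst h
    have hpd : ∀ m : ℤ, pUp 1 m = dUp m := fun m => by
      rw [pUp, dUp, evenFn, oddFn]
      by_cases h : Even m
      · simp [h, Int.not_odd_iff_even.2 h]
      · simp [h, Int.not_even_iff_odd.1 h]; ring_nf
    simp only [normSq, hpd, add_zero, Finset.range_zero, Finset.prod_empty, mul_one]
    rw [mul_div_assoc, div_self (prod_dUp_pos _).ne', mul_one]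
  · have : ∏ m ∈ Finset.range l, qUp 1 m = 0 :=
      Finset.prod_eq_zero (Finset.mem_range.2 (Nat.pos_of_ne_zero h)) (by norm_num [qUp, evenFn])
    simp [normSq, this]

theorem normSq_succ_left (i j l : ℕ) :
    normSq p (i + 1) j l =
      normSq p i j l * ((i + 1) * pUp p (i + j + l : ℕ) / dUp (i + j : ℕ)) := by
  have h1 := (prod_dUp_pos (i + j)).ne'
  have h2 := (dUp_pos (i + j)).ne'
  rw [normSq, normSq, show i + 1 + j + l = i + j + l + 1 by ring,
    show i + 1 + j = i + j + 1 by ring,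
    Finset.prod_range_succ, Finset.prod_range_succ (fun m : ℕ => dUp m), Nat.factorial_succ]
  push_cast at h2 ⊢
  field_simp

theorem normSq_succ_right (i j l : ℕ) :
    normSq p i (j + 1) l =
      normSq p i j l * ((j + 1) * pUp p (i + j + l : ℕ) / dUp (i + j : ℕ)) := by
  have h1 := (prod_dUp_pos (i + j)).ne'
  have h2 := (dUp_pos (i + j)).ne'
  rw [normSq, normSq, show i + (j + 1) + l = i + j + l + 1 by ring,
    show i + (j + 1) = i + j + 1 by ring,
    Finset.prod_range_succ, Finset.prod_range_succ (fun m : ℕ => dUp m), Nat.factorial_succ]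
  push_cast at h2 ⊢
  field_simp

/-- The ratio belonging to the second term of b₁⁺, which trades a factor v for t. The variant
`normSq_exchange_left` serves b₂⁺, which trades u for t. -/
theorem normSq_exchange_right (i j l : ℕ) :
    normSq p i j (l + 1) = normSq p i (j + 1) l * (qUp p l * dUp (i + j : ℕ) / (j + 1)) := by
  have h1 := (prod_dUp_pos (i + j)).ne'
  have h2 := (dUp_pos (i + j)).ne'
  rw [normSq, normSq, show i + (j + 1) + l = i + j + (l + 1) by ring,
    show i + (j + 1) = i + j + 1 by ring,
    Finset.prod_range_succ (fun m : ℕ => qUp p m), Finset.prod_range_succ (fun m : ℕ => dUp m),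
    Nat.factorial_succ]
  push_cast at h2 ⊢
  field_simp

theorem normSq_exchange_left (i j l : ℕ) :
    normSq p i j (l + 1) = normSq p (i + 1) j l * (qUp p l * dUp (i + j : ℕ) / (i + 1)) := by
  have h1 := (prod_dUp_pos (i + j)).ne'
  have h2 := (dUp_pos (i + j)).ne'
  rw [normSq, normSq, show i + 1 + j + l = i + j + (l + 1) by ring,
    show i + 1 + j = i + j + 1 by ring,
    Finset.prod_range_succ (fun m : ℕ => qUp p m), Finset.prod_range_succ (fun m : ℕ => dUp m),
    Nat.factorial_succ]
  push_cast at h2 ⊢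
  field_simp

/-- The inner product of the model for `p > 1`. -/
@[reducible] def modelCore (hp : 1 < p) : InnerProductSpace.Core ℂ (Model p) :=
  weightedCore (modelBasis p) (fun m => normSq p m.1 m.2.1 m.2.2) fun _ => normSq_pos hp _ _ _

theorem modelCore_mono (hp : 1 < p) (i j l i' j' l' : ℕ) :
    (modelCore hp).inner (mono p i j l) (mono p i' j' l') =
      if i = i' ∧ j = j' ∧ l = l' then (normSq p i j l : ℂ) else 0 := by
  rw [mono, mono, weightedCore_basis]
  simp only [Prod.mk.injEq]

theorem conj_sgn (l : ℤ) : starRingEnd ℂ (sgn l) = sgn l := by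
  rw [sgn]; split_ifs <;> simp

theorem conj_oddCeil (n : ℤ) : starRingEnd ℂ (oddCeil n) = oddCeil n := by
  rw [oddCeil]; split_ifs <;> simp

/-- The terms match one by one: raising u or v in b_k⁺ is adjoint to lowering it in b_k⁻, and
trading v or u for t is adjoint to the reverse trade. In each pair the quotient of square lengths
equals the quotient of the coefficients. -/
theorem isStarForm_modelCore (hp : 1 < p) : IsStarForm (n := 2) (modelCore hp) := by
  intro k v w
  simp only [actPlus, actMinus, model_bPlus_smul, model_bMinus_smul]
  refine core_adjoint_of_basis (modelBasis p) _ _ ?_ v w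
  rintro ⟨i, j, l⟩ ⟨i', j', l'⟩
  change (modelCore hp).inner (modelPlus p k (mono p i j l)) (mono p i' j' l') =
    (modelCore hp).inner (mono p i j l) (modelMinus p k (mono p i' j' l'))
  fin_cases k
  · simp only [Fin.zero_eta, modelPlus_zero, modelMinus_zero, core_sub_left, core_sub_right,
      (modelCore hp).smul_left, core_smul_right, modelCore_mono, map_div₀, conj_sgn, conj_oddCeil,
      Complex.conj_natCast]
    congr 1
    · rcases i' with _ | i'
      · simp
      · by_cases h : i = i' ∧ j = j' ∧ l = l'
        · obtain ⟨rfl, rfl, rfl⟩ := h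
          have := (dUp_pos (i + j)).ne'
          rw [if_pos (by simp), if_pos (by simp), normSq_succ_left, gCoef_succ_left,
            oddCeil_succ_left]
          push_cast
          ring
        · rw [if_neg (by omega), if_neg (by omega), mul_zero, mul_zero]
    · rcases l' with _ | l'
      · simp [hCoef_zero]
      · rcases j with _ | j
        · simp
        · by_cases h : i = i' ∧ j = j' ∧ l = l'
          · obtain ⟨rfl, rfl, rfl⟩ := h
            have h1 : (dUp (i + j : ℕ) : ℂ) ≠ 0 := Complex.ofReal_ne_zero.2 (dUp_pos (i + j)).ne'
            have h2 : (j : ℂ) + 1 ≠ 0 := Nat.cast_add_one_ne_zero j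
            rw [if_pos (by simp), if_pos (by simp), add_tsub_cancel_right, normSq_exchange_right,
              hCoef_nat_succ, oddCeil_succ_right]
            push_cast at h1 ⊢
            field_simp
          · rw [if_neg (by omega), if_neg (by omega), mul_zero, mul_zero]
  · simp only [Fin.mk_one, modelPlus_one, modelMinus_one, (modelCore hp).add_left, core_add_right,
      (modelCore hp).smul_left, core_smul_right, modelCore_mono, map_div₀, conj_sgn, conj_oddCeil,
      Complex.conj_natCast]
    congr 1
    · rcases j' with _ | j'
      · simp
      · by_cases h : i = i' ∧ j = j' ∧ l = l'
        · obtain ⟨rfl, rfl, rfl⟩ := h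
          have := (dUp_pos (i + j)).ne'
          rw [if_pos (by simp), if_pos (by simp), normSq_succ_right, gCoef_succ_right,
            oddCeil_succ_right]
          push_cast
          ring
        · rw [if_neg (by omega), if_neg (by omega), mul_zero, mul_zero]
    · rcases l' with _ | l'
      · simp [hCoef_zero]
      · rcases i with _ | i
        · simp
        · by_cases h : i = i' ∧ j = j' ∧ l = l'
          · obtain ⟨rfl, rfl, rfl⟩ := h
            have h1 : (dUp (i + j : ℕ) : ℂ) ≠ 0 := Complex.ofReal_ne_zero.2 (dUp_pos (i + j)).ne'
            have h2 : (i : ℂ) + 1 ≠ 0 := Nat.cast_add_one_ne_zero i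
            rw [if_pos (by simp), if_pos (by simp), add_tsub_cancel_right, normSq_exchange_left,
              hCoef_nat_succ, oddCeil_succ_left]
            push_cast at h1 ⊢
            field_simp
          · rw [if_neg (by omega), if_neg (by omega), mul_zero, mul_zero]

end

end

/-! ### The boson Fock space as a quotient of the model at p = 1 -/

section

/-- For bosons the inner commutators are scalars, so that the triple relations can be read off from
this expansion. -/
theorem commutator_of_anticommutator {A : Type*} [Ring A] (a b c : A) :
    (a * b + b * a) * c - c * (a * b + b * a) =
      (a * (b * c - c * b) + (b * c - c * b) * a) +
        (b * (a * c - c * a) + (a * c - c * a) * b) := by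
  noncomm_ring

/-- Bosons are parabosons. -/
theorem IsParaboson.of_boson {n : ℕ} {A : Type*} [Ring A] [Algebra ℂ A] {P M : Fin n → A}
    (hPP : ∀ j k, Commute (P j) (P k)) (hMM : ∀ j k, Commute (M j) (M k))
    (hMP : ∀ j k, M j * P k - P k * M j = if j = k then 1 else 0) : IsParaboson P M := by
  have hPP' (j k) : P j * P k - P k * P j = 0 := sub_eq_zero.2 (hPP j k)
  have hMM' (j k) : M j * M k - M k * M j = 0 := sub_eq_zero.2 (hMM j k)
  have hPM (j k) : P j * M k - M k * P j = if j = k then -1 else 0 := by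
    rw [← neg_sub, hMP]; split_ifs <;> simp_all
  constructor <;> intro j k l
  · rw [commutator_of_anticommutator, hMP, hPP']
    split_ifs <;> simp [two_smul]
  · rw [commutator_of_anticommutator, hMM', hPM]
    split_ifs <;> simp [two_smul]
  · rw [commutator_of_anticommutator, hPP', hPP']
    simp
  · rw [commutator_of_anticommutator, hMM', hMM']
    simp

open MvPolynomial

/-- The boson Fock space as a representation of `osp(1|2n)`. -/
def FockModule (n : ℕ) : Type := BosonFock n

instance (n : ℕ) : AddCommGroup (FockModule n) := inferInstanceAs (AddCommGroup (BosonFock n))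

instance (n : ℕ) : Module ℂ (FockModule n) := inferInstanceAs (Module ℂ (BosonFock n))

section
variable {n : ℕ}

variable (n) in
/-- The identification with polynomials. -/
def fockEquiv : FockModule n ≃ₗ[ℂ] BosonFock n := LinearEquiv.refl ℂ (BosonFock n)

variable (n) in
/-- The basis of monomials. -/
def fockBasis : Module.Basis (Fin n →₀ ℕ) ℂ (FockModule n) :=
  (basisMonomials (Fin n) ℂ).map (fockEquiv n).symm

theorem fockEquiv_fockBasis (s : Fin n →₀ ℕ) : fockEquiv n (fockBasis n s) = monomial s 1 := rfl

def fockPlus (j : Fin n) : Module.End ℂ (FockModule n) :=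
  (fockEquiv n).symm.toLinearMap ∘ₗ LinearMap.mulLeft ℂ (X j : BosonFock n) ∘ₗ
    (fockEquiv n).toLinearMap

def fockMinus (j : Fin n) : Module.End ℂ (FockModule n) :=
  (fockEquiv n).symm.toLinearMap ∘ₗ (pderiv j : Derivation ℂ (BosonFock n) _).toLinearMap ∘ₗ
    (fockEquiv n).toLinearMap

theorem fockEquiv_fockPlus (j : Fin n) (v : FockModule n) :
    fockEquiv n (fockPlus j v) = X j * fockEquiv n v := rfl

theorem fockEquiv_fockMinus (j : Fin n) (v : FockModule n) :
    fockEquiv n (fockMinus j v) = pderiv j (fockEquiv n v) := rfl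

theorem isParaboson_fock : IsParaboson (fockPlus (n := n)) fockMinus := by
  refine .of_boson (fun j k => ?_) (fun j k => ?_) fun j k => ?_
  · refine LinearMap.ext fun v => (fockEquiv n).injective ?_
    simp only [Module.End.mul_apply, fockEquiv_fockPlus]
    ring
  · refine (fockBasis n).ext fun s => (fockEquiv n).injective ?_
    simp only [Module.End.mul_apply, fockEquiv_fockMinus, fockEquiv_fockBasis, pderiv_monomial]
    rw [tsub_right_comm]
    congr 1
    by_cases h : j = k
    · subst h; rfl
    · simp [h, Ne.symm h]; ring
  · refine LinearMap.ext fun v => (fockEquiv n).injective ?_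
    simp only [LinearMap.sub_apply, Module.End.mul_apply, map_sub, fockEquiv_fockMinus,
      fockEquiv_fockPlus, pderiv_mul]
    by_cases h : j = k
    · subst h; simp
    · simp [h, pderiv_X_of_ne (Ne.symm h)]

instance : Module (Env n) (FockModule n) :=
  Module.compHom (FockModule n) (envLift (isParaboson_fock (n := n))).toRingHom

theorem fock_smul_def (u : Env n) (v : FockModule n) :
    u • v = envLift (isParaboson_fock (n := n)) u v := rfl

instance : IsScalarTower ℂ (Env n) (FockModule n) :=
  ⟨fun r u v => by rw [fock_smul_def, map_smul]; rfl⟩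

theorem fockEquiv_bPlus_smul (j : Fin n) (v : FockModule n) :
    fockEquiv n (toEnv n (bPlus j) • v) = X j * fockEquiv n v := by
  rw [fock_smul_def, envLift_bPlus, fockEquiv_fockPlus]

theorem fockEquiv_bMinus_smul (j : Fin n) (v : FockModule n) :
    fockEquiv n (toEnv n (bMinus j) • v) = pderiv j (fockEquiv n v) := by
  rw [fock_smul_def, envLift_bMinus, fockEquiv_fockMinus]

variable (n) in
/-- The vacuum of the Fock space. -/
def fockVac : FockModule n := (fockEquiv n).symm 1

theorem isVacuum_fockVac : IsVacuum (n := n) 1 (fockVac n) := by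
  refine ⟨fun j => (fockEquiv n).injective ?_, fun j k => (fockEquiv n).injective ?_⟩
  · simp [fockEquiv_bMinus_smul, fockVac]
  · rw [add_smul, mul_smul, mul_smul, map_add, fockEquiv_bPlus_smul, fockEquiv_bMinus_smul,
      fockEquiv_bMinus_smul, fockEquiv_bPlus_smul, apply_ite (fockEquiv n)]
    by_cases h : j = k
    · subst h; simp [fockVac]
    · simp [h, pderiv_X_of_ne h, fockVac]

theorem fockBasis_mem_weightSpace (s : Fin n →₀ ℕ) :
    fockBasis n s ∈ weightSpace (FockModule n) (fun j => 1 / 2 + (s j : ℂ)) := by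
  rw [mem_weightSpace]
  intro j
  refine (fockEquiv n).injective ?_
  rw [toEnv_cartan, smul_assoc, add_smul, mul_smul, mul_smul, map_smul, map_smul, map_add,
    fockEquiv_bPlus_smul, fockEquiv_bMinus_smul, fockEquiv_bMinus_smul, fockEquiv_bPlus_smul,
    fockEquiv_fockBasis, pderiv_mul, pderiv_X_self, one_mul, X_mul_pderiv_monomial]
  module

/-- The inner product of the Fock space. -/
@[reducible] def fockCore (n : ℕ) : InnerProductSpace.Core ℂ (FockModule n) :=
  weightedCore (fockBasis n) (fun k => ∏ j, ((k j)! : ℝ)) fun _ =>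
    Finset.prod_pos fun _ _ => by positivity

theorem bosonInner_eq (v w : FockModule n) :
    bosonInner (fockEquiv n v) (fockEquiv n w) = (fockCore n).inner v w := by
  refine Finset.sum_congr rfl fun k _ => ?_
  push_cast
  rfl

theorem isStarForm_fockCore : IsStarForm (n := n) (fockCore n) := by
  classical
  intro j v w
  rw [actPlus, actMinus, fock_smul_def, fock_smul_def, envLift_bPlus, envLift_bMinus]
  refine core_adjoint_of_basis (fockBasis n) _ _ (fun s t => ?_) v w
  have h1 : fockPlus j (fockBasis n s) = fockBasis n (s + Finsupp.single j 1) := by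
    refine (fockEquiv n).injective ?_
    rw [fockEquiv_fockPlus, fockEquiv_fockBasis, fockEquiv_fockBasis, X, monomial_mul, add_comm,
      one_mul]
  have h2 : fockMinus j (fockBasis n t) = (t j : ℂ) • fockBasis n (t - Finsupp.single j 1) := by
    refine (fockEquiv n).injective ?_
    rw [fockEquiv_fockMinus, map_smul, fockEquiv_fockBasis, fockEquiv_fockBasis, pderiv_monomial,
      smul_monomial, one_mul, smul_eq_mul, mul_one]
  rw [h1, h2, core_smul_right, weightedCore_basis, weightedCore_basis]
  by_cases h : s + Finsupp.single j 1 = t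
  · subst h
    rw [if_pos rfl, add_tsub_cancel_right, if_pos rfl]
    rw [← Finset.mul_prod_erase _ _ (Finset.mem_univ j),
      ← Finset.mul_prod_erase _ (fun i => ((s i)! : ℝ)) (Finset.mem_univ j)]
    rw [Finset.prod_congr rfl fun i hi => by
      rw [Finsupp.add_apply, Finsupp.single_eq_of_ne (Finset.ne_of_mem_erase hi), add_zero]]
    simp [Nat.factorial_succ, mul_assoc]
  · rw [if_neg h]
    by_cases ht : t j = 0
    · simp [ht]
    · rw [if_neg, mul_zero]
      rintro rfl
      refine h (tsub_add_cancel_of_le ?_)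
      simpa [Finsupp.single_le_iff] using Nat.one_le_iff_ne_zero.2 ht

theorem fock_vbarLift_surjective :
    Function.Surjective (vbarLift (isVacuum_fockVac (n := n))) := by
  rw [← LinearMap.range_eq_top, eq_top_iff]
  rintro v -
  suffices h : ∀ f : BosonFock n,
      (fockEquiv n).symm f ∈ LinearMap.range (vbarLift (isVacuum_fockVac (n := n))) from
    h (fockEquiv n v)
  intro f
  induction f using MvPolynomial.induction_on with
  | C a =>
    refine ⟨algebraMap ℂ (Env n) a • vbarVac n 1, ?_⟩
    rw [map_smul, vbarLift_vbarVac, algebraMap_smul, fockVac, ← map_smul, smul_eq_C_mul, mul_one]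
  | add f g hf hg => rw [map_add]; exact Submodule.add_mem _ hf hg
  | mul_X f j hf =>
    have h : (fockEquiv n).symm (f * X j) = toEnv n (bPlus j) • (fockEquiv n).symm f := by
      refine (fockEquiv n).injective ?_
      rw [fockEquiv_bPlus_smul, LinearEquiv.apply_symm_apply, LinearEquiv.apply_symm_apply,
        mul_comm]
    rw [h]
    exact Submodule.smul_mem _ _ hf

end

section

/-- At p = 1 this cancels the denominators, and on monomials without t the operators b_j⁻ become ∂_u
and ∂_v. -/
theorem gCoef_one (k : ℤ) : gCoef 1 k = oddCeil k := by
  rw [gCoef, oddCeil]; split_ifs <;> simp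

/-- The passage from t¹ to t⁰ has coefficient p − 1, so at p = 1 the multiples of t form a submodule
and setting t = 0 is a homomorphism. -/
theorem hCoef_one_one : hCoef 1 1 = 0 := by
  norm_num [hCoef]

/-- The linear map that sets `t = 0`. -/
def modelToFockLinear : Model 1 →ₗ[ℂ] FockModule 2 :=
  (modelBasis 1).constr ℂ fun m =>
    if m.2.2 = 0 then (fockEquiv 2).symm (X 0 ^ m.1 * X 1 ^ m.2.1) else 0

theorem modelToFockLinear_mono (i j l : ℕ) : fockEquiv 2 (modelToFockLinear (mono 1 i j l)) =
    if l = 0 then X 0 ^ i * X 1 ^ j else 0 := by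
  rw [modelToFockLinear, mono, Module.Basis.constr_basis]
  split_ifs <;> simp

/-- The Fock space is the quotient of the model at `p = 1`. -/
def modelToFock : Model 1 →ₗ[Env 2] FockModule 2 :=
  envLinear modelToFockLinear
    (fun k v => by
      suffices h : modelToFockLinear ∘ₗ modelPlus 1 k = fockPlus k ∘ₗ modelToFockLinear by
        rw [model_bPlus_smul, fock_smul_def, envLift_bPlus]
        exact LinearMap.congr_fun h v
      refine model_hom_ext fun i j l => (fockEquiv 2).injective ?_
      rw [LinearMap.comp_apply, LinearMap.comp_apply, fockEquiv_fockPlus]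
      fin_cases k
      · simp only [Fin.zero_eta, modelPlus_zero, map_sub, map_smul, modelToFockLinear_mono]
        by_cases h : l = 0
        · simp [h, sgn, pow_succ']; ring
        · simp [h]
      · simp only [Fin.mk_one, modelPlus_one, map_add, map_smul, modelToFockLinear_mono]
        by_cases h : l = 0
        · simp [h, sgn, pow_succ']; ring
        · simp [h])
    (fun k v => by
      suffices h : modelToFockLinear ∘ₗ modelMinus 1 k = fockMinus k ∘ₗ modelToFockLinear by
        rw [model_bMinus_smul, fock_smul_def, envLift_bMinus]
        exact LinearMap.congr_fun h v
      refine model_hom_ext fun i j l => (fockEquiv 2).injective ?_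
      rw [LinearMap.comp_apply, LinearMap.comp_apply, fockEquiv_fockMinus]
      have h0 : (pderiv 0 (X 1 : MvPolynomial (Fin 2) ℂ)) = 0 := pderiv_X_of_ne (by decide)
      have h1 : (pderiv 1 (X 0 : MvPolynomial (Fin 2) ℂ)) = 0 := pderiv_X_of_ne (by decide)
      fin_cases k
      · simp only [Fin.zero_eta, modelMinus_zero, map_sub, map_smul, modelToFockLinear_mono]
        rcases l with _ | _ | l
        · simp [sgn, hCoef_zero, gCoef_one, oddCeil_ne_zero, h0, smul_eq_C_mul]
          ring
        · simp [hCoef_one_one]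
        · simp
      · simp only [Fin.mk_one, modelMinus_one, map_add, map_smul, modelToFockLinear_mono]
        rcases l with _ | _ | l
        · simp [sgn, hCoef_zero, gCoef_one, oddCeil_ne_zero, h1, smul_eq_C_mul]
          ring
        · simp [hCoef_one_one]
        · simp)

theorem modelToFock_mono (i j l : ℕ) : fockEquiv 2 (modelToFock (mono 1 i j l)) =
    if l = 0 then X 0 ^ i * X 1 ^ j else 0 := modelToFockLinear_mono i j l

/-- The pulled-back form has the Gram matrix `normSq` in its null directions too, which lets p = 1
and p > 1 share the remaining arguments. -/
theorem fockCore_modelToFock_mono (i j l i' j' l' : ℕ) :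
    (fockCore 2).inner (modelToFock (mono 1 i j l)) (modelToFock (mono 1 i' j' l')) =
      if i = i' ∧ j = j' ∧ l = l' then (normSq 1 i j l : ℂ) else 0 := by
  classical
  have h (i j l : ℕ) : modelToFock (mono 1 i j l) = if l = 0 then
      fockBasis 2 (Finsupp.single 0 i + Finsupp.single 1 j) else 0 := by
    refine (fockEquiv 2).injective ?_
    rw [modelToFock_mono, apply_ite (fockEquiv 2), fockEquiv_fockBasis, map_zero, X_pow_eq_monomial,
      X_pow_eq_monomial, monomial_mul, one_mul]
  rw [h, h, normSq_one]
  by_cases hl : l = 0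
  · by_cases hl' : l' = 0
    · subst hl hl'
      rw [if_pos rfl, if_pos rfl, weightedCore_basis]
      have : Finsupp.single (0 : Fin 2) i + Finsupp.single 1 j =
          Finsupp.single 0 i' + Finsupp.single 1 j' ↔ i = i' ∧ j = j' ∧ 0 = 0 := by
        simp [Finsupp.ext_iff, Fin.forall_fin_two, Finsupp.single_apply]
      simp only [this]
      simp [Fin.prod_univ_two, Finsupp.single_apply]
    · rw [if_neg hl', core_zero_right, if_neg (by omega)]
  · rw [if_neg hl, core_zero_left, if_neg hl]
    simp

end

end

/-! ### Normalized monomials and the square-root coefficients -/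

section

section
variable {p : ℝ}

theorem f1_eq (k l : ℤ) : f1 p k l = (-1) ^ l * (√(pUp p k) / √(dUp (k - l))) := by
  rw [f1, pUp, dUp, mul_div_assoc]
  push_cast
  rfl

/-- Passing from k − l to k − l − 1 flips the parity, which turns the denominator of f₂ into another
value of the function `dUp` that occurs in f₁. -/
theorem f2_eq (k l : ℤ) : f2 p k l = √(qUp p l) / √(dUp (k - l - 1)) := by
  have h : oddFn (k - l - 1) = 1 - oddFn (k - l) := by
    rw [oddFn, oddFn]
    rcases Int.even_or_odd (k - l) with h | h
    · rw [if_pos (h.sub_odd odd_one), if_neg (Int.not_odd_iff_even.2 h), sub_zero]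
    · rw [if_neg (Int.not_odd_iff_even.2 (h.sub_odd odd_one)), if_pos h, sub_self]
  rw [f2, qUp, dUp, h]
  push_cast
  congr 2
  ring

theorem sgn_natCast (l : ℕ) : sgn l = (((-1 : ℝ) ^ (l : ℤ) : ℝ) : ℂ) := by
  rw [sgn, zpow_natCast]
  rcases Nat.even_or_odd l with h | h
  · simp [h, h.neg_one_pow]
  · simp [Nat.not_even_iff_odd.2 h, h.neg_one_pow]

theorem inv_sqrt_mul_sqrt_mul {a : ℝ} (ha : 0 < a) (r : ℝ) : (√a)⁻¹ * √(a * r) = √r := by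
  rw [Real.sqrt_mul ha.le, inv_mul_cancel_left₀ (Real.sqrt_pos.2 ha).ne']

theorem inv_sqrt_mul_mul_mul_sqrt {a r : ℝ} (ha : 0 < a) (hr : 0 ≤ r) :
    (√(a * r))⁻¹ * √a * r = √r := by
  have h := (Real.sqrt_pos.2 ha).ne'
  rcases hr.eq_or_lt with rfl | hr
  · simp
  · have h2 := (Real.sqrt_pos.2 hr).ne'
    rw [Real.sqrt_mul ha.le]
    field_simp
    exact (Real.sq_sqrt hr.le).symm

theorem sqrt_mul_div' {x y z : ℝ} (hx : 0 ≤ x) (hz : 0 ≤ z) :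
    √(z * x / y) = √z * (√x / √y) := by
  rw [Real.sqrt_div (mul_nonneg hz hx), Real.sqrt_mul hz, mul_div_assoc]

/-- Here z/y is the rational coefficient of a t-raising term and xy/z a ratio of square lengths.
Their combination has the shape √n · f₂. -/
theorem sqrt_mul_div_mul {x y z : ℝ} (hx : 0 ≤ x) (hy : 0 < y) (hz : 0 < z) :
    √(x * y / z) * (z / y) = √z * (√x / √y) := by
  obtain ⟨a, ha, rfl⟩ : ∃ a, 0 < a ∧ y = a ^ 2 :=
    ⟨√y, Real.sqrt_pos.2 hy, (Real.sq_sqrt hy.le).symm⟩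
  obtain ⟨b, hb, rfl⟩ : ∃ b, 0 < b ∧ z = b ^ 2 :=
    ⟨√z, Real.sqrt_pos.2 hz, (Real.sq_sqrt hz.le).symm⟩
  rw [Real.sqrt_div (mul_nonneg hx hy.le), Real.sqrt_mul hx, Real.sqrt_sq ha.le, Real.sqrt_sq hb.le]
  field_simp

theorem qUp_nonneg (hp : 1 ≤ p) (l : ℕ) : 0 ≤ qUp p l := by
  rw [qUp, evenFn]
  have : (0 : ℝ) ≤ l := l.cast_nonneg
  split_ifs <;> push_cast <;> linarith

theorem normSq_nonneg (hp : 1 ≤ p) (i j l : ℕ) : 0 ≤ normSq p i j l := by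
  refine div_nonneg (mul_nonneg (mul_nonneg (by positivity) ?_) ?_) (prod_dUp_pos _).le
  · exact Finset.prod_nonneg fun _ _ => (pUp_pos (by linarith) _).le
  · exact Finset.prod_nonneg fun _ _ => qUp_nonneg hp _

theorem normSq_pos_of_le (hp : 1 ≤ p) {i j l : ℕ} (h : p = 1 → l = 0) : 0 < normSq p i j l := by
  rcases hp.eq_or_lt with h1 | h1
  · rw [h h1.symm]; exact normSq_pos_of_zero (by linarith) i j
  · exact normSq_pos h1 i j l

end

section
variable {p : ℝ} {W : Type*} [AddCommGroup W] [Module ℂ W] [Module (Env 2) W]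

/-- The normalized image of a monomial. -/
def normalized (f : Model p →ₗ[Env 2] W) (i j l : ℕ) : W :=
  ((√(normSq p i j l))⁻¹ : ℂ) • f (mono p i j l)

/-- If the length is zero, definiteness makes the image itself zero. So the null monomials at p = 1
need no separate treatment. -/
theorem map_mono_eq {f : Model p →ₗ[Env 2] W} {c : InnerProductSpace.Core ℂ W}
    (hf : ∀ i j l i' j' l', c.inner (f (mono p i j l)) (f (mono p i' j' l')) =
      if i = i' ∧ j = j' ∧ l = l' then (normSq p i j l : ℂ) else 0)
    (hp : 1 ≤ p) (i j l : ℕ) :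
    f (mono p i j l) = (√(normSq p i j l) : ℂ) • normalized f i j l := by
  rcases (normSq_nonneg hp i j l).eq_or_lt with h | h
  · rw [← h, Real.sqrt_zero, Complex.ofReal_zero, zero_smul]
    refine c.definite _ ?_
    rw [hf, if_pos ⟨rfl, rfl, rfl⟩, ← h, Complex.ofReal_zero]
  · rw [normalized, smul_smul, mul_inv_cancel₀, one_smul]
    exact Complex.ofReal_ne_zero.2 (Real.sqrt_pos.2 h).ne'

variable [IsScalarTower ℂ (Env 2) W] {f : Model p →ₗ[Env 2] W}

theorem bPlus_smul_normalized (k : Fin 2) (i j l : ℕ) : toEnv 2 (bPlus k) • normalized f i j l =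
    ((√(normSq p i j l))⁻¹ : ℂ) • f (modelPlus p k (mono p i j l)) := by
  rw [normalized, env_smul_smul, ← map_smul, model_bPlus_smul]

theorem bMinus_smul_normalized (k : Fin 2) (i j l : ℕ) : toEnv 2 (bMinus k) • normalized f i j l =
    ((√(normSq p i j l))⁻¹ : ℂ) • f (modelMinus p k (mono p i j l)) := by
  rw [normalized, env_smul_smul, ← map_smul, model_bMinus_smul]

/-- With n' the square length of the raised monomial, the ratio of lengths supplies the radicands of
√n · f₁, and `sgn l` its sign. -/
theorem raise_first_coef {i j l : ℕ} (h : 0 < normSq p i j l) (hp : 1 ≤ p) {n n' : ℝ}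
    (hn : 0 ≤ n) (hn' : n' = normSq p i j l * (n * pUp p (i + j + l : ℕ) / dUp (i + j : ℕ))) :
    ((√(normSq p i j l))⁻¹ : ℂ) * sgn l * √n' = ((√n * f1 p (l + i + j) l : ℝ) : ℂ) := by
  rw [hn', sgn_natCast, f1_eq, mul_assoc, mul_left_comm, ← Complex.ofReal_inv, ← Complex.ofReal_mul,
    ← Complex.ofReal_mul, inv_sqrt_mul_sqrt_mul h,
    sqrt_mul_div' (pUp_pos (by linarith) _).le hn, show (l + i + j : ℤ) - l = (i + j : ℕ) by
      push_cast; ring, show (l + i + j : ℤ) = (i + j + l : ℕ) by push_cast; ring, mul_left_comm]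

theorem raise_second_coef {i j l : ℕ} {a n n' : ℝ} (h : 0 < a) (hp : 1 ≤ p) (hn : 0 < n) {m : ℕ}
    (hm : (l + i + j : ℤ) - l - 1 = m) (hn' : n' = a * (qUp p l * dUp m / n)) :
    ((√a)⁻¹ : ℂ) * ((n : ℂ) / (dUp m : ℂ)) * √n' = ((√n * f2 p (l + i + j) l : ℝ) : ℂ) := by
  rw [hn', f2_eq, hm, ← sqrt_mul_div_mul (qUp_nonneg hp l) (dUp_pos m) hn,
    ← inv_sqrt_mul_sqrt_mul h (qUp p l * dUp m / n)]
  push_cast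
  ring

theorem normalized_raise_zero
    (hf : ∀ i j l, f (mono p i j l) = (√(normSq p i j l) : ℂ) • normalized f i j l)
    (hp : 1 ≤ p) {i j l : ℕ} (h : 0 < normSq p i j l) :
    toEnv 2 (bPlus 0) • normalized f i j l =
      ((√((i : ℝ) + 1) * f1 p (l + i + j) l : ℝ) : ℂ) • normalized f (i + 1) j l -
        ((√(j : ℝ) * f2 p (l + i + j) l : ℝ) : ℂ) • normalized f i (j - 1) (l + 1) := by
  rw [bPlus_smul_normalized, modelPlus_zero, map_sub, LinearMap.map_smul_of_tower,
    LinearMap.map_smul_of_tower, hf, hf, smul_sub, smul_smul, smul_smul, smul_smul, smul_smul,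
    raise_first_coef h hp (by positivity) (normSq_succ_left i j l)]
  rcases j with _ | j
  · simp
  · rw [oddCeil_succ_right, add_tsub_cancel_right, ← raise_second_coef h hp (by positivity)
      (show _ = ((i + j : ℕ) : ℤ) by push_cast; ring) (n' := normSq p i j (l + 1))
      (by rw [normSq_exchange_right]; push_cast; rfl)]
    push_cast
    rfl

theorem normalized_raise_one
    (hf : ∀ i j l, f (mono p i j l) = (√(normSq p i j l) : ℂ) • normalized f i j l)
    (hp : 1 ≤ p) {i j l : ℕ} (h : 0 < normSq p i j l) :
    toEnv 2 (bPlus 1) • normalized f i j l =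
      ((√((j : ℝ) + 1) * f1 p (l + i + j) l : ℝ) : ℂ) • normalized f i (j + 1) l +
        ((√(i : ℝ) * f2 p (l + i + j) l : ℝ) : ℂ) • normalized f (i - 1) j (l + 1) := by
  rw [bPlus_smul_normalized, modelPlus_one, map_add, LinearMap.map_smul_of_tower,
    LinearMap.map_smul_of_tower, hf, hf, smul_add, smul_smul, smul_smul, smul_smul, smul_smul,
    raise_first_coef h hp (by positivity) (normSq_succ_right i j l)]
  rcases i with _ | i
  · simp
  · rw [oddCeil_succ_left, add_tsub_cancel_right, ← raise_second_coef h hp (by positivity)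
      (show _ = ((i + j : ℕ) : ℤ) by push_cast; ring) (n' := normSq p i j (l + 1))
      (by rw [normSq_exchange_left]; push_cast; rfl)]
    push_cast
    rfl

theorem lower_first_coef {i j l : ℕ} {a n : ℝ} (h : 0 < a) (hp : 1 ≤ p) (hn : 0 ≤ n) {m : ℕ}
    (hm : (l + i + j : ℤ) - 1 = (m + l : ℕ)) {n' : ℝ}
    (hn' : n' = a * (n * pUp p (m + l : ℕ) / dUp m)) :
    ((√n')⁻¹ : ℂ) * (sgn l * n * (pUp p (m + l : ℕ) : ℂ) / (dUp m : ℂ)) * √a =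
      ((√n * f1 p (l + i + j - 1) l : ℝ) : ℂ) := by
  have hr : 0 ≤ n * pUp p (m + l : ℕ) / dUp m :=
    div_nonneg (mul_nonneg hn (pUp_pos (by linarith) _).le) (dUp_pos m).le
  rw [hn', sgn_natCast, f1_eq, hm, show ((m + l : ℕ) : ℤ) - l = m by push_cast; ring,
    mul_left_comm (√n), ← sqrt_mul_div' (pUp_pos (by linarith) _).le hn,
    ← inv_sqrt_mul_mul_mul_sqrt h hr]
  push_cast
  ring

theorem lower_second_coef {i j l : ℕ} {a n n' : ℝ} (h : 0 < a) (hp : 1 ≤ p) (hn : 0 < n)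
    (hn' : n' = a * (qUp p l * dUp (i + j : ℕ) / n)) :
    ((√n')⁻¹ : ℂ) * (qUp p l : ℂ) * √a =
      ((√n * f2 p ((l + 1 : ℕ) + i + j) ((l + 1 : ℕ) - 1) : ℝ) : ℂ) := by
  have hd := dUp_pos (i + j)
  have hr : 0 ≤ qUp p l * dUp (i + j : ℕ) / n :=
    div_nonneg (mul_nonneg (qUp_nonneg hp l) hd.le) hn.le
  -- Splits off the ratio r of square lengths, so that √n'⁻¹ · √a · r collapses to √r.
  have hq : qUp p l = qUp p l * dUp (i + j : ℕ) / n * (n / dUp (i + j : ℕ)) := by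
    field_simp
  rw [f2_eq, show ((l + 1 : ℕ) : ℤ) - 1 = l by push_cast; ring,
    show (((l + 1 : ℕ) : ℤ) + i + j) - l - 1 = (i + j : ℕ) by push_cast; ring,
    ← sqrt_mul_div_mul (qUp_nonneg hp l) hd hn, ← inv_sqrt_mul_mul_mul_sqrt h hr, ← hn']
  nth_rewrite 1 [hq]
  push_cast
  ring

theorem normalized_lower_zero
    (hf : ∀ i j l, f (mono p i j l) = (√(normSq p i j l) : ℂ) • normalized f i j l)
    (hp : 1 ≤ p) {i j l : ℕ} (h : p = 1 → l = 0) :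
    toEnv 2 (bMinus 0) • normalized f i j l =
      ((√(i : ℝ) * f1 p (l + i + j - 1) l : ℝ) : ℂ) • normalized f (i - 1) j l -
        ((√((j : ℝ) + 1) * f2 p (l + i + j) (l - 1) : ℝ) : ℂ) • normalized f i (j + 1) (l - 1) := by
  rw [bMinus_smul_normalized, modelMinus_zero, map_sub, LinearMap.map_smul_of_tower,
    LinearMap.map_smul_of_tower, hf, hf, smul_sub, smul_smul, smul_smul, smul_smul, smul_smul]
  congr 1
  · rcases i with _ | i
    · simp
    · rw [gCoef_succ_left, oddCeil_succ_left, ← lower_first_coef (i := i + 1) (j := j) (l := l)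
        (m := i + j) (n := (i + 1 : ℕ)) (a := normSq p i j l) (n' := normSq p (i + 1) j l)
        (normSq_pos_of_le hp h) hp (by positivity) (by push_cast; ring)
        (by rw [normSq_succ_left]; push_cast; rfl)]
      push_cast
      rfl
  · rcases l with _ | l
    -- The truncated exponent l − 1 names a meaningless vector at l = 0. Both coefficients vanish
    -- there: `hCoef p 0`, and the radicand of f₂ at −1.
    · simp [hCoef_zero, f2_eq, qUp, evenFn]
    -- A positive exponent of t excludes p = 1, so the monomial with the lowered exponent has
    -- positive length.
    · rw [hCoef_nat_succ, add_tsub_cancel_right, ← lower_second_coef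
        (normSq_pos_of_le hp fun h1 => absurd (h h1) (by simp)) hp (by positivity)
        (normSq_exchange_right i j l)]

theorem normalized_lower_one
    (hf : ∀ i j l, f (mono p i j l) = (√(normSq p i j l) : ℂ) • normalized f i j l)
    (hp : 1 ≤ p) {i j l : ℕ} (h : p = 1 → l = 0) :
    toEnv 2 (bMinus 1) • normalized f i j l =
      ((√(j : ℝ) * f1 p (l + i + j - 1) l : ℝ) : ℂ) • normalized f i (j - 1) l +
        ((√((i : ℝ) + 1) * f2 p (l + i + j) (l - 1) : ℝ) : ℂ) • normalized f (i + 1) j (l - 1) := by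
  rw [bMinus_smul_normalized, modelMinus_one, map_add, LinearMap.map_smul_of_tower,
    LinearMap.map_smul_of_tower, hf, hf, smul_add, smul_smul, smul_smul, smul_smul, smul_smul]
  congr 1
  · rcases j with _ | j
    · simp
    · rw [gCoef_succ_right, oddCeil_succ_right, ← lower_first_coef (i := i) (j := j + 1) (l := l)
        (m := i + j) (n := (j + 1 : ℕ)) (a := normSq p i j l) (n' := normSq p i (j + 1) l)
        (normSq_pos_of_le hp h) hp (by positivity) (by push_cast; ring)
        (by rw [normSq_succ_right]; push_cast; rfl)]
      push_cast
      rfl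
  · rcases l with _ | l
    · simp [hCoef_zero, f2_eq, qUp, evenFn]
    · rw [hCoef_nat_succ, add_tsub_cancel_right, ← lower_second_coef
        (normSq_pos_of_le hp fun h1 => absurd (h h1) (by simp)) hp (by positivity)
        (normSq_exchange_left i j l)]

end

end

/-! ### The Gelfand–Zetlin basis -/

section

section
variable {p : ℝ} {W : Type*} [AddCommGroup W] [Module ℂ W] [Module (Env 2) W]

/-- The normalized images of the monomials, labelled by Gelfand–Zetlin patterns. -/
def patternVec (f : Model p →ₗ[Env 2] W) (m12 m22 m11 : ℤ) : W :=
  if 0 ≤ m22 ∧ m22 ≤ m11 ∧ m11 ≤ m12 then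
    normalized f (m11 - m22).toNat (m12 - m11).toNat m22.toNat
  else 0

theorem patternVec_eq (f : Model p →ₗ[Env 2] W) {m12 m22 m11 : ℤ} (i j l : ℕ) (h22 : m22 = l)
    (h11 : m11 = l + i) (h12 : m12 = l + i + j) :
    patternVec f m12 m22 m11 = normalized f i j l := by
  rw [patternVec, if_pos (by omega)]
  congr 1 <;> omega

theorem exists_eq_of_le {m12 m22 m11 : ℤ} (h : 0 ≤ m22 ∧ m22 ≤ m11 ∧ m11 ≤ m12) :
    ∃ i j l : ℕ, m22 = l ∧ m11 = l + i ∧ m12 = l + i + j :=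
  ⟨(m11 - m22).toNat, (m12 - m11).toNat, m22.toNat, by omega, by omega, by omega⟩

theorem IsPattern.exists_eq {m12 m22 m11 : ℤ} (h : IsPattern p m12 m22 m11) :
    ∃ i j l : ℕ, (p = 1 → l = 0) ∧ m22 = l ∧ m11 = l + i ∧ m12 = l + i + j := by
  obtain ⟨i, j, l, h22, h11, h12⟩ := exists_eq_of_le ⟨h.1, h.2.1, h.2.2.1⟩
  exact ⟨i, j, l, fun hp => by have := h.2.2.2 hp; omega, h22, h11, h12⟩

theorem f2_neg_one (k : ℤ) : f2 p k (-1) = 0 := by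
  simp [f2, evenFn]

variable {f : Model p →ₗ[Env 2] W} {c : InnerProductSpace.Core ℂ W}

theorem inner_normalized
    (hf : ∀ i j l i' j' l', c.inner (f (mono p i j l)) (f (mono p i' j' l')) =
      if i = i' ∧ j = j' ∧ l = l' then (normSq p i j l : ℂ) else 0) {i j l : ℕ}
    (h : 0 < normSq p i j l) : c.inner (normalized f i j l) (normalized f i j l) = 1 := by
  have h2 := (Real.sqrt_pos.2 h).ne'
  rw [normalized, c.smul_left, core_smul_right, hf, if_pos ⟨rfl, rfl, rfl⟩, map_inv₀,
    Complex.conj_ofReal]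
  nth_rewrite 3 [← Real.mul_self_sqrt h.le]
  norm_cast
  field_simp

theorem inner_normalized_of_ne
    (hf : ∀ i j l i' j' l', c.inner (f (mono p i j l)) (f (mono p i' j' l')) =
      if i = i' ∧ j = j' ∧ l = l' then (normSq p i j l : ℂ) else 0) {i j l i' j' l' : ℕ}
    (h : ¬(i = i' ∧ j = j' ∧ l = l')) :
    c.inner (normalized f i j l) (normalized f i' j' l') = 0 := by
  rw [normalized, normalized, c.smul_left, core_smul_right, hf, if_neg h, mul_zero, mul_zero]

end

theorem isGZBasis_patternVec {p : ℝ} (hp : 1 ≤ p) {f : Model p →ₗ[Env 2] V 2 p}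
    (hvac : f (mono p 0 0 0) = vac 2 p) (hs : Function.Surjective f)
    {c : InnerProductSpace.Core ℂ (V 2 p)}
    (hf : ∀ i j l i' j' l', c.inner (f (mono p i j l)) (f (mono p i' j' l')) =
      if i = i' ∧ j = j' ∧ l = l' then (normSq p i j l : ℂ) else 0) :
    IsGZBasis p c (patternVec f) where
  eq_zero m12 m22 m11 h := by
    rw [patternVec]
    split_ifs with h'
    · obtain ⟨h22, h11, h12⟩ := h'
      obtain ⟨rfl, h0⟩ : p = 1 ∧ m22 ≠ 0 := by
        by_contra! h1
        exact h ⟨h22, h11, h12, h1⟩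
      -- Only the null monomials at p = 1 are left; their normalizing factor is 0⁻¹ = 0.
      rw [normalized, normSq_one, if_neg (by omega)]
      simp
    · rfl
  vacuum := by
    rw [patternVec_eq f 0 0 0 (by simp) (by simp) (by simp), normalized, hvac,
      show normSq p 0 0 0 = 1 by simp [normSq]]
    simp
  norm_one m12 m22 m11 h := by
    obtain ⟨i, j, l, hl, h22, h11, h12⟩ := h.exists_eq
    rw [patternVec_eq f i j l h22 h11 h12]
    exact inner_normalized hf (normSq_pos_of_le hp hl)
  orthogonal m12 m22 m11 m12' m22' m11' h := by
    by_cases h1 : 0 ≤ m22 ∧ m22 ≤ m11 ∧ m11 ≤ m12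
    · by_cases h2 : 0 ≤ m22' ∧ m22' ≤ m11' ∧ m11' ≤ m12'
      · obtain ⟨i, j, l, h22, h11, h12⟩ := exists_eq_of_le h1
        obtain ⟨i', j', l', h22', h11', h12'⟩ := exists_eq_of_le h2
        rw [patternVec_eq f i j l h22 h11 h12, patternVec_eq f i' j' l' h22' h11' h12']
        refine inner_normalized_of_ne hf fun ⟨hi, hj, hl⟩ => h ?_
        rw [Prod.mk.injEq, Prod.mk.injEq]
        omega
      · rw [patternVec.eq_def _ m12', if_neg h2, core_zero_right]
    · rw [patternVec, if_neg h1, core_zero_left]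
  span_eq_top := by
    rw [eq_top_iff]
    rintro v -
    obtain ⟨w, rfl⟩ := hs v
    induction (modelBasis p).mem_span w using Submodule.span_induction with
    | mem x hx =>
      obtain ⟨⟨i, j, l⟩, rfl⟩ := hx
      change f (mono p i j l) ∈ _
      rw [map_mono_eq hf hp]
      exact Submodule.smul_mem _ _ (Submodule.subset_span ⟨l + i + j, l, l + i,
        (patternVec_eq f i j l rfl rfl rfl).symm⟩)
    | zero => rw [map_zero]; exact Submodule.zero_mem _
    | add x y _ _ hx hy => rw [map_add]; exact Submodule.add_mem _ hx hy
    | smul a x _ hx => rw [LinearMap.map_smul_of_tower]; exact Submodule.smul_mem _ _ hx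
  act1Plus m12 m22 m11 h := by
    obtain ⟨i, j, l, hl, rfl, rfl, rfl⟩ := h.exists_eq
    rw [actPlus, patternVec_eq f i j l rfl rfl rfl, patternVec_eq f (i + 1) j l rfl
      (by push_cast; ring) (by push_cast; ring),
      normalized_raise_zero (map_mono_eq hf hp) hp (normSq_pos_of_le hp hl)]
    congr 1
    · push_cast
      congr 5
      ring
    -- At j = 0 the raised label is not a pattern, and its coefficient √(m₁₂ − m₁₁) is zero.
    · rcases j with _ | j
      · simp
      · rw [patternVec_eq f i j (l + 1) (Nat.cast_succ l).symm (by push_cast; ring)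
          (by push_cast; ring), add_tsub_cancel_right]
        push_cast
        congr 4
        ring
  act2Plus m12 m22 m11 h := by
    obtain ⟨i, j, l, hl, rfl, rfl, rfl⟩ := h.exists_eq
    rw [actPlus, patternVec_eq f i j l rfl rfl rfl, patternVec_eq f i (j + 1) l rfl rfl
      (by push_cast; ring), normalized_raise_one (map_mono_eq hf hp) hp (normSq_pos_of_le hp hl)]
    congr 1
    · push_cast
      congr 5
      ring
    · rcases i with _ | i
      · simp
      · rw [patternVec_eq f i j (l + 1) (Nat.cast_succ l).symm (by push_cast; ring)
          (by push_cast; ring), add_tsub_cancel_right]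
        push_cast
        congr 4
        ring
  act1Minus m12 m22 m11 h := by
    obtain ⟨i, j, l, hl, rfl, rfl, rfl⟩ := h.exists_eq
    rw [actMinus, patternVec_eq f i j l rfl rfl rfl,
      normalized_lower_zero (map_mono_eq hf hp) hp hl]
    congr 1
    · rcases i with _ | i
      · simp
      · rw [patternVec_eq f i j l rfl (by push_cast; ring) (by push_cast; ring),
          add_tsub_cancel_right]
        push_cast
        congr 4
        ring
    · rcases l with _ | l
      · simp [f2_neg_one]
      · rw [patternVec_eq f i (j + 1) l (by push_cast; ring) (by push_cast; ring)
          (by push_cast; ring), add_tsub_cancel_right]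
        push_cast
        congr 5
        ring
  act2Minus m12 m22 m11 h := by
    obtain ⟨i, j, l, hl, rfl, rfl, rfl⟩ := h.exists_eq
    rw [actMinus, patternVec_eq f i j l rfl rfl rfl, normalized_lower_one (map_mono_eq hf hp) hp hl]
    congr 1
    · rcases j with _ | j
      · simp
      · rw [patternVec_eq f i j l rfl rfl (by push_cast; ring), add_tsub_cancel_right]
        push_cast
        congr 4
        ring
    · rcases l with _ | l
      · simp [f2_neg_one]
      · rw [patternVec_eq f (i + 1) j l (by push_cast; ring) (by push_cast; ring)
          (by push_cast; ring), add_tsub_cancel_right]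
        push_cast
        congr 5
        ring

end

/-! ### Transfer to V(p) -/

section

section
variable {n : ℕ} {W W' : Type*} [AddCommGroup W] [Module ℂ W] [Module (Env n) W]
  [IsScalarTower ℂ (Env n) W] [AddCommGroup W'] [Module ℂ W'] [Module (Env n) W']
  [IsScalarTower ℂ (Env n) W']

theorem map_mem_weightSpace (f : W →ₗ[Env n] W') {μ : Fin n → ℂ} {v : W}
    (hv : v ∈ weightSpace W μ) : f v ∈ weightSpace W' μ := by
  rw [mem_weightSpace] at hv ⊢
  intro j
  rw [← map_smul, hv j, LinearMap.map_smul_of_tower]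

/-- No proper submodule can lie strictly above the sum of all proper submodules. -/
theorem isSimpleModule_V {p : ℝ} (h : maxSub n p ≠ ⊤) : IsSimpleModule (Env n) (V n p) := by
  change IsSimpleModule (Env n) (Vbar n p ⧸ maxSub n p)
  rw [isSimpleModule_iff_isCoatom]
  refine ⟨h, fun N hN => ?_⟩
  by_contra hT
  exact hN.not_ge (le_sSup hT)

/-- The first isomorphism theorem for a map whose kernel is the maximal submodule. -/
def vEquiv {W : Type*} [AddCommGroup W] [Module (Env n) W] {p : ℝ}
    (f : Vbar n p →ₗ[Env n] W) (hs : Function.Surjective f)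
    (hk : LinearMap.ker f = maxSub n p) : V n p ≃ₗ[Env n] W :=
  (Submodule.quotEquivOfEq _ _ hk.symm).trans (f.quotKerEquivOfSurjective hs)

theorem vEquiv_vac {W : Type*} [AddCommGroup W] [Module (Env n) W] {p : ℝ}
    (f : Vbar n p →ₗ[Env n] W) (hs : Function.Surjective f)
    (hk : LinearMap.ker f = maxSub n p) : vEquiv f hs hk (vac n p) = f (vbarVac n p) := rfl

theorem vac_ne_zero {p : ℝ} [Nontrivial (V n p)] : vac n p ≠ 0 := by
  intro h
  obtain ⟨v, hv⟩ := exists_ne (0 : V n p)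
  obtain ⟨w, rfl⟩ := toV_surjective p v
  obtain ⟨u, rfl⟩ := exists_smul_vbarVac p w
  refine hv ?_
  rw [map_smul]
  exact (congrArg (u • ·) h).trans (smul_zero u)

/-- Irreducibility only serves to make the vacuum nonzero; the bound itself comes from the star
form. -/
theorem IsUnirrep.one_le {p : ℝ} (hp : p ≠ 0) (h : IsUnirrep 2 (V 2 p)) : 1 ≤ p := by
  obtain ⟨hs, c, hc⟩ := h
  have := IsSimpleModule.nontrivial (Env 2) (V 2 p)
  exact hc.one_le hp (isVacuum_vac p) vac_ne_zero

end

theorem map_mono_zero_ne_zero {p : ℝ} {W : Type*} [AddCommGroup W] [Module ℂ W] [Module (Env 2) W]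
    {g : Model p →ₗ[Env 2] W} {c : InnerProductSpace.Core ℂ W}
    (hg : ∀ i j l i' j' l', c.inner (g (mono p i j l)) (g (mono p i' j' l')) =
      if i = i' ∧ j = j' ∧ l = l' then (normSq p i j l : ℂ) else 0) : g (mono p 0 0 0) ≠ 0 := by
  intro h
  have := hg 0 0 0 0 0 0
  rw [h, core_zero_left] at this
  simp [normSq] at this

section
variable {p : ℝ} {W : Type*} [AddCommGroup W] [Module ℂ W] [Module (Env 2) W]
  [IsScalarTower ℂ (Env 2) W] {g : Model p →ₗ[Env 2] W} {c : InnerProductSpace.Core ℂ W}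

theorem ker_comp_toModel (hc : IsStarForm (n := 2) c)
    (h0 : g (mono p 0 0 0) ≠ 0) : LinearMap.ker (g ∘ₗ toModel p) = maxSub 2 p :=
  ker_eq_maxSub _ hc (by rwa [LinearMap.comp_apply, toModel_vbarVac])

/-- The description of `V(p)` by a quotient of the model carrying an inner product. -/
theorem exists_equiv_of_model_quotient (hp : 1 ≤ p) (hs : Function.Surjective g)
    (hc : IsStarForm (n := 2) c)
    (hg : ∀ i j l i' j' l', c.inner (g (mono p i j l)) (g (mono p i' j' l')) =
      if i = i' ∧ j = j' ∧ l = l' then (normSq p i j l : ℂ) else 0) :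
    IsSimpleModule (Env 2) (V 2 p) ∧ ∃ E : V 2 p ≃ₗ[Env 2] W, E (vac 2 p) = g (mono p 0 0 0) ∧
      ∃ c' : InnerProductSpace.Core ℂ (V 2 p), (∀ v w, c'.inner v w = c.inner (E v) (E w)) ∧
        IsStarForm (n := 2) c' ∧ ∃ e, IsGZBasis p c' e := by
  have h0 := map_mono_zero_ne_zero hg
  have hk := ker_comp_toModel hc h0
  let E := vEquiv _ (hs.comp toModel_surjective) hk
  have hE : E (vac 2 p) = g (mono p 0 0 0) := by
    rw [vEquiv_vac, LinearMap.comp_apply, toModel_vbarVac]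
  refine ⟨isSimpleModule_V fun h => h0 ?_, E, hE,
    coreComap c (E.toLinearMap.restrictScalars ℂ) E.injective, fun _ _ => rfl, ?_,
    patternVec (E.symm.toLinearMap ∘ₗ g), ?_⟩
  · have : vbarVac 2 p ∈ LinearMap.ker (g ∘ₗ toModel p) := by rw [hk, h]; trivial
    rwa [LinearMap.mem_ker, LinearMap.comp_apply, toModel_vbarVac] at this
  · intro j v w
    change c.inner (E (_ • v)) (E w) = c.inner (E v) (E (_ • w))
    rw [map_smul, map_smul]
    exact hc j (E v) (E w)
  · refine isGZBasis_patternVec hp ?_ (E.symm.surjective.comp hs) fun i j l i' j' l' => ?_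
    · rw [LinearMap.comp_apply, ← hE]
      exact E.symm_apply_apply _
    · change c.inner (E (E.symm _)) (E (E.symm _)) = _
      rw [E.apply_symm_apply, E.apply_symm_apply, hg]

theorem hasChar_of_equiv {ι : Type*} (E : V 2 p ≃ₗ[Env 2] W) (b : Module.Basis ι ℂ W)
    (σ : Fin 2 → ℂ) (r : ι → Fin 2 →₀ ℕ) (hb : ∀ i, b i ∈ weightSpace W (fun j => σ j + r i j))
    (hfin : ∀ k, (r ⁻¹' {k}).Finite) {F : MvPowerSeries (Fin 2) ℚ}
    (hF : ∀ k, ((r ⁻¹' {k}).ncard : ℚ) = MvPowerSeries.coeff k F) : HasChar (V 2 p) σ F :=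
  hasChar_of_basis (b.map (E.symm.restrictScalars ℂ)) σ r
    (fun i => by
      rw [Module.Basis.map_apply]
      exact map_mem_weightSpace E.symm.toLinearMap (hb i)) hfin hF

end

section
variable {p : ℝ}

theorem model_data (hp : 1 < p) :
    IsSimpleModule (Env 2) (V 2 p) ∧ ∃ E : V 2 p ≃ₗ[Env 2] Model p,
      E (vac 2 p) = mono p 0 0 0 ∧
      ∃ c : InnerProductSpace.Core ℂ (V 2 p),
        (∀ v w, c.inner v w = (modelCore hp).inner (E v) (E w)) ∧
        IsStarForm (n := 2) c ∧ ∃ e, IsGZBasis p c e :=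
  exists_equiv_of_model_quotient (g := LinearMap.id) hp.le Function.surjective_id
    (isStarForm_modelCore hp) (modelCore_mono hp)

theorem modelToFock_mono_zero : modelToFock (mono 1 0 0 0) = fockVac 2 := by
  refine (fockEquiv 2).injective ?_
  rw [modelToFock_mono, if_pos rfl, fockVac, LinearEquiv.apply_symm_apply, pow_zero, pow_zero,
    one_mul]

theorem modelToFock_surjective : Function.Surjective modelToFock := by
  intro v
  obtain ⟨w, rfl⟩ := fock_vbarLift_surjective v
  refine ⟨toModel 1 w, ?_⟩
  obtain ⟨u, rfl⟩ := exists_smul_vbarVac 1 w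
  rw [map_smul, map_smul, map_smul, toModel_vbarVac, vbarLift_vbarVac, modelToFock_mono_zero]

theorem maxSub_eq_bot (hp : 1 < p) : maxSub 2 p = ⊥ := by
  rw [← ker_comp_toModel (g := LinearMap.id) (isStarForm_modelCore hp)
    (map_mono_zero_ne_zero (c := modelCore hp) (modelCore_mono hp)), LinearMap.id_comp,
    LinearMap.ker_eq_bot]
  exact toModel_injective

/-- M(1) is the kernel of the map to Fock space, and a preimage of the monomial t is a nonzero
element of it. -/
theorem maxSub_one_ne_bot : maxSub 2 1 ≠ ⊥ := by
  intro h
  rw [← ker_comp_toModel isStarForm_fockCore (map_mono_zero_ne_zero fockCore_modelToFock_mono),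
    LinearMap.ker_eq_bot] at h
  obtain ⟨v, hv⟩ := toModel_surjective (mono 1 0 0 1)
  have h1 : v = 0 := h <| by
    refine (fockEquiv 2).injective ?_
    rw [LinearMap.comp_apply, hv, modelToFock_mono, map_zero, map_zero, if_neg one_ne_zero]
  rw [h1, map_zero] at hv
  exact (modelBasis 1).ne_zero (0, 0, 1) hv.symm

theorem preimage_equivFunOnFinite_symm_comp {ι : Type*} (r : ι → Fin 2 → ℕ) (k : Fin 2 →₀ ℕ) :
    (fun i => Finsupp.equivFunOnFinite.symm (r i)) ⁻¹' {k} = r ⁻¹' {⇑k} := by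
  ext i
  rw [Set.mem_preimage, Set.mem_preimage, Set.mem_singleton_iff, Set.mem_singleton_iff,
    Equiv.symm_apply_eq]
  rfl

theorem hasChar_V (hp : 1 < p) :
    HasChar (V 2 p) (fun _ : Fin 2 => (p : ℂ) / 2)
      ((1 - MvPowerSeries.X 0) * (1 - MvPowerSeries.X 1) *
        (1 - MvPowerSeries.X 0 * MvPowerSeries.X 1))⁻¹ := by
  obtain ⟨-, E, -⟩ := model_data hp
  refine hasChar_of_equiv E (modelBasis p) _ (fun m => Finsupp.equivFunOnFinite.symm (rel m))
    (fun m => mono_mem_weightSpace m.1 m.2.1 m.2.2) (fun k => ?_) (fun k => ?_)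
  · rw [preimage_equivFunOnFinite_symm_comp]
    exact rel_fiber_finite k
  · rw [preimage_equivFunOnFinite_symm_comp, rel_fiber_ncard, coeff_inv_three]

theorem fock_data : IsSimpleModule (Env 2) (V 2 1) ∧ ∃ E : V 2 1 ≃ₗ[Env 2] FockModule 2,
    E (vac 2 1) = fockVac 2 ∧ ∃ c : InnerProductSpace.Core ℂ (V 2 1),
      (∀ v w, c.inner v w = (fockCore 2).inner (E v) (E w)) ∧
      IsStarForm (n := 2) c ∧ ∃ e, IsGZBasis 1 c e := by
  rw [← modelToFock_mono_zero]
  exact exists_equiv_of_model_quotient le_rfl modelToFock_surjective isStarForm_fockCore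
    fockCore_modelToFock_mono

theorem hasChar_V_one : HasChar (V 2 1) (fun _ : Fin 2 => (1 : ℂ) / 2)
    ((1 - MvPowerSeries.X 0) * (1 - MvPowerSeries.X 1))⁻¹ := by
  obtain ⟨-, E, -⟩ := fock_data
  refine hasChar_of_equiv E (fockBasis 2) _ id fockBasis_mem_weightSpace (fun k => ?_) (fun k => ?_)
  · exact Set.finite_singleton k
  · rw [Set.preimage_id, Set.ncard_singleton, coeff_inv_two, Nat.cast_one]

theorem isUnirrep_V (hp : 1 ≤ p) : IsUnirrep 2 (V 2 p) := by
  rcases hp.eq_or_lt with rfl | hp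
  · obtain ⟨hs, -, -, c, -, hc, -⟩ := fock_data
    exact ⟨hs, c, hc⟩
  · obtain ⟨hs, -, -, c, -, hc, -⟩ := model_data hp
    exact ⟨hs, c, hc⟩

end

end

end Paraboson

end

theorem theorem1 (p : ℝ) (hp : p ≠ 0) :
    (Paraboson.IsUnirrep 2 (Paraboson.V 2 p) ↔ 1 ≤ p) ∧
    (1 < p →
      Paraboson.maxSub 2 p = ⊥ ∧
      Paraboson.HasChar (Paraboson.V 2 p) (fun _ : Fin 2 => (p : ℂ) / 2)
        ((1 - MvPowerSeries.X 0) * (1 - MvPowerSeries.X 1) *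
          (1 - MvPowerSeries.X 0 * MvPowerSeries.X 1))⁻¹) ∧
    (p = 1 →
      Paraboson.maxSub 2 p ≠ ⊥ ∧
      Paraboson.HasChar (Paraboson.V 2 p) (fun _ : Fin 2 => (1 : ℂ) / 2)
        ((1 - MvPowerSeries.X 0) * (1 - MvPowerSeries.X 1))⁻¹) ∧
    (1 ≤ p → ∃ c : InnerProductSpace.Core ℂ (Paraboson.V 2 p),
      Paraboson.IsStarForm (n := 2) c ∧
      (∃ e : ℤ → ℤ → ℤ → Paraboson.V 2 p, Paraboson.IsGZBasis p c e) ∧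
      (p = 1 → ∃ Φ : Paraboson.V 2 p ≃ₗ[ℂ] Paraboson.BosonFock 2,
        Φ (Paraboson.vac 2 p) = 1 ∧
        (∀ v w, Paraboson.bosonInner (Φ v) (Φ w) = c.inner v w) ∧
        (∀ j v, Φ (Paraboson.actPlus j v) = Paraboson.bosonPlus j (Φ v)) ∧
        (∀ j v, Φ (Paraboson.actMinus j v) = Paraboson.bosonMinus j (Φ v)))) := by
  refine ⟨⟨fun h => h.one_le hp, Paraboson.isUnirrep_V⟩,
    fun h => ⟨Paraboson.maxSub_eq_bot h, Paraboson.hasChar_V h⟩,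
    fun h => h ▸ ⟨Paraboson.maxSub_one_ne_bot, Paraboson.hasChar_V_one⟩, fun h => ?_⟩
  rcases h.eq_or_lt with rfl | h
  · obtain ⟨-, E, hE, c, hc, hstar, he⟩ := Paraboson.fock_data
    refine ⟨c, hstar, he, fun _ => ⟨(E.restrictScalars ℂ).trans (Paraboson.fockEquiv 2), ?_,
      fun v w => ?_, fun j v => ?_, fun j v => ?_⟩⟩
    · exact congrArg (Paraboson.fockEquiv 2) hE
    · rw [hc]
      exact Paraboson.bosonInner_eq (E v) (E w)
    · exact (congrArg (Paraboson.fockEquiv 2) (E.map_smul _ v)).trans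
        (Paraboson.fockEquiv_bPlus_smul j (E v))
    · exact (congrArg (Paraboson.fockEquiv 2) (E.map_smul _ v)).trans
        (Paraboson.fockEquiv_bMinus_smul j (E v))
  · obtain ⟨-, -, -, c, -, hstar, he⟩ := Paraboson.model_data h
    exact ⟨c, hstar, he, fun h1 => absurd h1 h.ne'⟩
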